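/- All Hilbert spaces are finite-dimensional. $\mathcal S(A)$ denotes the positive semidefinite operators on the Hilbert space of a quantum system $A$ (not necessarily of trace one). Write $\rho\ll\sigma$ if $\ker\sigma\subseteq\ker\rho$, and $\rho\perp\sigma$ if $\rho\sigma=\sigma\rho=0$. Powers of positive semidefinite operators are taken on the support (the kernel is ignored), and $\log$ is the natural logarithm. For real $\alpha\in(0,1)\cup(1,\infty)$ and $\rho,\sigma\in\mathcal S(A)$ let $$\tilde Q_\alpha(\rho\|\sigma)=\operatorname{tr}\Big(\big(\sigma^{\frac{1-\alpha}{2\alpha}}\rho\,\sigma^{\frac{1-\alpha}{2\alpha}}\big)^{\alpha}\Big),$$ and, for $\rho\neq0$, let the minimal (sandwiched) quantum Rényi divergence be $$\tilde D_\alpha(\rho\|\sigma)=\frac1{\alpha-1}\log\frac{\tilde Q_\alpha(\rho\|\sigma)}{\operatorname{tr}\rho}\ \text{ if }(\alpha<1\text{ and }\rho\not\perp\sigma)\text{ or }\rho\ll\sigma,\qquad \tilde D_\alpha(\rho\|\sigma)=+\infty\ \text{ otherwise};$$ $\tilde D_1$ and $\tilde D_\infty$ are the limits of $\tilde D_\alpha$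 as $\alpha\to1$ and $\alpha\to\infty$. For nonnegative functions $p\ne 0$ and $q$ on a finite set, the classical Rényi divergence is $D_\alpha(p\|q)=\frac1{\alpha-1}\log\frac{\sum_x p(x)^\alpha q(x)^{1-\alpha}}{\sum_x p(x)}$ for $\alpha\in(0,1)\cup(1,\infty)$, $D_1(p\|q)=\frac{\sum_x p(x)(\log p(x)-\log q(x))}{\sum_x p(x)}$ and $D_\infty(p\|q)=\max_{x:p(x)>0}\log\frac{p(x)}{q(x)}$; it is $+\infty$ if $\alpha\ge1$ and the support of $p$ is not contained in that of $q$, or if $\alpha<1$ and the supports are disjoint. **Theorem.** The limits defining $\tilde D_1(\rho\|\sigma)$ and $\tilde D_\infty(\rho\|\sigma)$ exist in the extended real line for all $\rho,\sigma\in\mathcal S(A)$ with $\rho\ne0$. Let $\alpha\in[\frac12,\infty]$. Then: 1. If $\alpha\in[\frac12,1)$, the functional $(\rho,\sigma)\mapsto\tilde Q_\alpha(\rho\|\sigma)$ is jointly concave on $\mathcal S(A)\times\mathcal S(A)$. If $\alpha\in(1,\infty)$, it is jointly convex on the set of pairs $\rho,\sigma\in\mathcal S(A)$ with $\rho\ll\sigma$.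 2. If $\alpha\in(\frac12,1]$, the functional $(\rho,\sigma)\mapsto\tilde D_\alpha(\rho\|\sigma)$ is jointly convex on pairs of elements of $\mathcal S(A)$ whose first component has a fixed nonzero trace (in particular, on pairs of normalized states). 3. (Data processing) For every completely positive trace-preserving map $\mathcal E$ from $A$ to $B$ and all $\rho,\sigma\in\mathcal S(A)$ with $\rho\neq0$, $$\tilde D_\alpha(\rho\|\sigma)\ \ge\ \tilde D_\alpha(\mathcal E(\rho)\|\mathcal E(\sigma)).$$ 4. (Asymptotic achievability by measurements) For all $\rho,\sigma\in\mathcal S(A)$ with $\rho\neq0$, $$\tilde D_\alpha(\rho\|\sigma)=\lim_{n\to\infty}\frac1n\max_{\mathcal M_n}D_\alpha\big(\mathcal M_n(\rho^{\otimes n})\,\big\|\,\mathcal M_n(\sigma^{\otimes n})\big),$$ where, for each $n$, the maximum is attained and runs over all measurements (POVMs) $\mathcal M_n=\{M_x\}$ on $A^{n}$ with finitely many outcomes, and $\mathcal M_n(\omega)$ is the function $x\mapsto\operatorname{tr}(\omega M_x)$. -/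

import Mathlib

open Matrix Filter Topology
open scoped ENNReal ComplexOrder

noncomputable section

namespace QuantumRenyi

/-! A finite-dimensional quantum system with an orthonormal basis indexed by the finite type `a` is
the Hilbert space `ℂ^a`; operators on it are matrices `Matrix a a ℂ`, and the positive functionals
(not necessarily normalized states) are the positive semidefinite matrices.
Divergences take values in the extended reals, and `log` is the natural logarithm. -/

section Operators

variable {a : Type*} [Fintype a]

/-- `L ≪ K`: the kernel of `K` is contained in the kernel of `L`. -/
def Dominated (L K : Matrix a a ℂ) : Prop :=
  ∀ v : a → ℂ, K *ᵥ v = 0 → L *ᵥ v = 0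

/-- `K ⟂ L`, that is `K L = L K = 0`. -/
def Orthogonal (K L : Matrix a a ℂ) : Prop :=
  K * L = 0 ∧ L * K = 0

/-- The (real) trace of a self-adjoint operator. -/
def rtr (L : Matrix a a ℂ) : ℝ := L.trace.re

/-- The power `M ^ s` of a positive semidefinite matrix by functional calculus. As
`(0 : ℝ) ^ s = 0` for `s ≠ 0`, the kernel of `M` is ignored, also when `s < 0`. All exponents used
below are nonzero. -/
def power [DecidableEq a] (M : Matrix a a ℂ) (s : ℝ) : Matrix a a ℂ :=
  cfc (fun x : ℝ => x ^ s) M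

/-- The functional
`Q_α(ρ‖σ) = ‖σ^((1-α)/(2α)) ρ σ^((1-α)/(2α))‖_α^α = tr ((σ^((1-α)/(2α)) ρ σ^((1-α)/(2α)))^α)`,
for real `α ∈ (0,1) ∪ (1,∞)`. -/
def minimalQ [DecidableEq a] (α : ℝ) (ρ σ : Matrix a a ℂ) : ℝ :=
  rtr (power (power σ ((1 - α) / (2 * α)) * ρ * power σ ((1 - α) / (2 * α))) α)

open Classical in
/-- The minimal (sandwiched) quantum Rényi divergence of real order `α ∈ (0,1) ∪ (1,∞)`. -/
def minimalDivReal [DecidableEq a] (α : ℝ) (ρ σ : Matrix a a ℂ) : EReal :=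
  if (α < 1 ∧ ¬ Orthogonal ρ σ) ∨ Dominated ρ σ then
    ((1 / (α - 1) * Real.log (minimalQ α ρ σ / rtr ρ) : ℝ) : EReal)
  else ⊤

open Classical in
/-- The minimal quantum Rényi divergence of order `α ∈ (0, ∞]`; the orders `1` and `∞` are defined
as limits. -/
def minimalDiv [DecidableEq a] (α : ℝ≥0∞) (ρ σ : Matrix a a ℂ) : EReal :=
  if α = ⊤ then limUnder atTop (fun β : ℝ => minimalDivReal β ρ σ)
  else if α = 1 then limUnder (𝓝[≠] 1) (fun β : ℝ => minimalDivReal β ρ σ)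
  else minimalDivReal α.toReal ρ σ

/-- The `n`-fold tensor power, as a matrix over the product basis `Fin n → a`. -/
def tensorPow (ρ : Matrix a a ℂ) (n : ℕ) : Matrix (Fin n → a) (Fin n → a) ℂ :=
  fun i j => ∏ k, ρ (i k) (j k)

end Operators

section Channels

variable {a b : Type*} [Fintype a] [Fintype b]

/-- The action of `E ⊗ id` on an operator of the joint system of `a` and an auxiliary system `c`. -/
def tensorId {c : Type*} (E : Matrix a a ℂ →ₗ[ℂ] Matrix b b ℂ) (ω : Matrix (a × c) (a × c) ℂ) :
    Matrix (b × c) (b × c) ℂ :=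
  fun i j => E (fun x y => ω (x, i.2) (y, j.2)) i.1 j.1

/-- Completely positive trace-preserving maps (quantum channels). -/
structure IsCPTP (E : Matrix a a ℂ →ₗ[ℂ] Matrix b b ℂ) : Prop where
  completely_positive : ∀ (m : ℕ) (ω : Matrix (a × Fin m) (a × Fin m) ℂ),
    ω.PosSemidef → (tensorId E ω).PosSemidef
  trace_preserving : ∀ ξ : Matrix a a ℂ, (E ξ).trace = ξ.trace

end Channels

section Classical

/-- The classical Rényi divergence of order `α ∈ (0, ∞]` of (not necessarily normalized)
nonnegative functions `p, q` on a finite set, `p ≠ 0`: order `1` is the Kullback-Leibler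
divergence, order `∞` the largest log-likelihood ratio on the support of `p`. It is `+∞` if
`α < 1` and the supports are disjoint, or if `α ≥ 1` and the support of `p` is not contained in
that of `q`. -/
def classicalDiv {x : Type*} [Fintype x] (α : ℝ≥0∞) (p q : x → ℝ) : EReal :=
  open Classical in
  if α = ⊤ then
    ⨆ i : x, ⨆ _ : p i ≠ 0, if q i = 0 then (⊤ : EReal) else ((Real.log (p i / q i) : ℝ) : EReal)
  else if α = 1 then
    if ∀ i, q i = 0 → p i = 0 then
      (((∑ i, p i * (Real.log (p i) - Real.log (q i))) / ∑ i, p i : ℝ) : EReal)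
    else ⊤
  else if (α < 1 ∧ ∃ i, p i ≠ 0 ∧ q i ≠ 0) ∨ ∀ i, q i = 0 → p i = 0 then
    ((1 / (α.toReal - 1) *
      Real.log ((∑ i, p i ^ α.toReal * q i ^ (1 - α.toReal)) / ∑ i, p i) : ℝ) : EReal)
  else ⊤

end Classical

section Measurements

variable {a : Type*} [Fintype a] [DecidableEq a]

/-- A positive operator valued measure with outcomes in the finite set `x`. -/
structure IsPOVM {x : Type*} [Fintype x] (M : x → Matrix a a ℂ) : Prop where
  posSemidef : ∀ i, (M i).PosSemidef
  sum_eq_one : ∑ i, M i = 1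

/-- The measurement map of `M`: the outcome distribution `i ↦ tr (ρ M_i)`, seen as a state of the
classical system `x`. -/
def measure {x : Type*} (M : x → Matrix a a ℂ) (ρ : Matrix a a ℂ) : x → ℝ :=
  fun i => rtr (ρ * M i)

/-- All values `D_α(M(ρ)‖M(σ))`, as `M` ranges over all measurements with finitely many outcomes. -/
def measuredDivs (α : ℝ≥0∞) (ρ σ : Matrix a a ℂ) : Set EReal :=
  {d | ∃ (k : ℕ) (M : Fin k → Matrix a a ℂ), IsPOVM M ∧
    d = classicalDiv α (measure M ρ) (measure M σ)}

end Measurements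

end QuantumRenyi

end

open QuantumRenyi

/-!
The functional `minimalQ` is multiplicative on tensor powers (`minimalQ_tensorPow`), so that an
inequality for it may be proved on `n` copies up to factors subexponential in `n`
(`le_of_pow_le_mul_pow`). On `n` copies the problem becomes classical up to such factors. The
eigenvalue of `σ^{⊗n}` at a product of eigenvectors of `σ` only depends on the type of the sequence
of factors, and there are at most `(n + 1) ^ |a|` types. Pinching `ρ^{⊗n}` along the types makes it
commute with `σ^{⊗n}`. It changes `minimalQ` only by a polynomial factor, by the pinching inequality
(`le_card_smul_pinch`) and by trace inequalities (`klein_rpow`, `rtr_mul_power_le`). Hence there is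
a basis (`IsPinchingBasis`) in which the two operators have the diagonals `r` and `m`, such that
`∑ r ^ α * m ^ (1 - α)` agrees with `minimalQ α ρ σ ^ n` up to a polynomial factor.

Measurements are compared with `minimalQ` in this way. For `α > 1`, the outcome distribution of
`ρ^{⊗n}` under a product measurement is bounded by a stochastic image of the classical pair
`(r, m)`, and classical data processing applies (`sum_measure_le_minimalQ`). For `1 / 2 ≤ α < 1`,
the functional is monotone in both arguments, so that both arguments may be pinched after a Naimark
dilation along the type of the sequence of outcomes, and Hölder's inequality is applied in each
block (`minimalQ_le_sum_measure`). Data processing for a channel follows by measuring its output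
on `n` copies in the basis above and pulling this measurement back along Kraus operators
(`minimalQ_kraus_le`, `le_minimalQ_kraus`). Joint convexity and concavity are data processing for
the partial trace of a direct sum (`minimalQ_add_le`, `le_minimalQ_add`), and the convexity of the
divergence follows from the concavity of the logarithm.

The same basis shows that measurements achieve the divergence up to an error of order `log n`
(`exists_le_classicalDiv`), while they never exceed it (`inv_mul_classicalDiv_le`). For the order
`1`, the divergence is a derivative of `β ↦ log (minimalQ β ρ σ)` at `1`
(`exists_tendsto_log_minimalQ`), and orders on both sides of `1` are used for the comparison. For
the order `∞`, it is the logarithm of the largest likelihood ratio, that is the least `c` with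
`ρ ≤ c σ`, which is attained by a single effect (`exists_max_ratio`,
`tendsto_minimalDivReal_atTop`). A measured divergence of finite order is a monotone function of
`∑ x, f (M x)` with `f` positively homogeneous, so that it attains its maximum by compactness of a
convex hull (`exists_optimal_povm`).
-/

set_option linter.unusedSectionVars false

noncomputable section

namespace QuantumRenyi

open scoped MatrixOrder

/-! ### Powers of positive semidefinite matrices -/

section PowerCalculus

variable {a b : Type*} [Fintype a] [DecidableEq a] [Fintype b] [DecidableEq b]

/-- The diagonal matrix with real entries `d`. -/
def rdiag (d : a → ℝ) : Matrix a a ℂ := diagonal fun i => (d i : ℂ)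

lemma rdiag_mul (d e : a → ℝ) : rdiag d * rdiag e = rdiag fun i => d i * e i := by
  simp [rdiag, diagonal_mul_diagonal]

lemma rdiag_conjTranspose (d : a → ℝ) : (rdiag d)ᴴ = rdiag d := by
  simp [rdiag, diagonal_conjTranspose, Pi.star_def]

lemma rdiag_posSemidef {d : a → ℝ} (hd : ∀ i, 0 ≤ d i) : (rdiag d).PosSemidef :=
  PosSemidef.diagonal fun i => by simpa using hd i

lemma rdiag_pow (d : a → ℝ) (k : ℕ) : rdiag d ^ k = rdiag fun i => d i ^ k := by
  simp [rdiag, diagonal_pow, Pi.pow_def]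

lemma rtr_rdiag (d : a → ℝ) : rtr (rdiag d) = ∑ i, d i := by
  simp [rtr, rdiag, trace_diagonal]

lemma rtr_add (A B : Matrix a a ℂ) : rtr (A + B) = rtr A + rtr B := by simp [rtr]

lemma rtr_sub (A B : Matrix a a ℂ) : rtr (A - B) = rtr A - rtr B := by simp [rtr]

lemma rtr_smul (c : ℝ) (A : Matrix a a ℂ) : rtr (c • A) = c * rtr A := by simp [rtr]

lemma rtr_sum {ι : Type*} (s : Finset ι) (A : ι → Matrix a a ℂ) :
    rtr (∑ i ∈ s, A i) = ∑ i ∈ s, rtr (A i) := by simp [rtr, trace_sum]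

lemma rtr_mul_comm (A : Matrix a b ℂ) (B : Matrix b a ℂ) : rtr (A * B) = rtr (B * A) := by
  simp [rtr, trace_mul_comm A B]

lemma rtr_nonneg {A : Matrix a a ℂ} (hA : A.PosSemidef) : 0 ≤ rtr A := by
  have := hA.trace_nonneg
  exact (Complex.le_def.1 this).1

lemma rtr_mono {A B : Matrix a a ℂ} (h : A ≤ B) : rtr A ≤ rtr B := by
  have := rtr_nonneg (Matrix.le_iff.1 h)
  rw [rtr_sub] at this; linarith

/-- The spectral theorem in terms of matrices, for Hermitian and positive semidefinite matrices at
once. -/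
lemma exists_unitary_rdiag {A : Matrix a a ℂ} (hA : A.IsHermitian) :
    ∃ (U : Matrix a a ℂ) (d : a → ℝ), Uᴴ * U = 1 ∧ U * Uᴴ = 1 ∧ A = U * rdiag d * Uᴴ ∧
      (A.PosSemidef → ∀ i, 0 ≤ d i) := by
  refine ⟨hA.eigenvectorUnitary, hA.eigenvalues, ?_, ?_, ?_, fun h i => h.eigenvalues_nonneg i⟩
  · exact Unitary.coe_star_mul_self hA.eigenvectorUnitary
  · exact Unitary.coe_mul_star_self hA.eigenvectorUnitary
  · have := hA.spectral_theorem
    rw [Unitary.conjStarAlgAut_apply] at this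
    exact this

/-- On finitely many points, a function vanishing at `0` agrees with a polynomial without constant
term. -/
lemma exists_polynomial_X_mul {f : ℝ → ℝ} (hf : f 0 = 0) {S : Set ℝ} (hS : S.Finite) :
    ∃ q : Polynomial ℝ, ∀ x ∈ S, (Polynomial.X * q).eval x = f x := by
  classical
  refine ⟨Lagrange.interpolate hS.toFinset id (fun x => f x / x), fun x hx => ?_⟩
  have := Lagrange.eval_interpolate_at_node (s := hS.toFinset) (v := id) (i := x)
    (fun x => f x / x) (Set.injOn_id _) (by simpa using hx)
  simp only [id] at this
  rw [Polynomial.eval_mul, Polynomial.eval_X]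
  erw [this]
  by_cases h : x = 0
  · simp [h, hf]
  · field_simp

lemma cfc_eq_aeval {f : ℝ → ℝ} {A : Matrix a a ℂ} (hA : A.IsHermitian) {q : Polynomial ℝ}
    (h : ∀ x ∈ spectrum ℝ A, q.eval x = f x) : cfc f A = Polynomial.aeval A q := by
  rw [← cfc_polynomial q A hA]
  exact cfc_congr fun x hx => (h x hx).symm

lemma aeval_conj_isometry {V : Matrix a b ℂ} (hV : Vᴴ * V = 1) (A : Matrix b b ℂ)
    (q : Polynomial ℝ) :
    Polynomial.aeval (V * A * Vᴴ) (Polynomial.X * q) =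
      V * Polynomial.aeval A (Polynomial.X * q) * Vᴴ := by
  have hpow : ∀ k : ℕ, (V * A * Vᴴ) ^ (k + 1) = V * A ^ (k + 1) * Vᴴ := by
    intro k
    induction k with
    | zero => simp
    | succ k ih =>
      rw [pow_succ, ih, pow_succ A (k + 1)]
      calc V * A ^ (k + 1) * Vᴴ * (V * A * Vᴴ)
          = V * A ^ (k + 1) * (Vᴴ * V) * A * Vᴴ := by simp only [Matrix.mul_assoc]
        _ = _ := by rw [hV]; simp only [Matrix.mul_assoc, Matrix.one_mul]
  induction q using Polynomial.induction_on' with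
  | add p q hp hq => rw [mul_add, map_add, map_add, hp, hq, Matrix.mul_add, Matrix.add_mul]
  | monomial n r =>
    have h : Polynomial.X * Polynomial.monomial n r = Polynomial.monomial (n + 1) r := by
      rw [mul_comm, Polynomial.monomial_mul_X]
    rw [h, Polynomial.aeval_monomial, Polynomial.aeval_monomial, hpow, ← Algebra.smul_def,
      ← Algebra.smul_def, Matrix.mul_smul, Matrix.smul_mul]

lemma aeval_rdiag (d : a → ℝ) (q : Polynomial ℝ) :
    Polynomial.aeval (rdiag d) q = rdiag fun i => q.eval (d i) := by
  induction q using Polynomial.induction_on' with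
  | add p q hp hq =>
    rw [map_add, hp, hq, rdiag, rdiag, rdiag, diagonal_add]
    simp
  | monomial n r =>
    rw [Polynomial.aeval_monomial, rdiag_pow, ← Algebra.smul_def, rdiag, rdiag, ← diagonal_smul]
    congr 1; ext i; simp

/-- Functional calculus commutes with conjugation by an isometry, for functions vanishing
at `0`. -/
lemma cfc_conj_isometry {f : ℝ → ℝ} (hf : f 0 = 0) {V : Matrix a b ℂ} (hV : Vᴴ * V = 1)
    {A : Matrix b b ℂ} (hA : A.IsHermitian) : cfc f (V * A * Vᴴ) = V * cfc f A * Vᴴ := by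
  have hA' : (V * A * Vᴴ).IsHermitian := isHermitian_mul_mul_conjTranspose V hA
  obtain ⟨q, hq⟩ := exists_polynomial_X_mul hf
    ((finite_real_spectrum (A := A)).union (finite_real_spectrum (A := V * A * Vᴴ)))
  rw [cfc_eq_aeval hA' fun x hx => hq x (Or.inr hx), cfc_eq_aeval hA fun x hx => hq x (Or.inl hx),
    aeval_conj_isometry hV]

lemma rdiag_isHermitian (d : a → ℝ) : (rdiag d).IsHermitian := rdiag_conjTranspose d

lemma cfc_rdiag (f : ℝ → ℝ) (d : a → ℝ) : cfc f (rdiag d) = rdiag fun i => f (d i) := by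
  classical
  have hS := (finite_real_spectrum (A := rdiag d)).union (Set.finite_range d)
  have hq := fun x hx => Lagrange.eval_interpolate_at_node (s := hS.toFinset) (v := id) (i := x)
    f (Set.injOn_id _) hx
  rw [cfc_eq_aeval (rdiag_isHermitian d)
    fun x hx => hq x (hS.mem_toFinset.2 (Or.inl hx)), aeval_rdiag]
  congr 1; ext i
  exact hq (d i) (hS.mem_toFinset.2 (Or.inr ⟨i, rfl⟩))

lemma cfc_conj_rdiag {f : ℝ → ℝ} (hf : f 0 = 0) {V : Matrix a b ℂ} (hV : Vᴴ * V = 1)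
    (d : b → ℝ) : cfc f (V * rdiag d * Vᴴ) = V * rdiag (fun i => f (d i)) * Vᴴ := by
  rw [cfc_conj_isometry hf hV (rdiag_isHermitian d), cfc_rdiag]

lemma power_conj_rdiag {s : ℝ} (hs : s ≠ 0) {V : Matrix a b ℂ} (hV : Vᴴ * V = 1)
    (d : b → ℝ) : power (V * rdiag d * Vᴴ) s = V * rdiag (fun i => d i ^ s) * Vᴴ :=
  cfc_conj_rdiag (f := fun x => x ^ s) (Real.zero_rpow hs) hV d

lemma power_rdiag (s : ℝ) (d : a → ℝ) : power (rdiag d) s = rdiag fun i => d i ^ s :=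
  cfc_rdiag _ d

lemma power_conj_isometry {s : ℝ} (hs : s ≠ 0) {V : Matrix a b ℂ} (hV : Vᴴ * V = 1)
    {A : Matrix b b ℂ} (hA : A.PosSemidef) : power (V * A * Vᴴ) s = V * power A s * Vᴴ :=
  cfc_conj_isometry (f := fun x => x ^ s) (Real.zero_rpow hs) hV hA.1

lemma power_posSemidef {A : Matrix a a ℂ} (hA : A.PosSemidef) {s : ℝ} (hs : s ≠ 0) :
    (power A s).PosSemidef := by
  obtain ⟨U, d, hU, -, rfl, hd⟩ := exists_unitary_rdiag hA.1
  rw [power_conj_rdiag hs hU]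
  exact (rdiag_posSemidef fun i => Real.rpow_nonneg (hd hA i) _).mul_mul_conjTranspose_same U

lemma power_isHermitian {A : Matrix a a ℂ} (hA : A.PosSemidef) {s : ℝ} (hs : s ≠ 0) :
    (power A s)ᴴ = power A s := (power_posSemidef hA hs).1

lemma power_one {A : Matrix a a ℂ} (hA : A.PosSemidef) : power A 1 = A := by
  simp only [power, Real.rpow_one]
  exact cfc_id' ℝ A hA.1

lemma conj_rdiag_mul {V : Matrix a b ℂ} (hV : Vᴴ * V = 1) (d e : b → ℝ) :
    (V * rdiag d * Vᴴ) * (V * rdiag e * Vᴴ) = V * rdiag (fun i => d i * e i) * Vᴴ := by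
  calc (V * rdiag d * Vᴴ) * (V * rdiag e * Vᴴ)
      = V * rdiag d * (Vᴴ * V) * rdiag e * Vᴴ := by simp only [Matrix.mul_assoc]
    _ = V * (rdiag d * rdiag e) * Vᴴ := by rw [hV]; simp only [Matrix.mul_assoc, Matrix.one_mul]
    _ = _ := by rw [rdiag_mul]

lemma power_mul_power {A : Matrix a a ℂ} (hA : A.PosSemidef) {s t : ℝ} (hs : s ≠ 0) (ht : t ≠ 0)
    (hst : s + t ≠ 0) : power A s * power A t = power A (s + t) := by
  obtain ⟨U, d, hU, -, rfl, hd⟩ := exists_unitary_rdiag hA.1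
  rw [power_conj_rdiag hs hU, power_conj_rdiag ht hU, power_conj_rdiag hst hU, conj_rdiag_mul hU]
  congr 3; ext i
  rw [Real.rpow_add' (hd hA i) hst]

lemma power_power {A : Matrix a a ℂ} (hA : A.PosSemidef) {s t : ℝ} (hs : s ≠ 0) (ht : t ≠ 0) :
    power (power A s) t = power A (s * t) := by
  obtain ⟨U, d, hU, -, rfl, hd⟩ := exists_unitary_rdiag hA.1
  rw [power_conj_rdiag hs hU, power_conj_rdiag ht hU, power_conj_rdiag (mul_ne_zero hs ht) hU]
  congr 3; ext i
  rw [Real.rpow_mul (hd hA i)]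

lemma smul_rdiag (c : ℝ) (d : a → ℝ) : c • rdiag d = rdiag fun i => c * d i := by
  rw [rdiag, rdiag, ← diagonal_smul]; congr 1; ext i; simp

lemma power_smul {A : Matrix a a ℂ} (hA : A.PosSemidef) {c s : ℝ} (hc : 0 ≤ c) (hs : s ≠ 0) :
    power (c • A) s = c ^ s • power A s := by
  obtain ⟨U, d, hU, -, rfl, hd⟩ := exists_unitary_rdiag hA.1
  rw [power_conj_rdiag hs hU, ← Matrix.smul_mul, ← Matrix.mul_smul, smul_rdiag,
    power_conj_rdiag hs hU, ← Matrix.smul_mul, ← Matrix.mul_smul, smul_rdiag]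
  congr 3; ext i
  rw [Real.mul_rpow hc (hd hA i)]

lemma rtr_conj_isometry {V : Matrix a b ℂ} (hV : Vᴴ * V = 1) (A : Matrix b b ℂ) :
    rtr (V * A * Vᴴ) = rtr A := by
  rw [rtr_mul_comm, ← Matrix.mul_assoc, hV, Matrix.one_mul]

/-- The power of a positive semidefinite matrix is given by one polynomial without constant term,
for any two matrices at once. -/
lemma exists_polynomial_power {A : Matrix a a ℂ} {B : Matrix b b ℂ} (hA : A.PosSemidef)
    (hB : B.PosSemidef) {s : ℝ} (hs : s ≠ 0) : ∃ q : Polynomial ℝ,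
      power A s = Polynomial.aeval A (Polynomial.X * q) ∧
      power B s = Polynomial.aeval B (Polynomial.X * q) := by
  obtain ⟨q, hq⟩ := exists_polynomial_X_mul (f := fun x => x ^ s) (Real.zero_rpow hs)
    ((finite_real_spectrum (A := A)).union (finite_real_spectrum (A := B)))
  exact ⟨q, cfc_eq_aeval hA.1 fun x hx => hq x (Or.inl hx),
    cfc_eq_aeval hB.1 fun x hx => hq x (Or.inr hx)⟩

lemma rtr_power_mul_conjTranspose (X : Matrix a b ℂ) {s : ℝ} (hs : s ≠ 0) :
    rtr (power (X * Xᴴ) s) = rtr (power (Xᴴ * X) s) := by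
  obtain ⟨q, h1, h2⟩ := exists_polynomial_power (posSemidef_self_mul_conjTranspose X)
    (posSemidef_conjTranspose_mul_self X) hs
  rw [h1, h2]
  clear h1 h2
  have hpow : ∀ k : ℕ, (X * Xᴴ) ^ (k + 1) = X * (Xᴴ * X) ^ k * Xᴴ := by
    intro k
    induction k with
    | zero => simp
    | succ k ih => rw [pow_succ, ih, pow_succ]; simp only [Matrix.mul_assoc]
  induction q using Polynomial.induction_on' with
  | add p q hp hq => rw [mul_add, map_add, map_add, rtr_add, rtr_add, hp, hq]
  | monomial n r =>
    have h : Polynomial.X * Polynomial.monomial n r = Polynomial.monomial (n + 1) r := by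
      rw [mul_comm, Polynomial.monomial_mul_X]
    rw [h, Polynomial.aeval_monomial, Polynomial.aeval_monomial, hpow, ← Algebra.smul_def,
      ← Algebra.smul_def, rtr_smul, rtr_smul, rtr_mul_comm (X * _) Xᴴ, ← Matrix.mul_assoc,
      ← pow_succ']

lemma commute_power {A B : Matrix a a ℂ} (hA : A.PosSemidef) (h : Commute A B) (s : ℝ) :
    Commute (power A s) B := by
  classical
  obtain ⟨q, hq⟩ : ∃ q : Polynomial ℝ, power A s = Polynomial.aeval A q := by
    have hS := finite_real_spectrum (A := A)
    exact ⟨_, cfc_eq_aeval hA.1 fun x hx => Lagrange.eval_interpolate_at_node (s := hS.toFinset)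
      (v := id) (i := x) _ (Set.injOn_id _) (hS.mem_toFinset.2 hx)⟩
  rw [hq]
  clear hq
  induction q using Polynomial.induction_on' with
  | add p q hp hq => rw [map_add]; exact hp.add_left hq
  | monomial n r =>
    rw [Polynomial.aeval_monomial, ← Algebra.smul_def]
    exact (h.pow_left n).smul_left r

lemma power_zero_matrix {s : ℝ} (hs : s ≠ 0) : power (0 : Matrix a a ℂ) s = 0 := by
  have h : (0 : Matrix a a ℂ) = rdiag fun _ => 0 := by ext i j; simp [rdiag, diagonal_apply]
  rw [h, power_rdiag]; simp [Real.zero_rpow hs]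

end PowerCalculus

/-! ### Trace inequalities -/

section TraceInequalities

variable {a b : Type*} [Fintype a] [DecidableEq a] [Fintype b] [DecidableEq b]

lemma conj_le_conj {A B : Matrix a a ℂ} (h : A ≤ B) (C : Matrix b a ℂ) :
    C * A * Cᴴ ≤ C * B * Cᴴ := by
  rw [Matrix.le_iff] at h ⊢
  have := h.mul_mul_conjTranspose_same C
  rwa [Matrix.mul_sub, Matrix.sub_mul] at this

lemma posSemidef_of_le {A B : Matrix a a ℂ} (hA : A.PosSemidef) (h : A ≤ B) : B.PosSemidef := by
  have := hA.add (Matrix.le_iff.1 h)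
  simpa using this

section
open scoped Matrix.Norms.L2Operator

/-- The Löwner–Heinz theorem for the powers defined here. -/
lemma power_le_power {A B : Matrix a a ℂ} (hA : A.PosSemidef) (h : A ≤ B) {s : ℝ} (hs : 0 < s)
    (hs1 : s ≤ 1) : power A s ≤ power B s := by
  have hB := posSemidef_of_le hA h
  have := CFC.rpow_le_rpow (A := Matrix a a ℂ) (p := s) ⟨hs.le, hs1⟩ h
  rwa [CFC.rpow_eq_cfc_real hA.nonneg, CFC.rpow_eq_cfc_real hB.nonneg] at this

lemma conjTranspose_mul_self_le_one {Z : Matrix a a ℂ} (h : Z * Zᴴ ≤ 1) : Zᴴ * Z ≤ 1 := by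
  have h1 := (CStarAlgebra.norm_le_one_iff_of_nonneg (Z * Zᴴ)
    (posSemidef_self_mul_conjTranspose Z).nonneg).2 h
  refine (CStarAlgebra.norm_le_one_iff_of_nonneg (Zᴴ * Z)
    (posSemidef_conjTranspose_mul_self Z).nonneg).1 ?_
  rw [← star_eq_conjTranspose, CStarRing.norm_self_mul_star] at h1
  rwa [← star_eq_conjTranspose, CStarRing.norm_star_mul_self]

end

lemma rtr_mul_nonneg {A B : Matrix a a ℂ} (hA : A.PosSemidef) (hB : B.PosSemidef) :
    0 ≤ rtr (A * B) := by
  have h : A = power A (1 / 2) * power A (1 / 2) := by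
    rw [power_mul_power hA (by norm_num) (by norm_num) (by norm_num)]
    norm_num
    rw [power_one hA]
  rw [h, Matrix.mul_assoc, rtr_mul_comm]
  refine rtr_nonneg ?_
  have := hB.mul_mul_conjTranspose_same (power A (1 / 2))
  rwa [power_isHermitian hA (by norm_num)] at this

/-- The tangent of the convex function `x ↦ x ^ α`. -/
lemma tangent_le_rpow {α x y : ℝ} (hα : 1 < α) (hx : 0 ≤ x) (hy : 0 ≤ y) :
    x ^ α + α * (x ^ (α - 1) * (y - x)) ≤ y ^ α := by
  rcases hx.eq_or_lt with rfl | hx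
  · rw [Real.zero_rpow (by linarith), Real.zero_rpow (by linarith)]
    simpa using Real.rpow_nonneg hy α
  · have h := one_add_mul_self_le_rpow_one_add (s := y / x - 1) (by
      have := div_nonneg hy hx.le; linarith) hα.le
    rw [add_sub_cancel, Real.div_rpow hy hx.le, le_div_iff₀ (Real.rpow_pos_of_pos hx α)] at h
    rw [Real.rpow_sub_one hx.ne']
    calc _ = (1 + α * (y / x - 1)) * x ^ α := by field_simp
      _ ≤ _ := h

/-- The trace of a product of two matrices, each diagonal in its own basis. -/
lemma rtr_mul_of_bases (U W : Matrix a a ℂ) (f g : a → ℝ) :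
    rtr ((U * rdiag f * Uᴴ) * (W * rdiag g * Wᴴ)) =
      ∑ i, ∑ j, f i * g j * Complex.normSq ((Uᴴ * W) i j) := by
  have h : rtr ((U * rdiag f * Uᴴ) * (W * rdiag g * Wᴴ)) =
      rtr (rdiag f * ((Uᴴ * W) * rdiag g * (Uᴴ * W)ᴴ)) := by
    rw [show (U * rdiag f * Uᴴ) * (W * rdiag g * Wᴴ) =
      U * (rdiag f * Uᴴ * (W * rdiag g * Wᴴ)) by simp only [Matrix.mul_assoc], rtr_mul_comm]
    congr 1
    simp only [Matrix.mul_assoc, conjTranspose_mul, conjTranspose_conjTranspose]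
  rw [h]
  set Z := Uᴴ * W
  simp only [rtr, trace, diag, Complex.re_sum]
  refine Finset.sum_congr rfl fun i _ => ?_
  rw [rdiag, diagonal_mul, Matrix.mul_apply, Finset.mul_sum, Complex.re_sum]
  refine Finset.sum_congr rfl fun j _ => ?_
  rw [rdiag, mul_diagonal, conjTranspose_apply, Complex.star_def,
    show (f i : ℂ) * (Z i j * (g j : ℂ) * (starRingEnd ℂ) (Z i j)) =
      (f i : ℂ) * (g j : ℂ) * (Z i j * (starRingEnd ℂ) (Z i j)) by ring, Complex.mul_conj]
  norm_cast

lemma sum_normSq_of_unitary {Z : Matrix a a ℂ} (h : Z * Zᴴ = 1) (i : a) :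
    ∑ j, Complex.normSq (Z i j) = 1 := by
  have := congrFun (congrFun h i) i
  rw [Matrix.mul_apply] at this
  simp only [conjTranspose_apply, Complex.star_def, Complex.mul_conj, one_apply_eq] at this
  exact_mod_cast this

/-- Klein's inequality for `x ↦ x ^ α`, `α > 1`. -/
lemma klein_rpow {A B : Matrix a a ℂ} (hA : A.PosSemidef) (hB : B.PosSemidef) {α : ℝ}
    (hα : 1 < α) :
    rtr (power A α) + α * rtr (power A (α - 1) * (B - A)) ≤ rtr (power B α) := by
  obtain ⟨U, x, hU, hU', hAU, hx⟩ := exists_unitary_rdiag hA.1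
  obtain ⟨W, y, hW, hW', hBW, hy⟩ := exists_unitary_rdiag hB.1
  have hx := hx hA
  have hy := hy hB
  have h1 : α ≠ 0 := by linarith
  have h2 : α - 1 ≠ 0 := by linarith
  have h3 : α - 1 + 1 ≠ 0 := by linarith
  have hAA : power A (α - 1) * A = power A α := by
    conv_lhs => rw [← power_one hA]
    rw [power_power hA one_ne_zero h2, one_mul, power_mul_power hA h2 one_ne_zero h3,
      sub_add_cancel]
  set w : a → a → ℝ := fun i j => Complex.normSq ((Uᴴ * W) i j)
  have hZ : (Uᴴ * W) * (Uᴴ * W)ᴴ = 1 := by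
    rw [conjTranspose_mul, conjTranspose_conjTranspose, Matrix.mul_assoc, ← Matrix.mul_assoc W, hW',
      Matrix.one_mul, hU]
  have hZ' : (Uᴴ * W)ᴴ * (Uᴴ * W)ᴴᴴ = 1 := by
    rw [conjTranspose_conjTranspose, conjTranspose_mul, conjTranspose_conjTranspose,
      Matrix.mul_assoc, ← Matrix.mul_assoc U, hU', Matrix.one_mul, hW]
  have hw1 : ∀ i, ∑ j, w i j = 1 := sum_normSq_of_unitary hZ
  have hw2 : ∀ j, ∑ i, w i j = 1 := fun j => by
    rw [← sum_normSq_of_unitary hZ' j]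
    refine Finset.sum_congr rfl fun i _ => ?_
    rw [conjTranspose_apply, Complex.star_def, Complex.normSq_conj]
  have eA : rtr (power A α) = ∑ i, ∑ j, x i ^ α * w i j := by
    rw [hAU, power_conj_rdiag h1 hU, rtr_conj_isometry hU, rtr_rdiag]
    simp [← Finset.mul_sum, hw1]
  have eB : rtr (power B α) = ∑ i, ∑ j, y j ^ α * w i j := by
    rw [hBW, power_conj_rdiag h1 hW, rtr_conj_isometry hW, rtr_rdiag, Finset.sum_comm]
    simp [← Finset.mul_sum, hw2]
  have eAB : rtr (power A (α - 1) * B) = ∑ i, ∑ j, x i ^ (α - 1) * y j * w i j := by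
    rw [hAU, power_conj_rdiag h2 hU, hBW, rtr_mul_of_bases]
  rw [Matrix.mul_sub, rtr_sub, hAA, eAB, eA, eB, mul_sub, Finset.mul_sum, Finset.mul_sum,
    ← Finset.sum_sub_distrib, ← Finset.sum_add_distrib]
  refine Finset.sum_le_sum fun i _ => ?_
  rw [Finset.mul_sum, Finset.mul_sum, ← Finset.sum_sub_distrib, ← Finset.sum_add_distrib]
  refine Finset.sum_le_sum fun j _ => ?_
  have h := tangent_le_rpow hα (hx i) (hy j)
  have hxx : x i ^ α = x i ^ (α - 1) * x i := by
    rw [← Real.rpow_add_one' (hx i) h3, sub_add_cancel]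
  have hw : 0 ≤ w i j := Complex.normSq_nonneg _
  have h := mul_le_mul_of_nonneg_right h hw
  rw [hxx] at h ⊢
  linarith

lemma rtr_power_mono {A B : Matrix a a ℂ} (hA : A.PosSemidef) (h : A ≤ B) {α : ℝ} (hα : 0 < α) :
    rtr (power A α) ≤ rtr (power B α) := by
  rcases le_or_gt α 1 with h1 | h1
  · exact rtr_mono (power_le_power hA h hα h1)
  · have h2 := klein_rpow hA (posSemidef_of_le hA h) h1
    have h3 := rtr_mul_nonneg (power_posSemidef hA (s := α - 1) (by linarith)) (Matrix.le_iff.1 h)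
    nlinarith

lemma power_mul_power_neg_le_one {B : Matrix a a ℂ} (hB : B.PosSemidef) {r : ℝ} (hr : 0 < r) :
    power B (-(r / 2)) * power B r * power B (-(r / 2)) ≤ 1 := by
  obtain ⟨U, d, hU, hU', rfl, hd⟩ := exists_unitary_rdiag hB.1
  have hd := hd hB
  rw [power_conj_rdiag (by linarith) hU, power_conj_rdiag hr.ne' hU, conj_rdiag_mul hU,
    conj_rdiag_mul hU]
  have h1 : (1 : Matrix a a ℂ) = U * rdiag (fun _ => 1) * Uᴴ := by
    rw [show rdiag (fun _ : a => (1 : ℝ)) = 1 by simp [rdiag], Matrix.mul_one, hU']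
  conv_rhs => rw [h1]
  refine conj_le_conj ?_ U
  rw [Matrix.le_iff, rdiag, rdiag, diagonal_sub]
  refine PosSemidef.diagonal fun i => ?_
  rw [← Complex.ofReal_sub]
  simp only [Pi.zero_apply, Complex.zero_le_real, sub_nonneg]
  rcases (hd i).eq_or_lt with h | h
  · rw [← h, Real.zero_rpow hr.ne']; simp
  · rw [← Real.rpow_add h, ← Real.rpow_add h]
    rw [show -(r / 2) + r + -(r / 2) = 0 by ring, Real.rpow_zero]

/-- For invertible matrices this says `tr (A * B ^ (α - 1)) ≤ tr (A * A ^ (α - 1))`, which is the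
antitonicity of `x ↦ x ^ (α - 1)`. As negative powers ignore kernels, they are not antitone in
general; the proof uses `A ^ (1 - α) ≤ B ^ (1 - α)` instead. -/
lemma rtr_mul_power_le {A B : Matrix a a ℂ} (hA : A.PosSemidef) (h : A ≤ B) {α : ℝ} (hα : 0 < α)
    (hα1 : α < 1) : rtr (A * power B (α - 1)) ≤ rtr (power A α) := by
  have hB := posSemidef_of_le hA h
  set r := 1 - α with hr
  have hr0 : 0 < r := by linarith
  have hr1 : r ≤ 1 := by linarith
  set S := power B (-(r / 2)) with hS
  set R := power A (r / 2) with hR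
  have hSh : Sᴴ = S := power_isHermitian hB (by linarith)
  have hRh : Rᴴ = R := power_isHermitian hA (by linarith)
  have hRR : R * R = power A r := by
    rw [hR, power_mul_power hA (by linarith) (by linarith) (by linarith), add_halves]
  have hSS : S * S = power B (α - 1) := by
    rw [hS, power_mul_power hB (by linarith) (by linarith) (by linarith)]
    congr 1; rw [hr]; ring
  have h1 : (S * R) * (S * R)ᴴ ≤ 1 := by
    rw [conjTranspose_mul, hSh, hRh, show S * R * (R * S) = S * (R * R) * S by
      simp only [Matrix.mul_assoc], hRR]
    refine le_trans ?_ (power_mul_power_neg_le_one hB hr0)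
    have := conj_le_conj (power_le_power hA h hr0 hr1) S
    rwa [hSh] at this
  have h2 := conjTranspose_mul_self_le_one h1
  rw [conjTranspose_mul, hSh, hRh, show R * S * (S * R) = R * (S * S) * R by
      simp only [Matrix.mul_assoc], hSS] at h2
  set T := power A (α / 2) with hT
  have hTh : Tᴴ = T := power_isHermitian hA (by linarith)
  have h3 := rtr_mono (conj_le_conj h2 T)
  rw [hTh, Matrix.mul_one, hT, power_mul_power hA (by linarith) (by linarith) (by linarith),
    add_halves, ← hT] at h3
  refine le_trans (le_of_eq ?_) h3
  have hRTTR : R * T * (T * R) = A := by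
    rw [hR, hT, power_mul_power hA (by linarith) (by linarith) (by linarith),
      power_mul_power hA (by linarith) (by linarith) (by linarith),
      power_mul_power hA (by linarith) (by linarith) (by linarith),
      show r / 2 + α / 2 + (α / 2 + r / 2) = 1 by rw [hr]; ring, power_one hA]
  rw [show T * (R * power B (α - 1) * R) * T = (T * R * power B (α - 1)) * (R * T) by
    simp only [Matrix.mul_assoc], rtr_mul_comm _ (R * T), ← Matrix.mul_assoc, hRTTR]

end TraceInequalities

/-! ### Pinching -/

section Pinching

variable {a T : Type*} [Fintype a] [DecidableEq a] [Fintype T] [DecidableEq T] (L : a → T)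

/-- The projection onto the coordinates with label `t`. -/
def labelProj (t : T) : Matrix a a ℂ := rdiag fun i => if L i = t then 1 else 0

/-- The pinching of `X` along the labelling `L`: the entries between differently labelled
coordinates are erased. -/
def pinch (X : Matrix a a ℂ) : Matrix a a ℂ := of fun i j => if L i = L j then X i j else 0

/-- `X` is block diagonal with respect to the labelling `L`. -/
def IsPinched (X : Matrix a a ℂ) : Prop := ∀ i j, L i ≠ L j → X i j = 0

lemma labelProj_isHermitian (t : T) : (labelProj L t)ᴴ = labelProj L t := rdiag_conjTranspose _

lemma labelProj_mul_apply (t : T) (X : Matrix a a ℂ) (i j : a) :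
    (labelProj L t * X) i j = if L i = t then X i j else 0 := by
  rw [labelProj, rdiag, diagonal_mul]; split_ifs <;> simp

lemma mul_labelProj_apply (t : T) (X : Matrix a a ℂ) (i j : a) :
    (X * labelProj L t) i j = if L j = t then X i j else 0 := by
  rw [labelProj, rdiag, mul_diagonal]; split_ifs <;> simp

lemma sum_labelProj : ∑ t, labelProj L t = 1 := by
  ext i j
  rw [Matrix.sum_apply]
  by_cases hij : i = j
  · subst hij; simp [labelProj, rdiag, apply_ite Complex.ofReal]
  · simp [labelProj, rdiag, hij]

lemma labelProj_mul_self (t : T) : labelProj L t * labelProj L t = labelProj L t := by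
  ext i j; rw [labelProj_mul_apply]; simp only [labelProj, rdiag, diagonal_apply]
  split_ifs <;> simp_all

lemma pinch_eq_sum (X : Matrix a a ℂ) :
    pinch L X = ∑ t, labelProj L t * X * labelProj L t := by
  ext i j
  rw [Matrix.sum_apply]
  simp only [mul_labelProj_apply, labelProj_mul_apply, pinch, of_apply]
  simp

lemma isPinched_pinch (X : Matrix a a ℂ) : IsPinched L (pinch L X) := fun i j h => by
  simp [pinch, h]

variable {L}

lemma IsPinched.commute {X : Matrix a a ℂ} (h : IsPinched L X) (t : T) :
    Commute X (labelProj L t) := by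
  ext i j
  rw [mul_labelProj_apply, labelProj_mul_apply]
  by_cases hij : L i = L j
  · rw [hij]
  · simp [h i j hij]

lemma isPinched_of_commute {X : Matrix a a ℂ} (h : ∀ t, Commute X (labelProj L t)) :
    IsPinched L X := fun i j hij => by
  have := congrFun (congrFun (h (L j)) i) j
  rw [mul_labelProj_apply, labelProj_mul_apply] at this
  simpa [hij] using this

lemma IsPinched.power {X : Matrix a a ℂ} (h : IsPinched L X) (hX : X.PosSemidef) (s : ℝ) :
    IsPinched L (power X s) := isPinched_of_commute fun t => commute_power hX (h.commute t) s

lemma IsPinched.mul {X Y : Matrix a a ℂ} (hX : IsPinched L X) (hY : IsPinched L Y) :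
    IsPinched L (X * Y) := isPinched_of_commute fun t => (hX.commute t).mul_left (hY.commute t)

lemma IsPinched.conjTranspose {X : Matrix a a ℂ} (hX : IsPinched L X) : IsPinched L Xᴴ :=
  fun i j h => by rw [conjTranspose_apply, hX j i (Ne.symm h), star_zero]

lemma isPinched_rdiag {d : a → ℝ} : IsPinched L (rdiag d) := fun i j h => by
  have : i ≠ j := fun e => h (by rw [e])
  simp [rdiag, this]

lemma pinch_conj {C : Matrix a a ℂ} (hC : IsPinched L C) (X : Matrix a a ℂ) :
    pinch L (C * X * Cᴴ) = C * pinch L X * Cᴴ := by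
  rw [pinch_eq_sum, pinch_eq_sum, Matrix.mul_sum, Matrix.sum_mul]
  refine Finset.sum_congr rfl fun t _ => ?_
  have h1 := (hC.commute t).eq
  have h2 := (hC.conjTranspose.commute t).eq
  calc labelProj L t * (C * X * Cᴴ) * labelProj L t
      = (labelProj L t * C) * X * (Cᴴ * labelProj L t) := by simp only [Matrix.mul_assoc]
    _ = _ := by rw [← h1, h2]; simp only [Matrix.mul_assoc]

lemma pinch_posSemidef {X : Matrix a a ℂ} (hX : X.PosSemidef) : (pinch L X).PosSemidef := by
  rw [pinch_eq_sum]
  refine posSemidef_sum _ fun t _ => ?_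
  have := hX.mul_mul_conjTranspose_same (labelProj L t)
  rwa [labelProj_isHermitian] at this

lemma rtr_pinch (X : Matrix a a ℂ) : rtr (pinch L X) = rtr X := by
  simp [rtr, trace, pinch]

lemma rtr_mul_pinch {C : Matrix a a ℂ} (hC : IsPinched L C) (X : Matrix a a ℂ) :
    rtr (C * pinch L X) = rtr (C * X) := by
  simp only [rtr, trace, diag, Matrix.mul_apply]
  congr 1
  refine Finset.sum_congr rfl fun i _ => Finset.sum_congr rfl fun j _ => ?_
  by_cases h : L i = L j
  · simp [pinch, h]
  · simp [hC i j h]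

/-- The pinching inequality. -/
lemma le_card_smul_pinch {X : Matrix a a ℂ} (hX : X.PosSemidef) :
    X ≤ (Fintype.card T : ℝ) • pinch L X := by
  have h : (∑ s, ∑ t, (labelProj L s - labelProj L t) * X * (labelProj L s - labelProj L t)ᴴ) =
      (2 : ℝ) • ((Fintype.card T : ℝ) • pinch L X - X) := by
    have e : ∀ s t, (labelProj L s - labelProj L t) * X * (labelProj L s - labelProj L t)ᴴ =
        labelProj L s * X * labelProj L s + labelProj L t * X * labelProj L t
          - labelProj L s * X * labelProj L t - labelProj L t * X * labelProj L s := by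
      intro s t
      rw [conjTranspose_sub, labelProj_isHermitian, labelProj_isHermitian]
      simp only [Matrix.sub_mul, Matrix.mul_sub]; abel
    have e2 : ∑ s, ∑ t, labelProj L s * X * labelProj L t = X := by
      simp only [← Matrix.mul_sum, ← Matrix.sum_mul, sum_labelProj, Matrix.mul_one, Matrix.one_mul]
    have e3 : ∑ s, ∑ t, labelProj L t * X * labelProj L s = X := by
      rw [Finset.sum_comm]; exact e2
    simp only [e, Finset.sum_sub_distrib, Finset.sum_add_distrib, e2, e3, ← pinch_eq_sum,
      Finset.sum_const, Finset.card_univ, ← Finset.smul_sum]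
    rw [two_smul, Nat.cast_smul_eq_nsmul]; abel
  rw [Matrix.le_iff]
  have h2 : (∑ s, ∑ t, (labelProj L s - labelProj L t) * X *
      (labelProj L s - labelProj L t)ᴴ).PosSemidef :=
    posSemidef_sum _ fun s _ => posSemidef_sum _ fun t _ => hX.mul_mul_conjTranspose_same _
  rw [h] at h2
  have h3 := h2.smul (show (0 : ℝ) ≤ 1 / 2 by norm_num)
  rwa [smul_smul, show (1 / 2 : ℝ) * 2 = 1 by norm_num, one_smul] at h3

/-- Pinching decreases the trace of a power of order `α > 1`. -/
lemma rtr_power_pinch_le {X : Matrix a a ℂ} (hX : X.PosSemidef) {α : ℝ} (hα : 1 < α) :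
    rtr (power (pinch L X) α) ≤ rtr (power X α) := by
  have hP := pinch_posSemidef (L := L) hX
  have h := klein_rpow hP hX hα
  rw [Matrix.mul_sub, rtr_sub, rtr_mul_pinch ((isPinched_pinch L X).power hP _), sub_self,
    mul_zero, add_zero] at h
  exact h

/-- Up to the number of blocks, pinching does not increase the trace of a power of order
`α < 1`. -/
lemma rtr_power_pinch_le_of_lt_one {X : Matrix a a ℂ} (hX : X.PosSemidef) {α : ℝ} (hα : 0 < α)
    (hα1 : α < 1) :
    rtr (power (pinch L X) α) ≤ (Fintype.card T : ℝ) ^ (1 - α) * rtr (power X α) := by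
  have hP := pinch_posSemidef (L := L) hX
  have h1 : α - 1 ≠ 0 := by linarith
  have h := rtr_mul_power_le hX (le_card_smul_pinch (L := L) hX) hα hα1
  rw [power_smul hP (by positivity) h1, Matrix.mul_smul, rtr_smul, rtr_mul_comm,
    ← rtr_mul_pinch ((isPinched_pinch L X).power hP _)] at h
  have e : power (pinch L X) (α - 1) * pinch L X = power (pinch L X) α := by
    conv_lhs => rw [← power_one hP]
    rw [power_power hP one_ne_zero h1, one_mul, power_mul_power hP h1 one_ne_zero (by linarith),
      sub_add_cancel]
  rw [e] at h
  rcases Nat.eq_zero_or_pos (Fintype.card T) with h0 | h0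
  · have : IsEmpty T := Fintype.card_eq_zero_iff.1 h0
    have : IsEmpty a := ⟨fun i => IsEmpty.false (L i)⟩
    simp [rtr, trace]
  · have hc : (0 : ℝ) < Fintype.card T := by exact_mod_cast h0
    calc rtr (power (pinch L X) α)
        = (Fintype.card T : ℝ) ^ (1 - α) *
          ((Fintype.card T : ℝ) ^ (α - 1) * rtr (power (pinch L X) α)) := by
          rw [← mul_assoc, ← Real.rpow_add hc]; simp
      _ ≤ _ := mul_le_mul_of_nonneg_left h (by positivity)

/-- A block diagonal Hermitian matrix is diagonalized by a block diagonal unitary. -/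
lemma IsPinched.exists_unitary_rdiag {A : Matrix a a ℂ} (hA : A.IsHermitian)
    (h : IsPinched L A) :
    ∃ (W : Matrix a a ℂ) (d : a → ℝ), Wᴴ * W = 1 ∧ W * Wᴴ = 1 ∧ IsPinched L W ∧
      A = W * rdiag d * Wᴴ := by
  let e := Equiv.sigmaFiberEquiv L
  have hB : ∀ t, (A.submatrix (fun i : {i // L i = t} => i.1) fun i => i.1).IsHermitian :=
    fun t => hA.submatrix _
  choose U d hU hU' hAU _ using fun t => QuantumRenyi.exists_unitary_rdiag (hB t)
  have hAe : A.submatrix e e = blockDiagonal'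
      fun t => A.submatrix (fun i : {i // L i = t} => i.1) fun i => i.1 := by
    ext ⟨s, i⟩ ⟨t, j⟩
    by_cases hst : s = t
    · subst hst
      rw [blockDiagonal'_apply_eq]; rfl
    · rw [blockDiagonal'_apply_ne _ _ _ hst]
      exact h _ _ (by simpa [e, Equiv.sigmaFiberEquiv, i.2, j.2] using hst)
  have hA2 : A = (blockDiagonal'
      fun t => A.submatrix (fun i : {i // L i = t} => i.1) fun i => i.1).submatrix
        e.symm e.symm := by
    rw [← hAe]; ext i j; simp
  have hd : (blockDiagonal' fun t => rdiag (d t)).submatrix e.symm e.symm =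
      rdiag (fun i => d (e.symm i).1 (e.symm i).2) := by
    simp only [rdiag]
    rw [blockDiagonal'_diagonal, submatrix_diagonal_equiv]
    rfl
  refine ⟨(blockDiagonal' U).submatrix e.symm e.symm, fun i => d (e.symm i).1 (e.symm i).2,
    ?_, ?_, ?_, ?_⟩
  · rw [conjTranspose_submatrix, blockDiagonal'_conjTranspose, submatrix_mul_equiv,
      ← blockDiagonal'_mul]
    simp only [hU]
    exact (congrArg (fun M => submatrix M e.symm e.symm) blockDiagonal'_one).trans
      (submatrix_one_equiv _)
  · rw [conjTranspose_submatrix, blockDiagonal'_conjTranspose, submatrix_mul_equiv,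
      ← blockDiagonal'_mul]
    simp only [hU']
    exact (congrArg (fun M => submatrix M e.symm e.symm) blockDiagonal'_one).trans
      (submatrix_one_equiv _)
  · intro i j hij
    rw [submatrix_apply]
    exact blockDiagonal'_apply_ne _ _ _ hij
  · rw [← hd, conjTranspose_submatrix, submatrix_mul_equiv, submatrix_mul_equiv,
      blockDiagonal'_conjTranspose, ← blockDiagonal'_mul, ← blockDiagonal'_mul]
    rw [← funext hAU]
    exact hA2

end Pinching

/-! ### Basic properties of `minimalQ` -/

section MinimalQ

variable {a b : Type*} [Fintype a] [DecidableEq a] [Fintype b] [DecidableEq b]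

lemma exponent_ne_zero {α : ℝ} (hα : 0 < α) (hα1 : α ≠ 1) : (1 - α) / (2 * α) ≠ 0 :=
  div_ne_zero (sub_ne_zero.2 hα1.symm) (by linarith)

lemma sandwich_posSemidef {ρ σ : Matrix a a ℂ} (hρ : ρ.PosSemidef) (hσ : σ.PosSemidef) {c : ℝ}
    (hc : c ≠ 0) : (power σ c * ρ * power σ c).PosSemidef := by
  have := hρ.mul_mul_conjTranspose_same (power σ c)
  rwa [power_isHermitian hσ hc] at this

lemma sandwich_le_sandwich {ρ ρ' σ : Matrix a a ℂ} (h : ρ ≤ ρ') (hσ : σ.PosSemidef) {c : ℝ}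
    (hc : c ≠ 0) : power σ c * ρ * power σ c ≤ power σ c * ρ' * power σ c := by
  have := conj_le_conj h (power σ c)
  rwa [power_isHermitian hσ hc] at this

lemma minimalQ_nonneg {ρ σ : Matrix a a ℂ} (hρ : ρ.PosSemidef) (hσ : σ.PosSemidef) {α : ℝ}
    (hα : 0 < α) (hα1 : α ≠ 1) : 0 ≤ minimalQ α ρ σ :=
  rtr_nonneg (power_posSemidef (sandwich_posSemidef hρ hσ (exponent_ne_zero hα hα1)) hα.ne')

lemma minimalQ_mono_left {ρ ρ' σ : Matrix a a ℂ} (hρ : ρ.PosSemidef) (h : ρ ≤ ρ')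
    (hσ : σ.PosSemidef) {α : ℝ} (hα : 0 < α) (hα1 : α ≠ 1) :
    minimalQ α ρ σ ≤ minimalQ α ρ' σ :=
  rtr_power_mono (sandwich_posSemidef hρ hσ (exponent_ne_zero hα hα1))
    (sandwich_le_sandwich h hσ (exponent_ne_zero hα hα1)) hα

lemma minimalQ_smul_left {ρ σ : Matrix a a ℂ} (hρ : ρ.PosSemidef) (hσ : σ.PosSemidef) {α : ℝ}
    (hα : 0 < α) (hα1 : α ≠ 1) {x : ℝ} (hx : 0 ≤ x) :
    minimalQ α (x • ρ) σ = x ^ α * minimalQ α ρ σ := by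
  rw [minimalQ, Matrix.mul_smul, Matrix.smul_mul,
    power_smul (sandwich_posSemidef hρ hσ (exponent_ne_zero hα hα1)) hx hα.ne', rtr_smul, minimalQ]

lemma rpow_sandwich {α r m : ℝ} (hα : 0 < α) (hα1 : α ≠ 1) (hr : 0 ≤ r) (hm : 0 ≤ m) :
    (m ^ ((1 - α) / (2 * α)) * r * m ^ ((1 - α) / (2 * α))) ^ α = r ^ α * m ^ (1 - α) := by
  have hm' := Real.rpow_nonneg hm ((1 - α) / (2 * α))
  have e : (1 - α) / (2 * α) * α + (1 - α) / (2 * α) * α = 1 - α := by field_simp; ring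
  rw [Real.mul_rpow (by positivity) hm', Real.mul_rpow hm' hr, ← Real.rpow_mul hm,
    mul_comm (m ^ _) (r ^ α), mul_assoc, ← Real.rpow_add' hm (by
      rw [e]; exact sub_ne_zero.2 hα1.symm), e]

lemma minimalQ_smul_right {ρ σ : Matrix a a ℂ} (hρ : ρ.PosSemidef) (hσ : σ.PosSemidef) {α : ℝ}
    (hα : 0 < α) (hα1 : α ≠ 1) {x : ℝ} (hx : 0 ≤ x) :
    minimalQ α ρ (x • σ) = x ^ (1 - α) * minimalQ α ρ σ := by
  have hc := exponent_ne_zero hα hα1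
  have hx' := Real.rpow_nonneg hx ((1 - α) / (2 * α))
  rw [minimalQ, power_smul hσ hx hc, Matrix.mul_smul, Matrix.smul_mul, Matrix.smul_mul, smul_smul,
    power_smul (sandwich_posSemidef hρ hσ hc) (by positivity) hα.ne', rtr_smul, minimalQ]
  have := rpow_sandwich hα hα1 zero_le_one hx
  rw [mul_one, Real.one_rpow, one_mul] at this
  rw [this]

lemma minimalQ_eq_swap {ρ σ : Matrix a a ℂ} (hρ : ρ.PosSemidef) (hσ : σ.PosSemidef) {α : ℝ}
    (hα : 0 < α) (hα1 : α ≠ 1) :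
    minimalQ α ρ σ = rtr (power (power ρ (1 / 2) * power σ ((1 - α) / α) * power ρ (1 / 2)) α) := by
  have hc := exponent_ne_zero hα hα1
  have h2 : (1 - α) / (2 * α) + (1 - α) / (2 * α) = (1 - α) / α := by field_simp; ring
  have hc2 : (1 - α) / (2 * α) + (1 - α) / (2 * α) ≠ 0 := by
    rw [h2]; exact div_ne_zero (sub_ne_zero.2 hα1.symm) hα.ne'
  have h := rtr_power_mul_conjTranspose (power σ ((1 - α) / (2 * α)) * power ρ (1 / 2)) hα.ne'
  rw [conjTranspose_mul, power_isHermitian hσ hc, power_isHermitian hρ (by norm_num)] at h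
  set S := power σ ((1 - α) / (2 * α)) with hS
  set R := power ρ (1 / 2) with hR
  have hRR : R * R = ρ := by
    rw [hR, power_mul_power hρ (by norm_num) (by norm_num) (by norm_num), add_halves, power_one hρ]
  have hSS : S * S = power σ ((1 - α) / α) := by
    rw [hS, power_mul_power hσ hc hc hc2, h2]
  rw [show S * R * (R * S) = S * (R * R) * S by simp only [Matrix.mul_assoc],
    show R * S * (S * R) = R * (S * S) * R by simp only [Matrix.mul_assoc], hRR, hSS] at h
  exact h

/-- Monotonicity in the second argument. This is where `1 / 2 ≤ α` is essential: it makes the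
exponent `(1 - α) / α` at most `1`, so that the power is operator monotone. -/
lemma minimalQ_mono_right {ρ σ σ' : Matrix a a ℂ} (hρ : ρ.PosSemidef) (hσ : σ.PosSemidef)
    (h : σ ≤ σ') {α : ℝ} (hα : 1 / 2 ≤ α) (hα1 : α < 1) :
    minimalQ α ρ σ ≤ minimalQ α ρ σ' := by
  have hα0 : 0 < α := by linarith
  have hs : 0 < (1 - α) / α := div_pos (by linarith) hα0
  have hρ' := power_isHermitian hρ (s := 1 / 2) (by norm_num)
  rw [minimalQ_eq_swap hρ hσ hα0 hα1.ne, minimalQ_eq_swap hρ (posSemidef_of_le hσ h) hα0 hα1.ne]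
  refine rtr_power_mono ?_ ?_ hα0
  · have := (power_posSemidef hσ hs.ne').mul_mul_conjTranspose_same (power ρ (1 / 2))
    rwa [hρ'] at this
  · have := conj_le_conj (power_le_power hσ h hs (by rw [div_le_one hα0]; linarith))
      (power ρ (1 / 2))
    rwa [hρ'] at this

lemma minimalQ_conj_isometry {V : Matrix a b ℂ} (hV : Vᴴ * V = 1) {ρ σ : Matrix b b ℂ}
    (hρ : ρ.PosSemidef) (hσ : σ.PosSemidef) {α : ℝ} (hα : 0 < α) (hα1 : α ≠ 1) :
    minimalQ α (V * ρ * Vᴴ) (V * σ * Vᴴ) = minimalQ α ρ σ := by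
  have hc := exponent_ne_zero hα hα1
  rw [minimalQ, power_conj_isometry hc hV hσ]
  set S := power σ ((1 - α) / (2 * α)) with hS
  have : V * S * Vᴴ * (V * ρ * Vᴴ) * (V * S * Vᴴ) = V * (S * ρ * S) * Vᴴ := by
    calc _ = V * S * (Vᴴ * V) * ρ * (Vᴴ * V) * S * Vᴴ := by simp only [Matrix.mul_assoc]
      _ = _ := by rw [hV]; simp only [Matrix.mul_assoc, Matrix.one_mul]
  rw [this, power_conj_isometry hα.ne' hV (sandwich_posSemidef hρ hσ hc), rtr_conj_isometry hV,
    minimalQ]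

lemma minimalQ_rdiag {r m : a → ℝ} (hr : ∀ i, 0 ≤ r i) (hm : ∀ i, 0 ≤ m i) {α : ℝ} (hα : 0 < α)
    (hα1 : α ≠ 1) : minimalQ α (rdiag r) (rdiag m) = ∑ i, r i ^ α * m i ^ (1 - α) := by
  rw [minimalQ, power_rdiag, rdiag_mul, rdiag_mul, power_rdiag, rtr_rdiag]
  exact Finset.sum_congr rfl fun i _ => rpow_sandwich hα hα1 (hr i) (hm i)

section Blocks

variable {T : Type*} [Fintype T] [DecidableEq T] {L : a → T}

lemma power_labelProj_conj {A : Matrix a a ℂ} (hA : A.PosSemidef) (h : IsPinched L A) (t : T)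
    {s : ℝ} (hs : s ≠ 0) : power (labelProj L t * A * labelProj L t) s =
      labelProj L t * power A s * labelProj L t := by
  obtain ⟨W, d, hW, -, hWL, rfl⟩ := IsPinched.exists_unitary_rdiag hA.1 h
  have key : ∀ e : a → ℝ, labelProj L t * (W * rdiag e * Wᴴ) * labelProj L t =
      W * rdiag (fun i => (if L i = t then 1 else 0) * e i * (if L i = t then 1 else 0)) * Wᴴ := by
    intro e
    have h1 := (hWL.commute t).eq
    have h2 := (hWL.conjTranspose.commute t).eq
    calc _ = (labelProj L t * W) * rdiag e * (Wᴴ * labelProj L t) := by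
          simp only [Matrix.mul_assoc]
      _ = W * (labelProj L t * rdiag e * labelProj L t) * Wᴴ := by
          rw [← h1, h2]; simp only [Matrix.mul_assoc]
      _ = _ := by rw [labelProj, rdiag_mul, rdiag_mul]
  rw [key, power_conj_rdiag hs hW, power_conj_rdiag hs hW, key]
  congr 3; ext i
  split_ifs <;> simp [Real.zero_rpow hs]

lemma rtr_eq_sum_blocks {A : Matrix a a ℂ} :
    rtr A = ∑ t, rtr (labelProj L t * A * labelProj L t) := by
  rw [← rtr_sum, ← pinch_eq_sum, rtr_pinch]

lemma labelProj_conj_posSemidef {A : Matrix a a ℂ} (hA : A.PosSemidef) (t : T) :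
    (labelProj L t * A * labelProj L t).PosSemidef := by
  have := hA.mul_mul_conjTranspose_same (labelProj L t)
  rwa [labelProj_isHermitian] at this

/-- `minimalQ` is additive over direct sums. -/
lemma minimalQ_eq_sum_blocks {ρ σ : Matrix a a ℂ} (hρ : ρ.PosSemidef) (hσ : σ.PosSemidef)
    (hρL : IsPinched L ρ) (hσL : IsPinched L σ) {α : ℝ} (hα : 0 < α) (hα1 : α ≠ 1) :
    minimalQ α ρ σ = ∑ t, minimalQ α (labelProj L t * ρ * labelProj L t)
      (labelProj L t * σ * labelProj L t) := by
  have hc := exponent_ne_zero hα hα1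
  have hS := hσL.power hσ ((1 - α) / (2 * α))
  rw [minimalQ, rtr_eq_sum_blocks (L := L)]
  refine Finset.sum_congr rfl fun t _ => ?_
  rw [minimalQ, power_labelProj_conj hσ hσL t hc,
    ← power_labelProj_conj (sandwich_posSemidef hρ hσ hc) ((hS.mul hρL).mul hS) t hα.ne']
  set S := power σ ((1 - α) / (2 * α))
  set E := labelProj L t with hE
  have hEE : E * E = E := labelProj_mul_self L t
  have h1 : S * E = E * S := (hS.commute t).eq
  have h2 : ρ * E = E * ρ := (hρL.commute t).eq
  congr 2
  have h3 : E * S * E = E * S := by rw [Matrix.mul_assoc, h1, ← Matrix.mul_assoc, hEE]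
  have h4 : E * ρ * E = E * ρ := by rw [Matrix.mul_assoc, h2, ← Matrix.mul_assoc, hEE]
  rw [h3, h4]
  calc E * (S * ρ * S) * E = E * S * ρ * (S * E) := by simp only [Matrix.mul_assoc]
    _ = E * S * (ρ * E) * S := by rw [h1]; simp only [Matrix.mul_assoc]
    _ = E * S * (E * E * ρ) * S := by rw [hEE, h2]
    _ = E * S * (E * (ρ * E)) * S := by rw [h2]; simp only [Matrix.mul_assoc]
    _ = E * S * (E * ρ) * (E * S) := by simp only [Matrix.mul_assoc]

end Blocks

end MinimalQ

/-! ### Tensor powers -/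

section Tensor

variable {a b c : Type*} [Fintype a] [DecidableEq a] [Fintype b] [DecidableEq b]
  [Fintype c] [DecidableEq c] {n : ℕ}

/-- The tensor product of `n` matrices. -/
def tprod (A : Fin n → Matrix a b ℂ) : Matrix (Fin n → a) (Fin n → b) ℂ :=
  fun i j => ∏ k, A k (i k) (j k)

lemma tensorPow_eq_tprod (A : Matrix a a ℂ) (n : ℕ) : tensorPow A n = tprod fun _ => A := rfl

lemma tprod_mul (A : Fin n → Matrix a b ℂ) (B : Fin n → Matrix b c ℂ) :
    tprod A * tprod B = tprod fun k => A k * B k := by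
  ext i j
  simp only [Matrix.mul_apply, tprod, ← Finset.prod_mul_distrib, Finset.prod_univ_sum,
    Fintype.piFinset_univ]

lemma tprod_conjTranspose (A : Fin n → Matrix a b ℂ) : (tprod A)ᴴ = tprod fun k => (A k)ᴴ := by
  ext i j
  simp [tprod, conjTranspose_apply]

lemma tprod_sum {ι : Type*} [Fintype ι] (A : Fin n → ι → Matrix a b ℂ) :
    tprod (fun k => ∑ x, A k x) = ∑ y : Fin n → ι, tprod fun k => A k (y k) := by
  ext i j
  rw [Matrix.sum_apply]
  simp only [tprod, Matrix.sum_apply, Finset.prod_univ_sum, Fintype.piFinset_univ]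

lemma tprod_rdiag (d : Fin n → a → ℝ) :
    tprod (fun k => rdiag (d k)) = rdiag fun i => ∏ k, d k (i k) := by
  ext i j
  by_cases h : i = j
  · subst h; simp [tprod, rdiag]
  · obtain ⟨k, hk⟩ := Function.ne_iff.1 h
    simp only [tprod, rdiag, diagonal_apply_ne _ h]
    exact Finset.prod_eq_zero (Finset.mem_univ k) (diagonal_apply_ne _ hk)

lemma tprod_one : tprod (fun _ : Fin n => (1 : Matrix a a ℂ)) = 1 := by
  have h1 : (1 : Matrix a a ℂ) = rdiag fun _ => 1 := by simp [rdiag]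
  rw [h1, tprod_rdiag]; simp [rdiag]

lemma tprod_posSemidef {A : Fin n → Matrix a a ℂ} (hA : ∀ k, (A k).PosSemidef) :
    (tprod A).PosSemidef := by
  have h : ∀ k, A k = (power (A k) (1 / 2))ᴴ * power (A k) (1 / 2) := fun k => by
    rw [power_isHermitian (hA k) (by norm_num), power_mul_power (hA k) (by norm_num) (by norm_num)
      (by norm_num), add_halves, power_one (hA k)]
  rw [funext h, ← tprod_mul, ← tprod_conjTranspose]
  exact posSemidef_conjTranspose_mul_self _

lemma trace_tprod (A : Fin n → Matrix a a ℂ) : (tprod A).trace = ∏ k, (A k).trace := by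
  simp only [trace, diag, tprod, Finset.prod_univ_sum, Fintype.piFinset_univ]

lemma rtr_tprod {A : Fin n → Matrix a a ℂ} (hA : ∀ k, ((rtr (A k) : ℝ) : ℂ) = (A k).trace) :
    rtr (tprod A) = ∏ k, rtr (A k) := by
  rw [rtr, trace_tprod, Finset.prod_congr rfl fun k _ => (hA k).symm, ← Complex.ofReal_prod,
    Complex.ofReal_re]

lemma ofReal_rtr {A : Matrix a a ℂ} (hA : A.PosSemidef) : ((rtr A : ℝ) : ℂ) = A.trace :=
  Complex.ext rfl (by simpa using (Complex.le_def.1 hA.trace_nonneg).2)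

lemma ofReal_rtr_mul {A B : Matrix a a ℂ} (hA : A.PosSemidef) (hB : B.PosSemidef) :
    ((rtr (A * B) : ℝ) : ℂ) = (A * B).trace := by
  refine (Complex.conj_eq_iff_re.1 ?_)
  rw [← Complex.star_def, ← trace_conjTranspose, conjTranspose_mul, hA.1, hB.1, trace_mul_comm]

lemma tensorPow_posSemidef {A : Matrix a a ℂ} (hA : A.PosSemidef) (n : ℕ) :
    (tensorPow A n).PosSemidef := tprod_posSemidef fun _ => hA

lemma rtr_tensorPow {A : Matrix a a ℂ} (hA : A.PosSemidef) (n : ℕ) :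
    rtr (tensorPow A n) = rtr A ^ n := by
  rw [tensorPow_eq_tprod, rtr_tprod fun _ => ofReal_rtr hA]; simp

lemma tensorPow_mul (A B : Matrix a a ℂ) (n : ℕ) :
    tensorPow (A * B) n = tensorPow A n * tensorPow B n := by
  simp only [tensorPow_eq_tprod, tprod_mul]

lemma tensorPow_conj (V : Matrix a b ℂ) (A : Matrix b b ℂ) (n : ℕ) :
    tensorPow (V * A * Vᴴ) n = (tprod fun _ : Fin n => V) * tensorPow A n *
      (tprod fun _ : Fin n => V)ᴴ := by
  simp only [tensorPow_eq_tprod, tprod_mul, tprod_conjTranspose]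

lemma tprod_isometry {V : Matrix a b ℂ} (hV : Vᴴ * V = 1) (n : ℕ) :
    (tprod fun _ : Fin n => V)ᴴ * (tprod fun _ : Fin n => V) = 1 := by
  rw [tprod_conjTranspose, tprod_mul, hV, tprod_one]

lemma tensorPow_rdiag (d : a → ℝ) (n : ℕ) :
    tensorPow (rdiag d) n = rdiag fun i => ∏ k, d (i k) := by
  rw [tensorPow_eq_tprod, tprod_rdiag]

lemma power_tensorPow {A : Matrix a a ℂ} (hA : A.PosSemidef) {s : ℝ} (hs : s ≠ 0) (n : ℕ) :
    power (tensorPow A n) s = tensorPow (power A s) n := by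
  obtain ⟨U, d, hU, -, rfl, hd⟩ := exists_unitary_rdiag hA.1
  have hd := hd hA
  rw [power_conj_rdiag hs hU, tensorPow_conj, tensorPow_conj, tensorPow_rdiag, tensorPow_rdiag,
    power_conj_rdiag hs (tprod_isometry hU n)]
  congr 3; ext i
  rw [Real.finsetProd_rpow _ _ fun k _ => hd (i k)]

lemma minimalQ_tensorPow {ρ σ : Matrix a a ℂ} (hρ : ρ.PosSemidef) (hσ : σ.PosSemidef) {α : ℝ}
    (hα : 0 < α) (hα1 : α ≠ 1) (n : ℕ) :
    minimalQ α (tensorPow ρ n) (tensorPow σ n) = minimalQ α ρ σ ^ n := by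
  have hc := exponent_ne_zero hα hα1
  have hX := sandwich_posSemidef hρ hσ hc
  rw [minimalQ, power_tensorPow hσ hc, ← tensorPow_mul, ← tensorPow_mul,
    power_tensorPow hX hα.ne', rtr_tensorPow (power_posSemidef hX hα.ne'), minimalQ]

end Tensor

/-! ### Types of sequences and classical inequalities -/

section Types

variable {κ : Type*} [Fintype κ] [DecidableEq κ] {n : ℕ}

/-- The type (empirical count) of a sequence of letters. -/
def seqType (y : Fin n → κ) (x : κ) : Fin (n + 1) :=
  ⟨(Finset.univ.filter fun k => y k = x).card,
    Nat.lt_succ_of_le ((Finset.card_le_univ _).trans (Fintype.card_fin n).le)⟩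

lemma prod_eq_of_seqType_eq {M : Type*} [CommMonoid M] {y z : Fin n → κ}
    (h : seqType y = seqType z) (f : κ → M) : ∏ k, f (y k) = ∏ k, f (z k) := by
  have key : ∀ y : Fin n → κ, ∏ k, f (y k) = ∏ x, f x ^ (seqType y x : ℕ) := fun y => by
    rw [← Finset.prod_fiberwise Finset.univ y fun k => f (y k)]
    refine Finset.prod_congr rfl fun x _ => ?_
    rw [Finset.prod_congr rfl fun k hk => by rw [(Finset.mem_filter.1 hk).2], Finset.prod_const]
    rfl
  rw [key, key, h]

lemma card_seqType (κ : Type*) [Fintype κ] [DecidableEq κ] (n : ℕ) :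
    (Fintype.card (κ → Fin (n + 1)) : ℝ) = ((n : ℝ) + 1) ^ Fintype.card κ := by
  simp

end Types

section Classical

variable {ι κ : Type*} [Fintype ι] [Fintype κ]

/-- Subexponential factors can be removed from an inequality between powers. -/
lemma le_of_pow_le_mul_pow {x y κ : ℝ} (hy : 0 ≤ y)
    (h : ∀ n : ℕ, x ^ n ≤ ((n : ℝ) + 1) ^ κ * y ^ n) : x ≤ y := by
  by_contra! hlt
  rcases hy.eq_or_lt with rfl | hy
  · have := h 1; simp at this; linarith
  have hq : 1 < x / y := (one_lt_div hy).2 hlt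
  have hq0 : 0 < x / y := by linarith
  have ht := (tendsto_pow_const_div_const_pow_of_one_lt ⌈κ⌉₊ hq).comp (tendsto_add_atTop_nat 1)
  have hle : 1 / (x / y) ≤ 0 := by
    refine ge_of_tendsto' ht fun n => ?_
    have h1 : (x / y) ^ n ≤ ((n : ℝ) + 1) ^ ⌈κ⌉₊ := by
      rw [div_pow, div_le_iff₀ (pow_pos hy n)]
      refine (h n).trans (mul_le_mul_of_nonneg_right ?_ (pow_nonneg hy.le n))
      rw [← Real.rpow_natCast]
      exact Real.rpow_le_rpow_of_exponent_le (by linarith [(Nat.cast_nonneg n : (0 : ℝ) ≤ n)])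
        (Nat.le_ceil κ)
    simp only [Function.comp_apply, Nat.cast_add, Nat.cast_one]
    rw [div_le_div_iff₀ hq0 (pow_pos hq0 _), one_mul, pow_succ]
    exact mul_le_mul_of_nonneg_right h1 hq0.le
  have : 0 < 1 / (x / y) := by positivity
  linarith

/-- Hölder's inequality with exponents `1 / α` and `1 / (1 - α)`. -/
lemma sum_rpow_mul_rpow_le {r m : ι → ℝ} (hr : ∀ i, 0 ≤ r i) (hm : ∀ i, 0 ≤ m i) {α : ℝ}
    (hα : 0 < α) (hα1 : α < 1) :
    ∑ i, r i ^ α * m i ^ (1 - α) ≤ (∑ i, r i) ^ α * (∑ i, m i) ^ (1 - α) := by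
  have hc : (1 / α).HolderConjugate (1 / (1 - α)) := by
    refine (Real.holderConjugate_iff).2 ⟨by rw [lt_div_iff₀ hα]; linarith, ?_⟩
    simp
  have := Real.inner_le_Lp_mul_Lq_of_nonneg Finset.univ hc
    (f := fun i => r i ^ α) (g := fun i => m i ^ (1 - α))
    (fun i _ => Real.rpow_nonneg (hr i) _) (fun i _ => Real.rpow_nonneg (hm i) _)
  have h1 : ∀ i, (r i ^ α) ^ (1 / α) = r i := fun i => by
    rw [← Real.rpow_mul (hr i), mul_one_div_cancel hα.ne', Real.rpow_one]
  have h2 : ∀ i, (m i ^ (1 - α)) ^ (1 / (1 - α)) = m i := fun i => by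
    rw [← Real.rpow_mul (hm i), mul_one_div_cancel (by linarith), Real.rpow_one]
  simpa only [h1, h2, one_div_one_div] using this

/-- Reverse Hölder inequality for `α > 1`. -/
lemma sum_rpow_mul_sum_rpow_le {t r m : ι → ℝ} (ht : ∀ i, 0 ≤ t i) (hr : ∀ i, 0 ≤ r i)
    (hm : ∀ i, 0 ≤ m i) (hrm : ∀ i, m i = 0 → r i = 0) {α : ℝ} (hα : 1 < α) :
    (∑ i, r i * t i) ^ α * (∑ i, m i * t i) ^ (1 - α) ≤
      ∑ i, r i ^ α * m i ^ (1 - α) * t i := by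
  have hα0 : 0 < α := by linarith
  have hA : ∀ i, 0 ≤ r i ^ α * m i ^ (1 - α) * t i := fun i =>
    mul_nonneg (mul_nonneg (Real.rpow_nonneg (hr i) _) (Real.rpow_nonneg (hm i) _)) (ht i)
  have hB : ∀ i, 0 ≤ m i * t i := fun i => mul_nonneg (hm i) (ht i)
  have hβ : 1 / α < 1 := by rw [div_lt_one hα0]; exact hα
  have h := sum_rpow_mul_rpow_le hA hB (one_div_pos.2 hα0) hβ
  have e : ∀ i, (r i ^ α * m i ^ (1 - α) * t i) ^ (1 / α) * (m i * t i) ^ (1 - 1 / α) =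
      r i * t i := fun i => by
    rcases (hm i).eq_or_lt with h0 | h0
    · rw [← h0, hrm i h0.symm, zero_mul, Real.zero_rpow (x := 1 - 1 / α) (by linarith),
        mul_zero]
    · have a1 : (r i ^ α) ^ (1 / α) = r i := by
        rw [← Real.rpow_mul (hr i), mul_one_div_cancel hα0.ne', Real.rpow_one]
      have a2 : (m i ^ (1 - α)) ^ (1 / α) * m i ^ (1 - 1 / α) = 1 := by
        rw [← Real.rpow_mul h0.le, ← Real.rpow_add h0]
        rw [show (1 - α) * (1 / α) + (1 - 1 / α) = 0 by field_simp; ring, Real.rpow_zero]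
      have a3 : t i ^ (1 / α) * t i ^ (1 - 1 / α) = t i := by
        rw [← Real.rpow_add' (ht i) (by norm_num)]; norm_num
      rw [Real.mul_rpow (mul_nonneg (Real.rpow_nonneg (hr i) _) (Real.rpow_nonneg h0.le _)) (ht i),
        Real.mul_rpow (Real.rpow_nonneg (hr i) _) (Real.rpow_nonneg h0.le _),
        Real.mul_rpow h0.le (ht i), a1]
      calc _ = r i * ((m i ^ (1 - α)) ^ (1 / α) * m i ^ (1 - 1 / α)) *
            (t i ^ (1 / α) * t i ^ (1 - 1 / α)) := by ring
        _ = _ := by rw [a2, a3, mul_one]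
  simp only [e] at h
  set A := ∑ i, r i ^ α * m i ^ (1 - α) * t i with hAdef
  set B := ∑ i, m i * t i with hBdef
  have hA0 : 0 ≤ A := Finset.sum_nonneg fun i _ => hA i
  have hB0 : 0 ≤ B := Finset.sum_nonneg fun i _ => hB i
  rcases hB0.eq_or_lt with h0 | h0
  · rw [← h0, Real.zero_rpow (by linarith), mul_zero]; exact hA0
  · have h2 := Real.rpow_le_rpow (Finset.sum_nonneg fun i _ => mul_nonneg (hr i) (ht i)) h hα0.le
    rw [Real.mul_rpow (Real.rpow_nonneg hA0 _) (Real.rpow_nonneg hB0 _), ← Real.rpow_mul hA0,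
      one_div_mul_cancel hα0.ne', Real.rpow_one, ← Real.rpow_mul hB0] at h2
    calc _ ≤ A * B ^ ((1 - 1 / α) * α) * B ^ (1 - α) :=
          mul_le_mul_of_nonneg_right h2 (Real.rpow_nonneg hB0 _)
      _ = A := by
          rw [mul_assoc, ← Real.rpow_add h0, show (1 - 1 / α) * α + (1 - α) = 0 by
            field_simp; ring, Real.rpow_zero, mul_one]

/-- Classical data processing for `α > 1`; the columns of the stochastic matrix `T` sum to `1`. -/
lemma classical_data_processing {T : κ → ι → ℝ} (hT : ∀ x i, 0 ≤ T x i) (hT1 : ∀ i, ∑ x, T x i = 1)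
    {r m : ι → ℝ} (hr : ∀ i, 0 ≤ r i) (hm : ∀ i, 0 ≤ m i) (hrm : ∀ i, m i = 0 → r i = 0) {α : ℝ}
    (hα : 1 < α) :
    ∑ x, (∑ i, r i * T x i) ^ α * (∑ i, m i * T x i) ^ (1 - α) ≤
      ∑ i, r i ^ α * m i ^ (1 - α) := by
  calc _ ≤ ∑ x, ∑ i, r i ^ α * m i ^ (1 - α) * T x i :=
        Finset.sum_le_sum fun x _ => sum_rpow_mul_sum_rpow_le (hT x) hr hm hrm hα
    _ = _ := by rw [Finset.sum_comm]; simp [← Finset.mul_sum, hT1]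

end Classical

/-! ### Pinching tensor powers -/

section Structure

variable {a T : Type*} [Fintype a] [DecidableEq a] [Fintype T] [DecidableEq T]

/-- If the function `m` is constant on labels, the eigenbasis of the pinching of `ρ` can be chosen
to be an eigenbasis of `rdiag m` too. -/
lemma exists_pinching_basis {L : a → T} {ρ : Matrix a a ℂ} (hρ : ρ.PosSemidef) {m : a → ℝ}
    (hmL : ∀ i j, L i = L j → m i = m j) :
    ∃ (W : Matrix a a ℂ) (r : a → ℝ), Wᴴ * W = 1 ∧ W * Wᴴ = 1 ∧ rdiag m = W * rdiag m * Wᴴ ∧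
      pinch L ρ = W * rdiag r * Wᴴ ∧ ∀ i, (Wᴴ * ρ * W) i i = r i := by
  obtain ⟨W, r, hW, hW', hWL, hr⟩ :=
    IsPinched.exists_unitary_rdiag (pinch_posSemidef (L := L) hρ).1 (isPinched_pinch L ρ)
  refine ⟨W, r, hW, hW', ?_, hr, fun i => ?_⟩
  · have h : W * rdiag m = rdiag m * W := by
      ext i j
      rw [rdiag, mul_diagonal, diagonal_mul]
      by_cases hij : L i = L j
      · rw [hmL i j hij, mul_comm]
      · simp [hWL i j hij]
    rw [h, Matrix.mul_assoc, hW', Matrix.mul_one]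
  · have h := pinch_conj hWL.conjTranspose ρ
    rw [conjTranspose_conjTranspose, hr] at h
    have h2 : Wᴴ * (W * rdiag r * Wᴴ) * W = rdiag r := by
      rw [show Wᴴ * (W * rdiag r * Wᴴ) * W = (Wᴴ * W) * rdiag r * (Wᴴ * W) by
        simp only [Matrix.mul_assoc], hW, Matrix.one_mul, Matrix.mul_one]
    rw [h2] at h
    have := congrFun (congrFun h i) i
    simpa [pinch, rdiag] using this

/-- A basis in which `σ^{⊗n}` is diagonal with entries `m` and a pinching of `ρ^{⊗n}` is diagonal
with entries `r`, together with the comparison of the classical and the quantum functional. -/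
structure IsPinchingBasis (ρ σ : Matrix a a ℂ) (n : ℕ)
    (W : Matrix (Fin n → a) (Fin n → a) ℂ) (r m : (Fin n → a) → ℝ) : Prop where
  conjTranspose_mul_self : Wᴴ * W = 1
  mul_conjTranspose_self : W * Wᴴ = 1
  left_nonneg : ∀ i, 0 ≤ r i
  right_nonneg : ∀ i, 0 ≤ m i
  right_eq : tensorPow σ n = W * rdiag m * Wᴴ
  left_diag : ∀ i, (Wᴴ * tensorPow ρ n * W) i i = r i
  left_le : tensorPow ρ n ≤ (((n : ℝ) + 1) ^ Fintype.card a) • (W * rdiag r * Wᴴ)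
  sum_le : ∀ α : ℝ, 1 < α → ∑ i, r i ^ α * m i ^ (1 - α) ≤ minimalQ α ρ σ ^ n
  sum_le_of_lt_one : ∀ α : ℝ, 0 < α → α < 1 → ∑ i, r i ^ α * m i ^ (1 - α) ≤
    (((n : ℝ) + 1) ^ Fintype.card a) ^ (1 - α) * minimalQ α ρ σ ^ n

/-- Take an eigenbasis of `σ^{⊗n}`, label its elements by their types, of which there are at most
`(n + 1) ^ |a|`, and pinch along this labelling. -/
lemma exists_isPinchingBasis {ρ σ : Matrix a a ℂ} (hρ : ρ.PosSemidef) (hσ : σ.PosSemidef) (n : ℕ) :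
    ∃ W r m, IsPinchingBasis ρ σ n W r m := by
  obtain ⟨U, μ, hU, hU', hσU, hμ⟩ := exists_unitary_rdiag hσ.1
  have hμ := hμ hσ
  set ρ' := Uᴴ * ρ * U with hρ'def
  have hρ' : ρ'.PosSemidef := hρ.conjTranspose_mul_mul_same U
  have hρU : ρ = U * ρ' * Uᴴ := by
    rw [hρ'def, show U * (Uᴴ * ρ * U) * Uᴴ = (U * Uᴴ) * ρ * (U * Uᴴ) by
      simp only [Matrix.mul_assoc], hU', Matrix.one_mul, Matrix.mul_one]
  set m : (Fin n → a) → ℝ := fun i => ∏ k, μ (i k) with hmdef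
  have hm : ∀ i, 0 ≤ m i := fun i => Finset.prod_nonneg fun k _ => hμ _
  have hρn := tensorPow_posSemidef hρ' n
  obtain ⟨W, r, hW, hW', hWm, hWr, hdiag⟩ := exists_pinching_basis (L := seqType) hρn (m := m)
    fun i j h => prod_eq_of_seqType_eq h μ
  set V := tprod fun _ : Fin n => U with hVdef
  have hV : Vᴴ * V = 1 := tprod_isometry hU n
  have hV' : V * Vᴴ = 1 := by
    rw [hVdef, tprod_conjTranspose, tprod_mul, hU', tprod_one]
  have hr : ∀ i, 0 ≤ r i := fun i => by
    have h := (hρn.conjTranspose_mul_mul_same W).diag_nonneg (i := i)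
    rw [hdiag] at h
    exact_mod_cast h
  have hρV : tensorPow ρ n = V * tensorPow ρ' n * Vᴴ := by rw [hρU]; exact tensorPow_conj U ρ' n
  have hσV : tensorPow σ n = V * rdiag m * Vᴴ := by
    rw [hσU, tensorPow_conj, tensorPow_rdiag]
  have hcard := card_seqType a n
  have hQ : ∀ α : ℝ, 0 < α → α ≠ 1 →
      minimalQ α (tensorPow ρ' n) (rdiag m) = minimalQ α ρ σ ^ n := fun α hα hα1 => by
    rw [← minimalQ_tensorPow hρ hσ hα hα1, hρV, hσV,
      minimalQ_conj_isometry hV hρn (rdiag_posSemidef hm) hα hα1]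
  have hsum : ∀ α : ℝ, 0 < α → α ≠ 1 → ∑ i, r i ^ α * m i ^ (1 - α) =
      rtr (power (pinch seqType (power (rdiag m) ((1 - α) / (2 * α)) * tensorPow ρ' n *
        power (rdiag m) ((1 - α) / (2 * α)))) α) := fun α hα hα1 => by
    have hc := pinch_conj (L := seqType) (C := power (rdiag m) ((1 - α) / (2 * α)))
      (isPinched_rdiag.power (rdiag_posSemidef hm) _) (tensorPow ρ' n)
    rw [power_isHermitian (rdiag_posSemidef hm) (exponent_ne_zero hα hα1)] at hc
    rw [hc, ← minimalQ, hWr, hWm, minimalQ_conj_isometry hW (rdiag_posSemidef hr)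
      (rdiag_posSemidef hm) hα hα1, minimalQ_rdiag hr hm hα hα1]
  refine ⟨V * W, r, m, ?_, ?_, hr, hm, ?_, fun i => ?_, ?_, fun α hα => ?_, fun α hα hα1 => ?_⟩
  · rw [conjTranspose_mul, Matrix.mul_assoc, ← Matrix.mul_assoc Vᴴ, hV, Matrix.one_mul, hW]
  · rw [conjTranspose_mul, Matrix.mul_assoc, ← Matrix.mul_assoc W, hW', Matrix.one_mul, hV']
  · rw [hσV, conjTranspose_mul]
    conv_lhs => rw [hWm]
    simp only [Matrix.mul_assoc]
  · rw [← hdiag i, hρV, conjTranspose_mul]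
    refine congrFun (congrFun ?_ i) i
    calc _ = Wᴴ * (Vᴴ * V) * tensorPow ρ' n * (Vᴴ * V) * W := by simp only [Matrix.mul_assoc]
      _ = _ := by rw [hV, Matrix.mul_one, Matrix.mul_one]
  · have h := conj_le_conj (le_card_smul_pinch (L := seqType) hρn) V
    rw [hWr, hcard, ← hρV] at h
    refine h.trans (le_of_eq ?_)
    rw [conjTranspose_mul, Matrix.mul_smul, Matrix.smul_mul]
    simp only [Matrix.mul_assoc]
  · have h1 : α ≠ 1 := hα.ne'
    have h0 : 0 < α := by linarith
    rw [hsum α h0 h1, ← hQ α h0 h1]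
    exact rtr_power_pinch_le (sandwich_posSemidef hρn (rdiag_posSemidef hm)
      (exponent_ne_zero h0 h1)) hα
  · rw [hsum α hα hα1.ne, ← hQ α hα hα1.ne, ← hcard]
    exact rtr_power_pinch_le_of_lt_one (sandwich_posSemidef hρn (rdiag_posSemidef hm)
      (exponent_ne_zero hα hα1.ne)) hα hα1

lemma IsPinchingBasis.pow_le {ρ σ : Matrix a a ℂ} (hρ : ρ.PosSemidef) (hσ : σ.PosSemidef) {n : ℕ}
    {W : Matrix (Fin n → a) (Fin n → a) ℂ} {r m : (Fin n → a) → ℝ}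
    (h : IsPinchingBasis ρ σ n W r m) {α : ℝ} (hα : 0 < α) (hα1 : α ≠ 1) :
    minimalQ α ρ σ ^ n ≤
      (((n : ℝ) + 1) ^ Fintype.card a) ^ α * ∑ i, r i ^ α * m i ^ (1 - α) := by
  have hr := rdiag_posSemidef h.left_nonneg
  have hm := rdiag_posSemidef h.right_nonneg
  have hrW := hr.mul_mul_conjTranspose_same W
  have hmW := hm.mul_mul_conjTranspose_same W
  rw [← minimalQ_tensorPow hρ hσ hα hα1, ← minimalQ_rdiag h.left_nonneg h.right_nonneg hα hα1,
    ← minimalQ_conj_isometry h.conjTranspose_mul_self hr hm hα hα1,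
    ← minimalQ_smul_left hrW hmW hα hα1 (by positivity), h.right_eq]
  exact minimalQ_mono_left (tensorPow_posSemidef hρ n) h.left_le hmW hα hα1

lemma IsPinchingBasis.sum_left {ρ σ : Matrix a a ℂ} {n : ℕ}
    {W : Matrix (Fin n → a) (Fin n → a) ℂ} {r m : (Fin n → a) → ℝ}
    (h : IsPinchingBasis ρ σ n W r m) : ∑ i, r i = rtr (tensorPow ρ n) := by
  have h1 := rtr_conj_isometry (V := Wᴴ)
    (by rw [conjTranspose_conjTranspose]; exact h.mul_conjTranspose_self) (tensorPow ρ n)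
  rw [conjTranspose_conjTranspose] at h1
  rw [← h1]
  simp [rtr, trace, h.left_diag]

lemma IsPinchingBasis.sum_right {ρ σ : Matrix a a ℂ} {n : ℕ}
    {W : Matrix (Fin n → a) (Fin n → a) ℂ} {r m : (Fin n → a) → ℝ}
    (h : IsPinchingBasis ρ σ n W r m) : ∑ i, m i = rtr (tensorPow σ n) := by
  rw [h.right_eq, rtr_conj_isometry h.conjTranspose_mul_self, rtr_rdiag]

/-- Hölder's inequality, the data processing inequality for the trace, obtained from the classical
one by pinching. -/
lemma minimalQ_le_rtr_rpow_mul {ρ σ : Matrix a a ℂ} (hρ : ρ.PosSemidef) (hσ : σ.PosSemidef) {α : ℝ}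
    (hα : 0 < α) (hα1 : α < 1) : minimalQ α ρ σ ≤ rtr ρ ^ α * rtr σ ^ (1 - α) := by
  have h1 := rtr_nonneg hρ
  have h2 := rtr_nonneg hσ
  refine le_of_pow_le_mul_pow (κ := Fintype.card a * α) (by positivity) fun n => ?_
  obtain ⟨W, r, m, h⟩ := exists_isPinchingBasis hρ hσ n
  refine (h.pow_le hρ hσ hα hα1.ne).trans ?_
  have hn : (0 : ℝ) ≤ (n : ℝ) + 1 := by positivity
  rw [Real.rpow_mul hn, Real.rpow_natCast]
  refine mul_le_mul_of_nonneg_left ?_ (by positivity)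
  refine (sum_rpow_mul_rpow_le h.left_nonneg h.right_nonneg hα hα1).trans (le_of_eq ?_)
  rw [h.sum_left, h.sum_right, rtr_tensorPow hρ, rtr_tensorPow hσ, mul_pow, ← Real.rpow_natCast,
    ← Real.rpow_natCast, ← Real.rpow_mul h1, ← Real.rpow_mul h2, mul_comm (n : ℝ), mul_comm (n : ℝ),
    Real.rpow_mul h1, Real.rpow_mul h2, Real.rpow_natCast, Real.rpow_natCast]

end Structure

/-! ### Domination and orthogonality -/

section Dominated

variable {a b ι : Type*} [Fintype a] [DecidableEq a] [Fintype b] [DecidableEq b] [Fintype ι]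

lemma dominated_mul (D σ : Matrix a a ℂ) : Dominated (D * σ) σ := fun v hv => by
  rw [← mulVec_mulVec, hv, mulVec_zero]

lemma Dominated.exists_eq_mul {ρ σ : Matrix a a ℂ} (hσ : σ.PosSemidef) (h : Dominated ρ σ) :
    ∃ D, ρ = D * σ := by
  obtain ⟨U, d, hU, hU', rfl, hd⟩ := exists_unitary_rdiag hσ.1
  set P := U * rdiag (fun i => (d i)⁻¹ * d i) * Uᴴ with hP
  have h1 : U * rdiag d * Uᴴ * (1 - P) = 0 := by
    rw [Matrix.mul_sub, Matrix.mul_one, hP, conj_rdiag_mul hU, sub_eq_zero]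
    congr 3; ext i
    by_cases h : d i = 0 <;> simp [h]
  have h2 : ρ * (1 - P) = 0 := by
    ext i j
    have h3 : (U * rdiag d * Uᴴ) *ᵥ (fun k => (1 - P) k j) = 0 :=
      funext fun i => congrFun (congrFun h1 i) j
    exact congrFun (h _ h3) i
  refine ⟨ρ * (U * rdiag (fun i => (d i)⁻¹) * Uᴴ), ?_⟩
  rw [Matrix.mul_assoc, conj_rdiag_mul hU, ← hP]
  rw [Matrix.mul_sub, Matrix.mul_one, sub_eq_zero] at h2
  exact h2

/-- Positive semidefinite matrices are orthogonal for the trace only if their product vanishes. -/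
lemma mul_eq_zero_of_rtr_eq_zero {A B : Matrix a a ℂ} (hA : A.PosSemidef) (hB : B.PosSemidef)
    (h : rtr (A * B) = 0) : A * B = 0 := by
  have e : ∀ {C : Matrix a a ℂ}, C.PosSemidef → C = power C (1 / 2) * power C (1 / 2) :=
    fun hC => by
      rw [power_mul_power hC (by norm_num) (by norm_num) (by norm_num), add_halves, power_one hC]
  set R := power A (1 / 2) with hR
  set S := power B (1 / 2) with hS
  have hRh : Rᴴ = R := power_isHermitian hA (by norm_num)
  have hSh : Sᴴ = S := power_isHermitian hB (by norm_num)
  have hA2 : A = R * R := e hA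
  have hB2 : B = S * S := e hB
  have h1 : rtr ((R * S)ᴴ * (R * S)) = 0 := by
    rw [← h, conjTranspose_mul, hRh, hSh, hA2, hB2, Matrix.mul_assoc S, rtr_mul_comm S]
    simp only [Matrix.mul_assoc]
  have h2 : ((R * S)ᴴ * (R * S)).trace = 0 := by
    rw [← ofReal_rtr (posSemidef_conjTranspose_mul_self _), h1, Complex.ofReal_zero]
  have h3 := trace_conjTranspose_mul_self_eq_zero_iff.1 h2
  rw [hA2, hB2, show R * R * (S * S) = R * (R * S) * S by simp only [Matrix.mul_assoc], h3,
    Matrix.mul_zero, Matrix.zero_mul]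

lemma eq_zero_of_rtr_eq_zero {A : Matrix a a ℂ} (hA : A.PosSemidef) (h : rtr A = 0) : A = 0 := by
  have := mul_eq_zero_of_rtr_eq_zero hA PosSemidef.one (by rwa [Matrix.mul_one])
  rwa [Matrix.mul_one] at this

lemma rtr_pos {A : Matrix a a ℂ} (hA : A.PosSemidef) (h : A ≠ 0) : 0 < rtr A :=
  (rtr_nonneg hA).lt_of_ne fun h0 => h (eq_zero_of_rtr_eq_zero hA h0.symm)

lemma Dominated.rtr_mul_eq_zero {ρ σ M : Matrix a a ℂ} (hσ : σ.PosSemidef) (hM : M.PosSemidef)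
    (h : Dominated ρ σ) (h0 : rtr (σ * M) = 0) : rtr (ρ * M) = 0 := by
  obtain ⟨D, rfl⟩ := h.exists_eq_mul hσ
  rw [Matrix.mul_assoc, mul_eq_zero_of_rtr_eq_zero hσ hM h0, Matrix.mul_zero]
  simp [rtr]

lemma Dominated.tensorPow {ρ σ : Matrix a a ℂ} (hσ : σ.PosSemidef) (h : Dominated ρ σ) (n : ℕ) :
    Dominated (tensorPow ρ n) (tensorPow σ n) := by
  obtain ⟨D, rfl⟩ := h.exists_eq_mul hσ
  rw [tensorPow_mul]; exact dominated_mul _ _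

/-- `minimalQ` vanishes only at orthogonal pairs. -/
lemma orthogonal_of_minimalQ_eq_zero {ρ σ : Matrix a a ℂ} (hρ : ρ.PosSemidef) (hσ : σ.PosSemidef)
    {α : ℝ} (hα : 0 < α) (hα1 : α ≠ 1) (h : minimalQ α ρ σ = 0) : Orthogonal ρ σ := by
  have hc := exponent_ne_zero hα hα1
  have hX := sandwich_posSemidef hρ hσ hc
  have h1 := eq_zero_of_rtr_eq_zero (power_posSemidef hX hα.ne') h
  have h2 : power σ ((1 - α) / (2 * α)) * ρ * power σ ((1 - α) / (2 * α)) = 0 := by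
    have := power_power hX hα.ne' (inv_ne_zero hα.ne')
    rw [h1, power_zero_matrix (inv_ne_zero hα.ne'), mul_inv_cancel₀ hα.ne', power_one hX] at this
    exact this.symm
  have hS := power_posSemidef hσ hc
  have hR := power_posSemidef hρ (s := 1 / 2) (by norm_num)
  -- multiplying by a positive power of `σ` turns the sandwich into one with the square root of `σ`
  set S := power σ ((1 - α) / (2 * α)) with hSdef
  have hne : (1 - α) / (2 * α) + (1 - α) / (2 * α) ≠ 0 := by
    rw [← two_mul]; exact mul_ne_zero two_ne_zero hc
  have h3 : rtr (power σ ((1 - α) / (2 * α) + (1 - α) / (2 * α)) * ρ) = 0 := by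
    have : rtr (S * ρ * S) = 0 := by rw [h2]; simp [rtr]
    rwa [rtr_mul_comm, ← Matrix.mul_assoc, hSdef, power_mul_power hσ hc hc hne] at this
  have h4 := mul_eq_zero_of_rtr_eq_zero (power_posSemidef hσ hne) hρ h3
  obtain ⟨D, hD⟩ : ∃ D, σ = D * power σ ((1 - α) / (2 * α) + (1 - α) / (2 * α)) := by
    obtain ⟨U, d, hU, hU', hσU, hd⟩ := exists_unitary_rdiag hσ.1
    set e := (1 - α) / (2 * α) + (1 - α) / (2 * α)
    refine ⟨U * rdiag (fun i => d i * (d i ^ e)⁻¹) * Uᴴ, ?_⟩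
    rw [hσU, power_conj_rdiag hne hU, conj_rdiag_mul hU]
    congr 3; ext i
    rcases (hd hσ i).eq_or_lt with h | h
    · simp [← h]
    · rw [mul_assoc, inv_mul_cancel₀ (Real.rpow_pos_of_pos h _).ne', mul_one]
  have h5 : σ * ρ = 0 := by rw [hD, Matrix.mul_assoc, h4, Matrix.mul_zero]
  refine ⟨?_, h5⟩
  have := congrArg conjTranspose h5
  rwa [conjTranspose_mul, hρ.1, hσ.1, conjTranspose_zero] at this

end Dominated

/-! ### Measurements -/

section Measured

variable {a κ : Type*} [Fintype a] [DecidableEq a] [Fintype κ] [DecidableEq κ]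

lemma IsPOVM.measure_nonneg {M : κ → Matrix a a ℂ} (hM : IsPOVM M) {ρ : Matrix a a ℂ}
    (hρ : ρ.PosSemidef) (x : κ) : 0 ≤ measure M ρ x := rtr_mul_nonneg hρ (hM.posSemidef x)

lemma IsPOVM.sum_measure {M : κ → Matrix a a ℂ} (hM : IsPOVM M) (ρ : Matrix a a ℂ) :
    ∑ x, measure M ρ x = rtr ρ := by
  simp only [measure]
  rw [← rtr_sum, ← Matrix.mul_sum, hM.sum_eq_one, Matrix.mul_one]

/-- The product measurement on `n` copies. -/
def povmPow (M : κ → Matrix a a ℂ) (n : ℕ) (y : Fin n → κ) : Matrix (Fin n → a) (Fin n → a) ℂ :=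
  tprod fun k => M (y k)

lemma IsPOVM.povmPow {M : κ → Matrix a a ℂ} (hM : IsPOVM M) (n : ℕ) : IsPOVM (povmPow M n) where
  posSemidef y := tprod_posSemidef fun k => hM.posSemidef _
  sum_eq_one := by
    have := tprod_sum (n := n) fun _ => M
    rw [hM.sum_eq_one, tprod_one] at this
    exact this.symm

lemma IsPOVM.measure_povmPow {M : κ → Matrix a a ℂ} (hM : IsPOVM M) {ρ : Matrix a a ℂ}
    (hρ : ρ.PosSemidef) {n : ℕ} (y : Fin n → κ) :
    measure (QuantumRenyi.povmPow M n) (tensorPow ρ n) y = ∏ k, measure M ρ (y k) := by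
  rw [measure, QuantumRenyi.povmPow, tensorPow_eq_tprod, tprod_mul,
    rtr_tprod fun k => ofReal_rtr_mul hρ (hM.posSemidef _)]
  rfl

lemma pow_sum_rpow_mul_rpow {p q : κ → ℝ} (hp : ∀ x, 0 ≤ p x) (hq : ∀ x, 0 ≤ q x) (s t : ℝ)
    (n : ℕ) : (∑ x, p x ^ s * q x ^ t) ^ n =
      ∑ y : Fin n → κ, (∏ k, p (y k)) ^ s * (∏ k, q (y k)) ^ t := by
  have := Finset.prod_univ_sum (fun _ : Fin n => (Finset.univ : Finset κ))
    fun _ x => p x ^ s * q x ^ t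
  rw [Finset.prod_const, Finset.card_univ, Fintype.card_fin, Fintype.piFinset_univ] at this
  rw [this]
  refine Finset.sum_congr rfl fun y _ => ?_
  rw [Finset.prod_mul_distrib, Real.finsetProd_rpow _ _ fun k _ => hp _,
    Real.finsetProd_rpow _ _ fun k _ => hq _]

lemma rtr_conj_rdiag_mul (W M : Matrix a a ℂ) (r : a → ℝ) :
    rtr (W * rdiag r * Wᴴ * M) = ∑ i, r i * ((Wᴴ * M * W) i i).re := by
  rw [show W * rdiag r * Wᴴ * M = W * (rdiag r * (Wᴴ * M)) by simp only [Matrix.mul_assoc],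
    rtr_mul_comm, Matrix.mul_assoc, rtr, trace, Complex.re_sum]
  refine Finset.sum_congr rfl fun i _ => ?_
  rw [diag, rdiag, diagonal_mul, Complex.re_ofReal_mul]

/-- Measurements do not increase `minimalQ` for `α > 1`. On `n` copies, the pinching inequality
compares the outcome distribution of `ρ^{⊗n}` with the image of the diagonal of a pinching of
`ρ^{⊗n}` under a stochastic matrix. -/
lemma sum_measure_le_minimalQ {M : κ → Matrix a a ℂ} (hM : IsPOVM M) {ρ σ : Matrix a a ℂ}
    (hρ : ρ.PosSemidef) (hσ : σ.PosSemidef) (hd : Dominated ρ σ) {α : ℝ} (hα : 1 < α) :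
    ∑ x, measure M ρ x ^ α * measure M σ x ^ (1 - α) ≤ minimalQ α ρ σ := by
  have hα0 : 0 < α := by linarith
  refine le_of_pow_le_mul_pow (κ := Fintype.card a * α) (minimalQ_nonneg hρ hσ hα0 hα.ne')
    fun n => ?_
  obtain ⟨W, r, m, h⟩ := exists_isPinchingBasis hρ hσ n
  have hn : (0 : ℝ) ≤ (n : ℝ) + 1 := by positivity
  have hMn := hM.povmPow n
  have hT : ∀ y i, 0 ≤ ((Wᴴ * povmPow M n y * W) i i).re := fun y i =>
    (Complex.le_def.1 ((hMn.posSemidef y).conjTranspose_mul_mul_same W).diag_nonneg).1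
  have hT1 : ∀ i, ∑ y, ((Wᴴ * povmPow M n y * W) i i).re = 1 := fun i => by
    rw [← Complex.re_sum, ← Matrix.sum_apply, ← Matrix.sum_mul, ← Matrix.mul_sum, hMn.sum_eq_one,
      Matrix.mul_one, h.conjTranspose_mul_self, one_apply_eq, Complex.one_re]
  have hrm : ∀ i, m i = 0 → r i = 0 := fun i hi => by
    obtain ⟨D, hD⟩ := (hd.tensorPow hσ n).exists_eq_mul (tensorPow_posSemidef hσ n)
    have h1 := h.left_diag i
    rw [hD, h.right_eq, show Wᴴ * (D * (W * rdiag m * Wᴴ)) * W =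
      (Wᴴ * D * W) * rdiag m * (Wᴴ * W) by simp only [Matrix.mul_assoc],
      h.conjTranspose_mul_self, Matrix.mul_one, rdiag, mul_diagonal, hi] at h1
    simpa using h1.symm
  have hp : ∀ y, measure (povmPow M n) (tensorPow ρ n) y ≤ ((n : ℝ) + 1) ^ Fintype.card a *
      ∑ i, r i * ((Wᴴ * povmPow M n y * W) i i).re := fun y => by
    rw [← rtr_conj_rdiag_mul, ← rtr_smul, ← Matrix.smul_mul, measure, ← sub_nonneg, ← rtr_sub,
      ← Matrix.sub_mul]
    exact rtr_mul_nonneg (Matrix.le_iff.1 h.left_le) (hMn.posSemidef y)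
  have hq : ∀ y, measure (povmPow M n) (tensorPow σ n) y =
      ∑ i, m i * ((Wᴴ * povmPow M n y * W) i i).re := fun y => by
    rw [← rtr_conj_rdiag_mul, measure, h.right_eq]
  rw [pow_sum_rpow_mul_rpow (hM.measure_nonneg hρ) (hM.measure_nonneg hσ)]
  simp only [← hM.measure_povmPow hρ, ← hM.measure_povmPow hσ]
  calc _ ≤ ∑ y, (((n : ℝ) + 1) ^ Fintype.card a *
        ∑ i, r i * ((Wᴴ * povmPow M n y * W) i i).re) ^ α *
        (∑ i, m i * ((Wᴴ * povmPow M n y * W) i i).re) ^ (1 - α) := by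
        refine Finset.sum_le_sum fun y _ => ?_
        rw [hq]
        refine mul_le_mul_of_nonneg_right (Real.rpow_le_rpow
          (hMn.measure_nonneg (tensorPow_posSemidef hρ n) y) (hp y) hα0.le)
          (Real.rpow_nonneg (Finset.sum_nonneg fun i _ => mul_nonneg (h.right_nonneg i) (hT y i)) _)
    _ = (((n : ℝ) + 1) ^ Fintype.card a) ^ α *
        ∑ y, (∑ i, r i * ((Wᴴ * povmPow M n y * W) i i).re) ^ α *
        (∑ i, m i * ((Wᴴ * povmPow M n y * W) i i).re) ^ (1 - α) := by
        rw [Finset.mul_sum]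
        refine Finset.sum_congr rfl fun y _ => ?_
        rw [Real.mul_rpow (by positivity) (Finset.sum_nonneg fun i _ =>
          mul_nonneg (h.left_nonneg i) (hT y i)), mul_assoc]
    _ ≤ (((n : ℝ) + 1) ^ Fintype.card a) ^ α * minimalQ α ρ σ ^ n := by
        refine mul_le_mul_of_nonneg_left ?_ (by positivity)
        exact (classical_data_processing hT hT1 h.left_nonneg h.right_nonneg hrm hα).trans
          (h.sum_le α hα)
    _ = _ := by rw [Real.rpow_mul hn, Real.rpow_natCast]

/-- For `1 / 2 ≤ α < 1`, pinching both arguments along a labelling and applying Hölder's inequality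
in each block. -/
lemma minimalQ_le_sum_blocks {T : Type*} [Fintype T] [DecidableEq T] (L : a → T)
    {ρ σ : Matrix a a ℂ} (hρ : ρ.PosSemidef) (hσ : σ.PosSemidef) {α : ℝ} (hα : 1 / 2 ≤ α)
    (hα1 : α < 1) : minimalQ α ρ σ ≤ Fintype.card T *
      ∑ t, rtr (labelProj L t * ρ * labelProj L t) ^ α *
        rtr (labelProj L t * σ * labelProj L t) ^ (1 - α) := by
  have hα0 : 0 < α := by linarith
  have hρL := pinch_posSemidef (L := L) hρ
  have hσL := pinch_posSemidef (L := L) hσ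
  have hT : (0 : ℝ) ≤ Fintype.card T := by positivity
  have e : ∀ (X : Matrix a a ℂ) t, labelProj L t * pinch L X * labelProj L t =
      labelProj L t * X * labelProj L t := fun X t => by
    ext i j
    simp only [mul_labelProj_apply, labelProj_mul_apply, pinch, of_apply]
    split_ifs with h1 h2 h3 <;> simp_all
  calc minimalQ α ρ σ ≤ minimalQ α ((Fintype.card T : ℝ) • pinch L ρ)
        ((Fintype.card T : ℝ) • pinch L σ) :=
        (minimalQ_mono_left hρ (le_card_smul_pinch hρ) hσ hα0 hα1.ne).trans
          (minimalQ_mono_right (posSemidef_of_le hρ (le_card_smul_pinch hρ)) hσ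
            (le_card_smul_pinch hσ) hα hα1)
    _ = Fintype.card T * minimalQ α (pinch L ρ) (pinch L σ) := by
        rw [minimalQ_smul_left hρL (hσL.smul hT) hα0 hα1.ne hT,
          minimalQ_smul_right hρL hσL hα0 hα1.ne hT, ← mul_assoc,
          ← Real.rpow_add' hT (by norm_num)]
        norm_num
    _ ≤ _ := by
        refine mul_le_mul_of_nonneg_left ?_ hT
        rw [minimalQ_eq_sum_blocks hρL hσL (isPinched_pinch L ρ) (isPinched_pinch L σ) hα0 hα1.ne]
        refine Finset.sum_le_sum fun t _ => ?_
        rw [e, e]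
        exact minimalQ_le_rtr_rpow_mul (labelProj_conj_posSemidef hρ t)
          (labelProj_conj_posSemidef hσ t) hα0 hα1

/-- The Naimark isometry of a measurement: `V v = ∑ x, √M_x v ⊗ e_x`. -/
def naimark (M : κ → Matrix a a ℂ) : Matrix (a × κ) a ℂ :=
  of fun i j => power (M i.2) (1 / 2) i.1 j

lemma IsPOVM.naimark_isometry {M : κ → Matrix a a ℂ} (hM : IsPOVM M) :
    (naimark M)ᴴ * naimark M = 1 := by
  rw [← hM.sum_eq_one]
  ext i j
  rw [Matrix.sum_apply, Matrix.mul_apply, Fintype.sum_prod_type, Finset.sum_comm]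
  refine Finset.sum_congr rfl fun x _ => ?_
  have h := hM.posSemidef x
  have h2 : M x = (power (M x) (1 / 2))ᴴ * power (M x) (1 / 2) := by
    rw [power_isHermitian h (by norm_num), power_mul_power h (by norm_num) (by norm_num)
      (by norm_num), add_halves, power_one h]
  rw [h2, Matrix.mul_apply]
  rfl

lemma IsPOVM.sum_diag_naimark {M : κ → Matrix a a ℂ} (hM : IsPOVM M) (ρ : Matrix a a ℂ) (x : κ) :
    ∑ i, (naimark M * ρ * (naimark M)ᴴ) (i, x) (i, x) = (ρ * M x).trace := by
  have h := hM.posSemidef x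
  have h2 : M x = power (M x) (1 / 2) * power (M x) (1 / 2) := by
    rw [power_mul_power h (by norm_num) (by norm_num) (by norm_num), add_halves, power_one h]
  have h3 : (power (M x) (1 / 2))ᴴ = power (M x) (1 / 2) := power_isHermitian h (by norm_num)
  have h4 : (ρ * M x).trace = (power (M x) (1 / 2) * ρ * (power (M x) (1 / 2))ᴴ).trace := by
    rw [h3, trace_mul_comm (power (M x) (1 / 2) * ρ), ← Matrix.mul_assoc, ← h2, trace_mul_comm]
  rw [h4]
  rfl

/-- Measurements do not decrease `minimalQ` for `1 / 2 ≤ α < 1`. On `n` copies of the Naimark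
dilation, one pinches along the type of the sequence of outcomes; the number of types is
subexponential, and all sequences of one type are equally likely. -/
lemma minimalQ_le_sum_measure {M : κ → Matrix a a ℂ} (hM : IsPOVM M) {ρ σ : Matrix a a ℂ}
    (hρ : ρ.PosSemidef) (hσ : σ.PosSemidef) {α : ℝ} (hα : 1 / 2 ≤ α) (hα1 : α < 1) :
    minimalQ α ρ σ ≤ ∑ x, measure M ρ x ^ α * measure M σ x ^ (1 - α) := by
  have hα0 : 0 < α := by linarith
  have hα2 : 0 < 1 - α := by linarith
  have hp := hM.measure_nonneg hρ
  have hq := hM.measure_nonneg hσ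
  refine le_of_pow_le_mul_pow (κ := (Fintype.card κ : ℕ))
    (Finset.sum_nonneg fun x _ => mul_nonneg (Real.rpow_nonneg (hp x) _)
      (Real.rpow_nonneg (hq x) _)) fun n => ?_
  have hV := hM.naimark_isometry
  set V := naimark M with hVdef
  have hVρ := hρ.mul_mul_conjTranspose_same V
  have hVσ := hσ.mul_mul_conjTranspose_same V
  let L : (Fin n → a × κ) → (κ → Fin (n + 1)) := fun i => seqType fun k => (i k).2
  have key : ∀ {A : Matrix a a ℂ}, A.PosSemidef → ∀ t,
      rtr (labelProj L t * tensorPow (V * A * Vᴴ) n * labelProj L t) =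
        ∑ y : Fin n → κ, if seqType y = t then ∏ k, measure M A (y k) else 0 := by
    intro A hA t
    have h1 : (labelProj L t * tensorPow (V * A * Vᴴ) n * labelProj L t).trace =
        ∑ i : Fin n → a × κ, if L i = t then ∏ k, (V * A * Vᴴ) (i k) (i k) else 0 := by
      simp only [trace, diag, mul_labelProj_apply, labelProj_mul_apply, tensorPow]
      refine Finset.sum_congr rfl fun i _ => ?_
      split_ifs <;> rfl
    have h2 : (∑ i : Fin n → a × κ, if L i = t then ∏ k, (V * A * Vᴴ) (i k) (i k) else 0) =
        ∑ y : Fin n → κ, if seqType y = t then ∏ k, (A * M (y k)).trace else 0 := by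
      rw [← (Equiv.arrowProdEquivProdArrow (Fin n) (fun _ => a) (fun _ => κ)).symm.sum_comp,
        Fintype.sum_prod_type, Finset.sum_comm]
      refine Finset.sum_congr rfl fun y _ => ?_
      simp only [← hM.sum_diag_naimark, Finset.prod_univ_sum, Fintype.piFinset_univ]
      by_cases hy : seqType y = t
      · rw [if_pos hy]
        refine Finset.sum_congr rfl fun i _ => ?_
        exact if_pos hy
      · rw [if_neg hy]
        exact Finset.sum_eq_zero fun i _ => if_neg hy
    rw [rtr, h1, h2, Complex.re_sum]
    refine Finset.sum_congr rfl fun y _ => ?_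
    split_ifs
    · rw [Finset.prod_congr rfl fun k _ => (ofReal_rtr_mul hA (hM.posSemidef (y k))).symm,
        ← Complex.ofReal_prod, Complex.ofReal_re]
      rfl
    · simp
  have h := minimalQ_le_sum_blocks L (tensorPow_posSemidef hVρ n) (tensorPow_posSemidef hVσ n)
    hα hα1
  rw [minimalQ_tensorPow hVρ hVσ hα0 hα1.ne, minimalQ_conj_isometry hV hρ hσ hα0 hα1.ne,
    card_seqType] at h
  rw [Real.rpow_natCast]
  refine h.trans (mul_le_mul_of_nonneg_left (le_of_eq ?_) (by positivity))
  rw [pow_sum_rpow_mul_rpow hp hq,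
    ← Finset.sum_fiberwise Finset.univ (fun y : Fin n → κ => seqType y)]
  refine Finset.sum_congr rfl fun t _ => ?_
  rw [key hρ, key hσ, ← Finset.sum_filter, ← Finset.sum_filter]
  rcases (Finset.univ.filter fun y : Fin n → κ => seqType y = t).eq_empty_or_nonempty with h0 | h0
  · rw [h0]; simp [Real.zero_rpow hα0.ne']
  · obtain ⟨z, hz⟩ := h0
    have hz := (Finset.mem_filter.1 hz).2
    have e : ∀ f : κ → ℝ, ∀ y ∈ Finset.univ.filter fun y : Fin n → κ => seqType y = t,
        ∏ k, f (y k) = ∏ k, f (z k) := fun f y hy =>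
      prod_eq_of_seqType_eq ((Finset.mem_filter.1 hy).2.trans hz.symm) f
    have e' : ∀ y ∈ Finset.univ.filter fun y : Fin n → κ => seqType y = t,
        (∏ k, measure M ρ (y k)) ^ α * (∏ k, measure M σ (y k)) ^ (1 - α) =
        (∏ k, measure M ρ (z k)) ^ α * (∏ k, measure M σ (z k)) ^ (1 - α) := fun y hy => by
      rw [e _ y hy, e _ y hy]
    rw [Finset.sum_congr rfl (e _), Finset.sum_congr rfl (e _), Finset.sum_congr rfl e']
    have h1 : 0 ≤ ∏ k, measure M ρ (z k) := Finset.prod_nonneg fun k _ => hp _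
    have h2 : 0 ≤ ∏ k, measure M σ (z k) := Finset.prod_nonneg fun k _ => hq _
    simp only [Finset.sum_const, nsmul_eq_mul]
    generalize (Finset.univ.filter fun y : Fin n → κ => seqType y = t).card = N
    have hN0 : (0 : ℝ) ≤ N := by positivity
    rw [Real.mul_rpow hN0 h1, Real.mul_rpow hN0 h2, mul_mul_mul_comm,
      ← Real.rpow_add' hN0 (by norm_num)]
    norm_num

end Measured

/-! ### Kraus maps and data processing for `minimalQ` -/

section Kraus

variable {a b κ : Type*} [Fintype a] [DecidableEq a] [Fintype b] [DecidableEq b] [Fintype κ]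
  [DecidableEq κ]

/-- The completely positive map with Kraus operators `K`. -/
def kraus (K : κ → Matrix b a ℂ) (X : Matrix a a ℂ) : Matrix b b ℂ := ∑ x, K x * X * (K x)ᴴ

lemma kraus_posSemidef (K : κ → Matrix b a ℂ) {X : Matrix a a ℂ} (hX : X.PosSemidef) :
    (kraus K X).PosSemidef := posSemidef_sum _ fun _ _ => hX.mul_mul_conjTranspose_same _

/-- The measurement on the input obtained by measuring the output of a Kraus map. -/
def krausPull {x : Type*} (K : κ → Matrix b a ℂ) (N : x → Matrix b b ℂ) (i : x) : Matrix a a ℂ :=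
  ∑ y, (K y)ᴴ * N i * K y

lemma IsPOVM.krausPull {x : Type*} [Fintype x] {K : κ → Matrix b a ℂ} (hK : ∑ y, (K y)ᴴ * K y = 1)
    {N : x → Matrix b b ℂ} (hN : IsPOVM N) : IsPOVM (krausPull K N) where
  posSemidef i := posSemidef_sum _ fun _ _ => (hN.posSemidef i).conjTranspose_mul_mul_same _
  sum_eq_one := by
    simp only [QuantumRenyi.krausPull]
    rw [Finset.sum_comm]
    simp only [← Matrix.mul_sum, ← Matrix.sum_mul, hN.sum_eq_one, Matrix.mul_one, hK]

lemma measure_krausPull {x : Type*} [Fintype x] (K : κ → Matrix b a ℂ) (N : x → Matrix b b ℂ)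
    (X : Matrix a a ℂ) : measure (krausPull K N) X = measure N (kraus K X) := by
  ext i
  simp only [measure, krausPull, kraus, Matrix.mul_sum, Matrix.sum_mul, rtr_sum]
  refine Finset.sum_congr rfl fun y _ => ?_
  rw [Matrix.mul_assoc (K y * X), Matrix.mul_assoc (K y), rtr_mul_comm (K y)]
  simp only [Matrix.mul_assoc]

lemma tensorPow_kraus (K : κ → Matrix b a ℂ) (X : Matrix a a ℂ) (n : ℕ) :
    tensorPow (kraus K X) n =
      kraus (fun y : Fin n → κ => tprod fun k => K (y k)) (tensorPow X n) := by
  simp only [kraus, tensorPow_eq_tprod, tprod_sum, tprod_conjTranspose, tprod_mul]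

lemma sum_tprod_kraus {K : κ → Matrix b a ℂ} (hK : ∑ y, (K y)ᴴ * K y = 1) (n : ℕ) :
    ∑ y : Fin n → κ, (tprod fun k => K (y k))ᴴ * (tprod fun k => K (y k)) = 1 := by
  simp only [tprod_conjTranspose, tprod_mul]
  rw [← tprod_sum (n := n) fun _ x => (K x)ᴴ * K x, hK, tprod_one]

/-- The projective measurement in the basis formed by the columns of `W`. -/
def basisPOVM (W : Matrix a a ℂ) (i : a) : Matrix a a ℂ :=
  W * rdiag (fun j => if j = i then 1 else 0) * Wᴴ

lemma isPOVM_basisPOVM {W : Matrix a a ℂ} (hW : W * Wᴴ = 1) : IsPOVM (basisPOVM W) where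
  posSemidef i := (rdiag_posSemidef fun j => by split_ifs <;> norm_num).mul_mul_conjTranspose_same W
  sum_eq_one := by
    have h := sum_labelProj (fun i : a => i)
    simp only [basisPOVM, ← Matrix.mul_sum, ← Matrix.sum_mul]
    rw [← hW]
    congr 1
    simp only [labelProj] at h
    rw [h, Matrix.mul_one]

lemma measure_basisPOVM (W A : Matrix a a ℂ) (i : a) :
    measure (basisPOVM W) A i = ((Wᴴ * A * W) i i).re := by
  rw [measure, rtr_mul_comm, basisPOVM, rtr_conj_rdiag_mul]
  simp

lemma IsPinchingBasis.measure_left {ρ σ : Matrix a a ℂ} {n : ℕ}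
    {W : Matrix (Fin n → a) (Fin n → a) ℂ} {r m : (Fin n → a) → ℝ}
    (h : IsPinchingBasis ρ σ n W r m) : measure (basisPOVM W) (tensorPow ρ n) = r := by
  ext i
  rw [measure_basisPOVM, h.left_diag, Complex.ofReal_re]

lemma IsPinchingBasis.measure_right {ρ σ : Matrix a a ℂ} {n : ℕ}
    {W : Matrix (Fin n → a) (Fin n → a) ℂ} {r m : (Fin n → a) → ℝ}
    (h : IsPinchingBasis ρ σ n W r m) : measure (basisPOVM W) (tensorPow σ n) = m := by
  ext i
  rw [measure_basisPOVM, h.right_eq, show Wᴴ * (W * rdiag m * Wᴴ) * W =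
    (Wᴴ * W) * rdiag m * (Wᴴ * W) by simp only [Matrix.mul_assoc], h.conjTranspose_mul_self]
  simp [rdiag]

/-- Data processing for `α > 1`: the basis measurement that achieves `minimalQ` of the outputs on
`n` copies pulls back to a measurement of the inputs. -/
lemma minimalQ_kraus_le {K : κ → Matrix b a ℂ} (hK : ∑ y, (K y)ᴴ * K y = 1) {ρ σ : Matrix a a ℂ}
    (hρ : ρ.PosSemidef) (hσ : σ.PosSemidef) (hd : Dominated ρ σ) {α : ℝ} (hα : 1 < α) :
    minimalQ α (kraus K ρ) (kraus K σ) ≤ minimalQ α ρ σ := by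
  have hα0 : 0 < α := by linarith
  have hρ' := kraus_posSemidef K hρ
  have hσ' := kraus_posSemidef K hσ
  refine le_of_pow_le_mul_pow (κ := Fintype.card b * α) (minimalQ_nonneg hρ hσ hα0 hα.ne')
    fun n => ?_
  obtain ⟨W, r, m, h⟩ := exists_isPinchingBasis hρ' hσ' n
  refine (h.pow_le hρ' hσ' hα0 hα.ne').trans ?_
  rw [Real.rpow_mul (by positivity), Real.rpow_natCast]
  refine mul_le_mul_of_nonneg_left ?_ (by positivity)
  have hN := (isPOVM_basisPOVM h.mul_conjTranspose_self).krausPull (sum_tprod_kraus hK n)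
  have := sum_measure_le_minimalQ hN (tensorPow_posSemidef hρ n) (tensorPow_posSemidef hσ n)
    (hd.tensorPow hσ n) hα
  rwa [measure_krausPull, measure_krausPull, ← tensorPow_kraus, ← tensorPow_kraus, h.measure_left,
    h.measure_right, minimalQ_tensorPow hρ hσ hα0 hα.ne'] at this

/-- Data processing for `1 / 2 ≤ α < 1`, by the same measurement. -/
lemma le_minimalQ_kraus {K : κ → Matrix b a ℂ} (hK : ∑ y, (K y)ᴴ * K y = 1) {ρ σ : Matrix a a ℂ}
    (hρ : ρ.PosSemidef) (hσ : σ.PosSemidef) {α : ℝ} (hα : 1 / 2 ≤ α) (hα1 : α < 1) :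
    minimalQ α ρ σ ≤ minimalQ α (kraus K ρ) (kraus K σ) := by
  have hα0 : 0 < α := by linarith
  have hρ' := kraus_posSemidef K hρ
  have hσ' := kraus_posSemidef K hσ
  refine le_of_pow_le_mul_pow (κ := Fintype.card b * (1 - α))
    (minimalQ_nonneg hρ' hσ' hα0 hα1.ne) fun n => ?_
  obtain ⟨W, r, m, h⟩ := exists_isPinchingBasis hρ' hσ' n
  rw [Real.rpow_mul (by positivity), Real.rpow_natCast]
  refine le_trans ?_ (h.sum_le_of_lt_one α hα0 hα1)
  have hN := (isPOVM_basisPOVM h.mul_conjTranspose_self).krausPull (sum_tprod_kraus hK n)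
  have := minimalQ_le_sum_measure hN (tensorPow_posSemidef hρ n) (tensorPow_posSemidef hσ n) hα hα1
  rwa [measure_krausPull, measure_krausPull, ← tensorPow_kraus, ← tensorPow_kraus, h.measure_left,
    h.measure_right, minimalQ_tensorPow hρ hσ hα0 hα1.ne] at this

lemma Dominated.kraus {K : κ → Matrix b a ℂ} {ρ σ : Matrix a a ℂ} (hσ : σ.PosSemidef)
    (hd : Dominated ρ σ) : Dominated (kraus K ρ) (kraus K σ) := by
  intro v hv
  have h1 : ∀ y ∈ Finset.univ, (K y * σ * (K y)ᴴ) *ᵥ v = 0 := fun y hy => by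
    have hpos : ∀ y, (K y * σ * (K y)ᴴ).PosSemidef := fun y => hσ.mul_mul_conjTranspose_same _
    have h0 : ∑ y, star v ⬝ᵥ (K y * σ * (K y)ᴴ) *ᵥ v = 0 := by
      have := congrArg (fun w => star v ⬝ᵥ w) hv
      simpa [QuantumRenyi.kraus, Matrix.sum_mulVec, dotProduct_sum] using this
    exact ((hpos y).dotProduct_mulVec_zero_iff v).1
      ((Finset.sum_eq_zero_iff_of_nonneg fun y _ => (hpos y).dotProduct_mulVec_nonneg v).1 h0 y hy)
  have h2 : ∀ y, σ *ᵥ ((K y)ᴴ *ᵥ v) = 0 := fun y => by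
    refine (hσ.dotProduct_mulVec_zero_iff _).1 ?_
    have := congrArg (fun w => star v ⬝ᵥ w) (h1 y (Finset.mem_univ y))
    simp only [dotProduct_zero] at this
    rw [star_mulVec, conjTranspose_conjTranspose, ← dotProduct_mulVec, mulVec_mulVec,
      mulVec_mulVec]
    exact this
  rw [QuantumRenyi.kraus, Matrix.sum_mulVec]
  refine Finset.sum_eq_zero fun y _ => ?_
  rw [← mulVec_mulVec, ← mulVec_mulVec, hd _ (h2 y), mulVec_zero]

lemma rtr_kraus {K : κ → Matrix b a ℂ} (hK : ∑ y, (K y)ᴴ * K y = 1) (X : Matrix a a ℂ) :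
    rtr (kraus K X) = rtr X := by
  rw [kraus, rtr_sum, Finset.sum_congr rfl fun y _ => by
    rw [Matrix.mul_assoc, rtr_mul_comm, Matrix.mul_assoc], ← rtr_sum, ← Matrix.mul_sum, hK,
    Matrix.mul_one]

/-- Choi's theorem: a channel has a Kraus representation. -/
lemma IsCPTP.exists_kraus {E : Matrix a a ℂ →ₗ[ℂ] Matrix b b ℂ} (hE : IsCPTP E) :
    ∃ K : b × Fin (Fintype.card a) → Matrix b a ℂ, ∑ y, (K y)ᴴ * K y = 1 ∧
      ∀ X, E X = kraus K X := by
  set e := Fintype.equivFin a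
  let v : a × Fin (Fintype.card a) → ℂ := fun i => if e i.1 = i.2 then 1 else 0
  set C := tensorId E (vecMulVec v (star v)) with hCdef
  have hC : C.PosSemidef := hE.completely_positive _ _ (posSemidef_vecMulVec_self_star v)
  set B := power C (1 / 2) with hB
  have hBB : Bᴴ * B = C := by
    rw [hB, power_isHermitian hC (by norm_num), power_mul_power hC (by norm_num) (by norm_num)
      (by norm_num), add_halves, power_one hC]
  have hCE : ∀ i j x y, C (i, e x) (j, e y) = E (single x y 1) i j := fun i j x y => by
    rw [hCdef, tensorId]
    refine congrArg (fun M => E M i j) ?_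
    ext k l
    by_cases h1 : k = x <;> by_cases h2 : l = y <;>
      simp [vecMulVec_apply, v, eq_comm (a := x) (b := k),
        eq_comm (a := y) (b := l), h1, h2]
  let K : b × Fin (Fintype.card a) → Matrix b a ℂ := fun k => of fun i x => star (B k (i, e x))
  have hK : ∀ X, E X = kraus K X := fun X => by
    conv_lhs => rw [matrix_eq_sum_single X]
    ext i j
    simp only [map_sum, Matrix.sum_apply, kraus]
    have h1 : ∀ x y, E (single x y (X x y)) i j = ∑ k, K k i x * X x y * star (K k j y) := by
      intro x y
      rw [show single x y (X x y) = X x y • single x y (1 : ℂ) by simp, map_smul, Matrix.smul_apply,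
        ← hCE, ← hBB, Matrix.mul_apply, smul_eq_mul, Finset.mul_sum]
      refine Finset.sum_congr rfl fun k _ => ?_
      simp only [K, of_apply, conjTranspose_apply, star_star]
      ring
    simp only [h1]
    rw [Finset.sum_congr rfl fun x _ => Finset.sum_comm, Finset.sum_comm]
    refine Finset.sum_congr rfl fun k _ => ?_
    simp only [Matrix.mul_apply, conjTranspose_apply, Finset.sum_mul]
    rw [Finset.sum_comm]
  refine ⟨K, ?_, hK⟩
  ext x y
  have h := hE.trace_preserving (single y x 1)
  rw [hK, kraus, trace_sum, Finset.sum_congr rfl fun k _ => by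
    rw [Matrix.mul_assoc, trace_mul_comm, Matrix.mul_assoc], ← trace_sum, ← Matrix.mul_sum,
    trace_single_mul, one_smul] at h
  rw [h, one_apply]
  split_ifs with hxy
  · rw [hxy, trace_single_eq_same]
  · rw [trace_single_eq_of_ne _ _ _ (Ne.symm hxy)]

end Kraus

/-! ### Joint concavity and convexity of `minimalQ` -/

section Joint

variable {a T : Type*} [Fintype a] [DecidableEq a] [Fintype T] [DecidableEq T]

/-- The embedding of the `t`-th summand into a direct sum of copies of `ℂ^a`. -/
def summandInj (a : Type*) [DecidableEq a] (t : T) : Matrix (a × T) a ℂ :=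
  of fun i j => if i.2 = t ∧ i.1 = j then 1 else 0

lemma summandInj_conjTranspose_mul (s t : T) :
    (summandInj a s : Matrix (a × T) a ℂ)ᴴ * summandInj a t = if s = t then 1 else 0 := by
  ext i j
  rw [Matrix.mul_apply, Fintype.sum_prod_type]
  simp only [conjTranspose_apply, summandInj, of_apply]
  by_cases hst : s = t
  · subst hst
    by_cases hij : i = j
    · subst hij; simp [ite_and]
    · rw [if_pos rfl, one_apply_ne hij]
      refine Finset.sum_eq_zero fun x _ => Finset.sum_eq_zero fun u _ => ?_
      split_ifs <;> simp_all
  · rw [if_neg hst, Matrix.zero_apply]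
    refine Finset.sum_eq_zero fun x _ => Finset.sum_eq_zero fun u _ => ?_
    split_ifs <;> simp_all

lemma summandInj_mul_conjTranspose (t : T) :
    summandInj a t * (summandInj a t : Matrix (a × T) a ℂ)ᴴ =
      labelProj (fun i : a × T => i.2) t := by
  ext i j
  rw [Matrix.mul_apply]
  simp only [conjTranspose_apply, summandInj, of_apply, labelProj, rdiag, diagonal_apply]
  by_cases hij : i = j
  · subst hij
    by_cases hi : i.2 = t <;> simp [hi]
  · rw [if_neg hij]
    refine Finset.sum_eq_zero fun x _ => ?_
    split_ifs with h1 h2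
    · exact absurd (Prod.ext (h1.2.trans h2.2.symm) (h1.1.trans h2.1.symm)) hij
    all_goals simp

/-- The direct sum of the operators `ρ t`. -/
def directSum (ρ : T → Matrix a a ℂ) : Matrix (a × T) (a × T) ℂ :=
  ∑ t, summandInj a t * ρ t * (summandInj a t)ᴴ

lemma directSum_posSemidef {ρ : T → Matrix a a ℂ} (hρ : ∀ t, (ρ t).PosSemidef) :
    (directSum ρ).PosSemidef := posSemidef_sum _ fun t _ => (hρ t).mul_mul_conjTranspose_same _

lemma summandInj_conjTranspose_mul_directSum (ρ : T → Matrix a a ℂ) (t : T) :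
    (summandInj a t)ᴴ * directSum ρ = ρ t * (summandInj a t)ᴴ := by
  rw [directSum, Matrix.mul_sum, Finset.sum_eq_single t]
  · rw [← Matrix.mul_assoc, ← Matrix.mul_assoc, summandInj_conjTranspose_mul, if_pos rfl,
      Matrix.one_mul]
  · intro s _ hs
    rw [← Matrix.mul_assoc, ← Matrix.mul_assoc, summandInj_conjTranspose_mul, if_neg hs.symm]
    simp
  · simp

lemma labelProj_mul_directSum (ρ : T → Matrix a a ℂ) (t : T) :
    labelProj (fun i : a × T => i.2) t * directSum ρ =
      summandInj a t * ρ t * (summandInj a t)ᴴ := by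
  rw [← summandInj_mul_conjTranspose, Matrix.mul_assoc, summandInj_conjTranspose_mul_directSum,
    Matrix.mul_assoc]

lemma labelProj_directSum (ρ : T → Matrix a a ℂ) (t : T) :
    labelProj (fun i : a × T => i.2) t * directSum ρ * labelProj (fun i : a × T => i.2) t =
      summandInj a t * ρ t * (summandInj a t)ᴴ := by
  rw [labelProj_mul_directSum, ← summandInj_mul_conjTranspose, Matrix.mul_assoc,
    ← Matrix.mul_assoc (summandInj a t)ᴴ, summandInj_conjTranspose_mul, if_pos rfl, Matrix.one_mul]

lemma isPinched_directSum {ρ : T → Matrix a a ℂ} (hρ : ∀ t, (ρ t).PosSemidef) :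
    IsPinched (fun i : a × T => i.2) (directSum ρ) := by
  refine isPinched_of_commute fun t => ?_
  have h1 := labelProj_mul_directSum ρ t
  have h2 := congrArg conjTranspose h1
  rw [conjTranspose_mul, labelProj_isHermitian, (directSum_posSemidef hρ).1,
    ((hρ t).mul_mul_conjTranspose_same (summandInj a t)).1] at h2
  exact h2.trans h1.symm

lemma minimalQ_directSum {ρ σ : T → Matrix a a ℂ} (hρ : ∀ t, (ρ t).PosSemidef)
    (hσ : ∀ t, (σ t).PosSemidef) {α : ℝ} (hα : 0 < α) (hα1 : α ≠ 1) :
    minimalQ α (directSum ρ) (directSum σ) = ∑ t, minimalQ α (ρ t) (σ t) := by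
  rw [minimalQ_eq_sum_blocks (directSum_posSemidef hρ) (directSum_posSemidef hσ)
    (isPinched_directSum hρ) (isPinched_directSum hσ) hα hα1]
  refine Finset.sum_congr rfl fun t _ => ?_
  rw [labelProj_directSum, labelProj_directSum]
  exact minimalQ_conj_isometry (by rw [summandInj_conjTranspose_mul, if_pos rfl])
    (hρ t) (hσ t) hα hα1

/-- The partial trace over the summation index, as a Kraus map. -/
lemma kraus_directSum (ρ : T → Matrix a a ℂ) :
    kraus (fun t : T => (summandInj a t : Matrix (a × T) a ℂ)ᴴ) (directSum ρ) = ∑ t, ρ t := by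
  rw [kraus]
  refine Finset.sum_congr rfl fun t _ => ?_
  rw [summandInj_conjTranspose_mul_directSum, conjTranspose_conjTranspose, Matrix.mul_assoc,
    summandInj_conjTranspose_mul, if_pos rfl, Matrix.mul_one]

lemma sum_summandInj_mul_conjTranspose : ∑ t : T,
    ((summandInj a t : Matrix (a × T) a ℂ)ᴴ)ᴴ * (summandInj a t : Matrix (a × T) a ℂ)ᴴ = 1 := by
  simp only [conjTranspose_conjTranspose, summandInj_mul_conjTranspose, sum_labelProj]

lemma dominated_directSum {ρ σ : T → Matrix a a ℂ} (hσ : ∀ t, (σ t).PosSemidef)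
    (hd : ∀ t, Dominated (ρ t) (σ t)) : Dominated (directSum ρ) (directSum σ) := by
  choose D hD using fun t => (hd t).exists_eq_mul (hσ t)
  have : directSum ρ = directSum D * directSum σ := by
    rw [directSum, directSum, Matrix.sum_mul]
    refine Finset.sum_congr rfl fun t _ => ?_
    rw [Matrix.mul_assoc (summandInj a t * D t), summandInj_conjTranspose_mul_directSum, hD t]
    simp only [Matrix.mul_assoc]
  rw [this]; exact dominated_mul _ _

/-- Data processing under the partial trace of a direct sum gives joint subadditivity of `minimalQ`
for `α > 1`. With homogeneity, this is joint convexity. -/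
lemma minimalQ_sum_le {ρ σ : T → Matrix a a ℂ} (hρ : ∀ t, (ρ t).PosSemidef)
    (hσ : ∀ t, (σ t).PosSemidef) (hd : ∀ t, Dominated (ρ t) (σ t)) {α : ℝ} (hα : 1 < α) :
    minimalQ α (∑ t, ρ t) (∑ t, σ t) ≤ ∑ t, minimalQ α (ρ t) (σ t) := by
  have := minimalQ_kraus_le sum_summandInj_mul_conjTranspose (directSum_posSemidef hρ)
    (directSum_posSemidef hσ) (dominated_directSum hσ hd) hα
  rwa [kraus_directSum, kraus_directSum, minimalQ_directSum hρ hσ (by linarith) hα.ne'] at this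

lemma sum_minimalQ_le {ρ σ : T → Matrix a a ℂ} (hρ : ∀ t, (ρ t).PosSemidef)
    (hσ : ∀ t, (σ t).PosSemidef) {α : ℝ} (hα : 1 / 2 ≤ α) (hα1 : α < 1) :
    ∑ t, minimalQ α (ρ t) (σ t) ≤ minimalQ α (∑ t, ρ t) (∑ t, σ t) := by
  have := le_minimalQ_kraus sum_summandInj_mul_conjTranspose (directSum_posSemidef hρ)
    (directSum_posSemidef hσ) hα hα1
  rwa [kraus_directSum, kraus_directSum, minimalQ_directSum hρ hσ (by linarith) hα1.ne] at this

lemma minimalQ_smul_smul {ρ σ : Matrix a a ℂ} (hρ : ρ.PosSemidef) (hσ : σ.PosSemidef) {α : ℝ}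
    (hα : 0 < α) (hα1 : α ≠ 1) {x : ℝ} (hx : 0 ≤ x) :
    minimalQ α (x • ρ) (x • σ) = x * minimalQ α ρ σ := by
  rw [minimalQ_smul_left hρ (hσ.smul hx) hα hα1 hx, minimalQ_smul_right hρ hσ hα hα1 hx,
    ← mul_assoc, ← Real.rpow_add' hx (by norm_num)]
  norm_num

lemma Dominated.smul {ρ σ : Matrix a a ℂ} (h : Dominated ρ σ) (x : ℝ) :
    Dominated (x • ρ) (x • σ) := fun v hv => by
  rw [smul_mulVec] at hv ⊢
  rcases smul_eq_zero.1 hv with h0 | h0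
  · rw [h0, zero_smul]
  · rw [h v h0, smul_zero]

lemma Dominated.add {ρ₀ ρ₁ σ₀ σ₁ : Matrix a a ℂ} (hσ₀ : σ₀.PosSemidef) (hσ₁ : σ₁.PosSemidef)
    (h₀ : Dominated ρ₀ σ₀) (h₁ : Dominated ρ₁ σ₁) : Dominated (ρ₀ + ρ₁) (σ₀ + σ₁) := by
  have := (dominated_directSum (T := Fin 2) (ρ := ![ρ₀, ρ₁]) (σ := ![σ₀, σ₁])
    (by intro t; fin_cases t <;> assumption) (by intro t; fin_cases t <;> assumption)).kraus
    (K := fun t => (summandInj a t)ᴴ)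
    (directSum_posSemidef (by intro t; fin_cases t <;> assumption))
  rw [kraus_directSum, kraus_directSum] at this
  simpa [Fin.sum_univ_two] using this

lemma minimalQ_add_le {ρ₀ ρ₁ σ₀ σ₁ : Matrix a a ℂ} (hρ₀ : ρ₀.PosSemidef) (hρ₁ : ρ₁.PosSemidef)
    (hσ₀ : σ₀.PosSemidef) (hσ₁ : σ₁.PosSemidef) (hd₀ : Dominated ρ₀ σ₀) (hd₁ : Dominated ρ₁ σ₁)
    {α : ℝ} (hα : 1 < α) {s t : ℝ} (hs : 0 ≤ s) (ht : 0 ≤ t) :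
    minimalQ α (s • ρ₀ + t • ρ₁) (s • σ₀ + t • σ₁) ≤
      s * minimalQ α ρ₀ σ₀ + t * minimalQ α ρ₁ σ₁ := by
  have := minimalQ_sum_le (T := Fin 2) (ρ := ![s • ρ₀, t • ρ₁]) (σ := ![s • σ₀, t • σ₁])
    (by intro i; fin_cases i; exacts [hρ₀.smul hs, hρ₁.smul ht])
    (by intro i; fin_cases i; exacts [hσ₀.smul hs, hσ₁.smul ht])
    (by intro i; fin_cases i; exacts [hd₀.smul s, hd₁.smul t]) hα
  simp only [Fin.sum_univ_two, cons_val_zero, cons_val_one] at this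
  rwa [minimalQ_smul_smul hρ₀ hσ₀ (by linarith) hα.ne' hs,
    minimalQ_smul_smul hρ₁ hσ₁ (by linarith) hα.ne' ht] at this

lemma le_minimalQ_add {ρ₀ ρ₁ σ₀ σ₁ : Matrix a a ℂ} (hρ₀ : ρ₀.PosSemidef) (hρ₁ : ρ₁.PosSemidef)
    (hσ₀ : σ₀.PosSemidef) (hσ₁ : σ₁.PosSemidef) {α : ℝ} (hα : 1 / 2 ≤ α) (hα1 : α < 1)
    {s t : ℝ} (hs : 0 ≤ s) (ht : 0 ≤ t) :
    s * minimalQ α ρ₀ σ₀ + t * minimalQ α ρ₁ σ₁ ≤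
      minimalQ α (s • ρ₀ + t • ρ₁) (s • σ₀ + t • σ₁) := by
  have := sum_minimalQ_le (T := Fin 2) (ρ := ![s • ρ₀, t • ρ₁]) (σ := ![s • σ₀, t • σ₁])
    (by intro i; fin_cases i; exacts [hρ₀.smul hs, hρ₁.smul ht])
    (by intro i; fin_cases i; exacts [hσ₀.smul hs, hσ₁.smul ht]) hα hα1
  simp only [Fin.sum_univ_two, cons_val_zero, cons_val_one] at this
  rwa [minimalQ_smul_smul hρ₀ hσ₀ (by linarith) hα1.ne hs,
    minimalQ_smul_smul hρ₁ hσ₁ (by linarith) hα1.ne ht] at this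

end Joint

/-! ### The limit of order one -/

section LimitOne

variable {a : Type*} [Fintype a] [DecidableEq a]

lemma rpow_ge_add_mul_log {x : ℝ} (hx : 0 ≤ x) {β : ℝ} (hβ : β ≠ 0) :
    x + (β - 1) * (x * Real.log x) ≤ x ^ β := by
  rcases hx.eq_or_lt with rfl | hx
  · simp [Real.zero_rpow hβ]
  · have h := Real.add_one_le_exp ((β - 1) * Real.log x)
    have e : x ^ β = x * Real.exp ((β - 1) * Real.log x) := by
      rw [mul_comm (β - 1), ← Real.rpow_def_of_pos hx, Real.rpow_sub_one hx.ne']; field_simp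
    rw [e]
    nlinarith

lemma exp_le_quadratic (t : ℝ) : Real.exp t ≤ 1 + t + t ^ 2 * Real.exp |t| := by
  have h1 : Real.exp t - 1 ≤ t * Real.exp t := by
    have h := Real.add_one_le_exp (-t)
    have h2 : Real.exp (-t) * Real.exp t = 1 := by rw [← Real.exp_add]; simp
    nlinarith [Real.exp_pos t]
  have h0 := Real.add_one_le_exp t
  rcases le_total 0 t with ht | ht
  · rw [abs_of_nonneg ht]
    nlinarith
  · have h3 : 1 ≤ Real.exp |t| := Real.one_le_exp (abs_nonneg t)
    nlinarith [sq_nonneg t]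

/-- A second order bound for `β ↦ x ^ β` at `β = 1`, uniform in `x ∈ [0, C]`. -/
lemma rpow_le_quadratic {x C β : ℝ} (hx : 0 ≤ x) (hxC : x ≤ C) (hC : 1 ≤ C)
    (hβ : |β - 1| ≤ 1 / 2) :
    x ^ β ≤ x + (β - 1) * (x * Real.log x) + (β - 1) ^ 2 * (C ^ 4 + 16) := by
  have hβ0 : β ≠ 0 := by rintro rfl; norm_num at hβ
  rcases hx.eq_or_lt with rfl | hx
  · simp only [Real.zero_rpow hβ0, zero_mul, mul_zero, add_zero, zero_add]
    positivity
  have e : x ^ β = x * Real.exp ((β - 1) * Real.log x) := by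
    rw [mul_comm (β - 1), ← Real.rpow_def_of_pos hx, Real.rpow_sub_one hx.ne']; field_simp
  have h := mul_le_mul_of_nonneg_left (exp_le_quadratic ((β - 1) * Real.log x)) hx.le
  have h1 : Real.exp |(β - 1) * Real.log x| ≤ Real.exp (|Real.log x| / 2) := by
    rw [Real.exp_le_exp, abs_mul]
    nlinarith [abs_nonneg (Real.log x)]
  -- it remains to bound `x (log x)² exp (|log x| / 2)`, separately for `x ≥ 1` and `x ≤ 1`
  have h2 : x * Real.log x ^ 2 * Real.exp (|Real.log x| / 2) ≤ C ^ 4 + 16 := by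
    rcases le_total 1 x with h1x | h1x
    · have hl := Real.log_nonneg h1x
      have hl2 : Real.log x ≤ x := (Real.log_le_sub_one_of_pos hx).trans (by linarith)
      have he : Real.exp (|Real.log x| / 2) ≤ x := by
        rw [abs_of_nonneg hl]
        calc _ ≤ Real.exp (Real.log x) := Real.exp_le_exp.2 (by linarith)
          _ = x := Real.exp_log hx
      calc x * Real.log x ^ 2 * Real.exp (|Real.log x| / 2) ≤ x * x ^ 2 * x := by gcongr
        _ = x ^ 4 := by ring
        _ ≤ C ^ 4 := by gcongr
        _ ≤ _ := by linarith
    · have hl := Real.log_nonpos hx.le h1x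
      have h3 := (Real.abs_log_mul_self_rpow_lt x (1 / 4) hx h1x (by norm_num)).le
      norm_num at h3
      have h4 : x * Real.exp (|Real.log x| / 2) = (x ^ (1 / 4 : ℝ)) ^ 2 := by
        rw [abs_of_nonpos hl, ← Real.rpow_natCast, ← Real.rpow_mul hx.le, Real.rpow_def_of_pos hx]
        nth_rewrite 1 [← Real.exp_log hx]
        rw [← Real.exp_add]
        congr 1; norm_num; ring
      have h5 : (Real.log x * x ^ (1 / 4 : ℝ)) ^ 2 ≤ 4 ^ 2 := by
        rw [← sq_abs, abs_mul, abs_of_nonneg (Real.rpow_nonneg hx.le _)]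
        gcongr
        rwa [abs_of_nonneg (Real.rpow_nonneg hx.le _)] at h3
      calc _ = (Real.log x * x ^ (1 / 4 : ℝ)) ^ 2 := by
            rw [mul_right_comm, h4]; ring
        _ ≤ 16 := by linarith
        _ ≤ _ := by have := pow_nonneg (by linarith : (0 : ℝ) ≤ C) 4; linarith
  rw [e]
  calc _ ≤ _ := h
    _ = x + (β - 1) * (x * Real.log x) + (β - 1) ^ 2 *
        (x * Real.log x ^ 2 * Real.exp |(β - 1) * Real.log x|) := by ring
    _ ≤ x + (β - 1) * (x * Real.log x) + (β - 1) ^ 2 *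
        (x * Real.log x ^ 2 * Real.exp (|Real.log x| / 2)) := by gcongr
    _ ≤ _ := by gcongr

/-- The trace of `X log X`. -/
def trMulLog (X : Matrix a a ℂ) : ℝ := rtr (cfc (fun x : ℝ => x * Real.log x) X)

lemma rtr_power_ge {X : Matrix a a ℂ} (hX : X.PosSemidef) {β : ℝ} (hβ : β ≠ 0) :
    (β - 1) * trMulLog X ≤ rtr (power X β) - rtr X := by
  obtain ⟨U, d, hU, -, rfl, hd⟩ := exists_unitary_rdiag hX.1
  have hd := hd hX
  rw [trMulLog, cfc_conj_rdiag (by simp) hU, power_conj_rdiag hβ hU, rtr_conj_isometry hU,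
    rtr_conj_isometry hU, rtr_conj_isometry hU, rtr_rdiag, rtr_rdiag, rtr_rdiag, Finset.mul_sum,
    ← Finset.sum_sub_distrib]
  refine Finset.sum_le_sum fun i _ => ?_
  have := rpow_ge_add_mul_log (hd i) hβ
  linarith

lemma rtr_power_le {X : Matrix a a ℂ} (hX : X.PosSemidef) {β C : ℝ} (hC : 1 ≤ C)
    (hXC : rtr X ≤ C) (hβ : |β - 1| ≤ 1 / 2) :
    rtr (power X β) - rtr X ≤
      (β - 1) * trMulLog X + (β - 1) ^ 2 * (Fintype.card a * (C ^ 4 + 16)) := by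
  have hβ0 : β ≠ 0 := by rintro rfl; norm_num at hβ
  obtain ⟨U, d, hU, -, rfl, hd⟩ := exists_unitary_rdiag hX.1
  have hd := hd hX
  rw [rtr_conj_isometry hU, rtr_rdiag] at hXC
  rw [trMulLog, cfc_conj_rdiag (by simp) hU, power_conj_rdiag hβ0 hU, rtr_conj_isometry hU,
    rtr_conj_isometry hU, rtr_conj_isometry hU, rtr_rdiag, rtr_rdiag, rtr_rdiag, Finset.mul_sum,
    ← Finset.sum_sub_distrib, mul_left_comm, ← nsmul_eq_mul, ← Finset.card_univ,
    ← Finset.sum_const, ← Finset.sum_add_distrib]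
  refine Finset.sum_le_sum fun i _ => ?_
  have := rpow_le_quadratic (hd i)
    ((Finset.single_le_sum (fun j _ => hd j) (Finset.mem_univ i)).trans hXC) hC hβ
  linarith

lemma continuous_rtr : Continuous (rtr : Matrix a a ℂ → ℝ) :=
  Complex.continuous_re.comp (continuous_id.matrix_trace)

lemma spectrum_subset_Icc {X : Matrix a a ℂ} (hX : X.PosSemidef) {C : ℝ} (hXC : rtr X ≤ C) :
    spectrum ℝ X ⊆ Set.Icc 0 C := by
  rw [hX.1.spectrum_real_eq_range_eigenvalues]
  rintro _ ⟨i, rfl⟩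
  refine ⟨hX.eigenvalues_nonneg i, le_trans ?_ hXC⟩
  have : rtr X = ∑ i, hX.1.eigenvalues i := by
    rw [rtr, hX.1.trace_eq_sum_eigenvalues]; simp
  rw [this]
  exact Finset.single_le_sum (fun j _ => hX.eigenvalues_nonneg j) (Finset.mem_univ i)

section
open scoped Matrix.Norms.L2Operator

lemma tendsto_trMulLog {ι : Type*} {l : Filter ι} {X : ι → Matrix a a ℂ} {Y : Matrix a a ℂ}
    (hX : ∀ᶠ i in l, (X i).PosSemidef) (hY : Y.PosSemidef) (h : Tendsto X l (𝓝 Y)) :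
    Tendsto (fun i => trMulLog (X i)) l (𝓝 (trMulLog Y)) := by
  have h1 : Tendsto (fun i => rtr (X i)) l (𝓝 (rtr Y)) := (continuous_rtr.tendsto Y).comp h
  have h2 : ∀ᶠ i in l, rtr (X i) ≤ rtr Y + 1 := h1.eventually_le_const (by linarith)
  have h3 : Tendsto (fun i => cfc (fun x : ℝ => x * Real.log x) (X i)) l
      (𝓝 (cfc (fun x : ℝ => x * Real.log x) Y)) := by
    refine Filter.Tendsto.cfc (s := Set.Icc 0 (rtr Y + 1)) isCompact_Icc _ h ?_ ?_ ?_ hY.1 ?_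
    · filter_upwards [hX, h2] with i h h' using spectrum_subset_Icc h h'
    · filter_upwards [hX] with i h using h.1
    · exact spectrum_subset_Icc hY (by linarith)
    · exact Real.continuous_mul_log.continuousOn
  exact (continuous_rtr.tendsto _).comp h3

end

/-- The projection onto the support of a positive semidefinite matrix. -/
def suppProj (σ : Matrix a a ℂ) : Matrix a a ℂ := cfc (fun x : ℝ => if x = 0 then 0 else 1) σ

lemma tendsto_power_zero {σ : Matrix a a ℂ} (hσ : σ.PosSemidef) :
    Tendsto (fun c : ℝ => power σ c) (𝓝[≠] 0) (𝓝 (suppProj σ)) := by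
  obtain ⟨U, d, hU, -, rfl, hd⟩ := exists_unitary_rdiag hσ.1
  have hd := hd hσ
  rw [suppProj, cfc_conj_rdiag (by simp) hU]
  have h : Tendsto (fun c : ℝ => U * rdiag (fun i => d i ^ c) * Uᴴ) (𝓝[≠] 0)
      (𝓝 (U * rdiag (fun i => if d i = 0 then 0 else 1) * Uᴴ)) := by
    have hcont : Continuous fun e : a → ℝ => U * rdiag e * Uᴴ := by
      unfold rdiag
      fun_prop
    refine (hcont.tendsto _).comp (tendsto_pi_nhds.2 fun i => ?_)
    by_cases hi : d i = 0
    · rw [if_pos hi, hi]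
      refine tendsto_const_nhds.congr' ?_
      filter_upwards [self_mem_nhdsWithin] with c hc
      rw [Real.zero_rpow hc]
    · rw [if_neg hi, ← Real.rpow_zero (d i)]
      exact ((Real.continuousAt_const_rpow hi).tendsto).mono_left nhdsWithin_le_nhds
  refine h.congr' ?_
  filter_upwards [self_mem_nhdsWithin] with c hc
  rw [power_conj_rdiag hc hU]

lemma suppProj_isHermitian {σ : Matrix a a ℂ} (hσ : σ.PosSemidef) : (suppProj σ)ᴴ = suppProj σ := by
  obtain ⟨U, d, hU, -, rfl, hd⟩ := exists_unitary_rdiag hσ.1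
  rw [suppProj, cfc_conj_rdiag (by simp) hU]
  exact isHermitian_mul_mul_conjTranspose U (rdiag_isHermitian _)

lemma suppProj_mul_self {σ : Matrix a a ℂ} (hσ : σ.PosSemidef) :
    suppProj σ * suppProj σ = suppProj σ := by
  obtain ⟨U, d, hU, -, rfl, hd⟩ := exists_unitary_rdiag hσ.1
  rw [suppProj, cfc_conj_rdiag (by simp) hU, conj_rdiag_mul hU]
  congr 3; ext i; split_ifs <;> simp

lemma mul_suppProj {σ : Matrix a a ℂ} (hσ : σ.PosSemidef) : σ * suppProj σ = σ := by
  obtain ⟨U, d, hU, -, rfl, hd⟩ := exists_unitary_rdiag hσ.1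
  rw [suppProj, cfc_conj_rdiag (by simp) hU, conj_rdiag_mul hU]
  congr 3; ext i; split_ifs with h <;> simp [h]

lemma exists_suppProj_eq_mul {σ : Matrix a a ℂ} (hσ : σ.PosSemidef) :
    ∃ D, suppProj σ = D * σ := by
  obtain ⟨U, d, hU, -, rfl, hd⟩ := exists_unitary_rdiag hσ.1
  refine ⟨U * rdiag (fun i => (d i)⁻¹) * Uᴴ, ?_⟩
  rw [suppProj, cfc_conj_rdiag (by simp) hU, conj_rdiag_mul hU]
  congr 3; ext i; split_ifs with h <;> simp [h]

lemma Dominated.mul_suppProj {ρ σ : Matrix a a ℂ} (hσ : σ.PosSemidef) (h : Dominated ρ σ) :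
    ρ * suppProj σ = ρ := by
  obtain ⟨D, rfl⟩ := h.exists_eq_mul hσ
  rw [Matrix.mul_assoc, QuantumRenyi.mul_suppProj hσ]

lemma Dominated.suppProj_mul {ρ σ : Matrix a a ℂ} (hρ : ρ.PosSemidef) (hσ : σ.PosSemidef)
    (h : Dominated ρ σ) : suppProj σ * ρ = ρ := by
  have := congrArg conjTranspose (h.mul_suppProj hσ)
  rwa [conjTranspose_mul, suppProj_isHermitian hσ, hρ.1] at this

lemma dominated_of_mul_suppProj {ρ σ : Matrix a a ℂ} (hσ : σ.PosSemidef)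
    (h : ρ * suppProj σ = ρ) : Dominated ρ σ := by
  obtain ⟨D, hD⟩ := exists_suppProj_eq_mul hσ
  rw [← h, hD, ← Matrix.mul_assoc]
  exact dominated_mul _ _

/-- The operator inside the definition of `minimalQ`. -/
def sandwich (β : ℝ) (ρ σ : Matrix a a ℂ) : Matrix a a ℂ :=
  power σ ((1 - β) / (2 * β)) * ρ * power σ ((1 - β) / (2 * β))

lemma tendsto_exponent : Tendsto (fun β : ℝ => (1 - β) / (2 * β)) (𝓝[≠] 1) (𝓝[≠] 0) := by
  refine tendsto_nhdsWithin_iff.2 ⟨?_, ?_⟩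
  · have : ContinuousAt (fun β : ℝ => (1 - β) / (2 * β)) 1 :=
      ContinuousAt.div (by fun_prop) (by fun_prop) (by norm_num)
    have h := this.tendsto
    norm_num at h
    exact h.mono_left nhdsWithin_le_nhds
  · have h0 : ∀ᶠ β : ℝ in 𝓝[≠] 1, 0 < β :=
      (eventually_gt_nhds one_pos).filter_mono nhdsWithin_le_nhds
    filter_upwards [h0, self_mem_nhdsWithin] with β h h1 using exponent_ne_zero h h1

lemma tendsto_sandwich {ρ σ : Matrix a a ℂ} (hσ : σ.PosSemidef) :
    Tendsto (fun β => sandwich β ρ σ) (𝓝[≠] 1) (𝓝 (suppProj σ * ρ * suppProj σ)) := by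
  have h := (tendsto_power_zero hσ).comp tendsto_exponent
  exact (h.mul tendsto_const_nhds).mul h

lemma eventually_near_one : ∀ᶠ β : ℝ in 𝓝[≠] 1, β ≠ 1 ∧ |β - 1| ≤ 1 / 2 ∧ 0 < β := by
  have h : ∀ᶠ β : ℝ in 𝓝 1, |β - 1| < 1 / 2 := by
    have : Metric.ball (1 : ℝ) (1 / 2) ∈ 𝓝 (1 : ℝ) := Metric.ball_mem_nhds _ (by norm_num)
    filter_upwards [this] with β hβ
    rwa [Metric.mem_ball, Real.dist_eq] at hβ
  filter_upwards [h.filter_mono nhdsWithin_le_nhds, self_mem_nhdsWithin] with β h1 h2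
  refine ⟨h2, h1.le, ?_⟩
  have := (abs_lt.1 h1).1
  linarith

/-- To first order at `β = 1`, `minimalQ` differs from the trace of the sandwiched operator by
an entropy term. -/
lemma tendsto_minimalQ_sub {ρ σ : Matrix a a ℂ} (hρ : ρ.PosSemidef) (hσ : σ.PosSemidef) :
    Tendsto (fun β => (minimalQ β ρ σ - rtr (sandwich β ρ σ)) / (β - 1)) (𝓝[≠] 1)
      (𝓝 (trMulLog (suppProj σ * ρ * suppProj σ))) := by
  set Y := suppProj σ * ρ * suppProj σ with hY
  have hYp : Y.PosSemidef := by
    have := hρ.mul_mul_conjTranspose_same (suppProj σ)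
    rwa [suppProj_isHermitian hσ] at this
  have hX : ∀ᶠ β in 𝓝[≠] (1 : ℝ), (sandwich β ρ σ).PosSemidef := by
    filter_upwards [eventually_near_one] with β hβ
    exact sandwich_posSemidef hρ hσ (exponent_ne_zero hβ.2.2 hβ.1)
  have hlim := tendsto_sandwich (ρ := ρ) hσ
  have htr : Tendsto (fun β => rtr (sandwich β ρ σ)) (𝓝[≠] 1) (𝓝 (rtr Y)) :=
    (continuous_rtr.tendsto Y).comp hlim
  set C := rtr Y + 1 with hC
  have hC1 : 1 ≤ C := by have := rtr_nonneg hYp; linarith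
  have hbd : ∀ᶠ β in 𝓝[≠] (1 : ℝ), rtr (sandwich β ρ σ) ≤ C :=
    htr.eventually_le_const (by linarith)
  have hlog := tendsto_trMulLog hX hYp hlim
  set K := Fintype.card a * (C ^ 4 + 16) with hK
  have hK0 : 0 ≤ K := by positivity
  have herr : Tendsto (fun β : ℝ => |β - 1| * K) (𝓝[≠] 1) (𝓝 0) := by
    have : ContinuousAt (fun β : ℝ => |β - 1| * K) 1 := by fun_prop
    have h := this.tendsto
    simp only [sub_self, abs_zero, zero_mul] at h
    exact h.mono_left nhdsWithin_le_nhds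
  have hdiff : Tendsto (fun β => (minimalQ β ρ σ - rtr (sandwich β ρ σ)) / (β - 1) -
      trMulLog (sandwich β ρ σ)) (𝓝[≠] 1) (𝓝 0) := by
    refine squeeze_zero_norm' ?_ herr
    filter_upwards [eventually_near_one, hX, hbd] with β hβ hXβ hb
    have h1 := rtr_power_ge hXβ hβ.2.2.ne'
    have h2 := rtr_power_le hXβ hC1 hb hβ.2.1
    have hne : β - 1 ≠ 0 := sub_ne_zero.2 hβ.1
    have e : (minimalQ β ρ σ - rtr (sandwich β ρ σ)) / (β - 1) - trMulLog (sandwich β ρ σ) =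
        (rtr (power (sandwich β ρ σ) β) - rtr (sandwich β ρ σ) -
          (β - 1) * trMulLog (sandwich β ρ σ)) / (β - 1) := by
      rw [minimalQ, ← sandwich]; field_simp
    rw [e, Real.norm_eq_abs, abs_div, div_le_iff₀ (abs_pos.2 hne), abs_of_nonneg (by linarith)]
    calc _ ≤ (β - 1) ^ 2 * K := by linarith
      _ = _ := by rw [← sq_abs]; ring
  have := hdiff.add hlog
  simpa using this

lemma tendsto_minimalQ_one {ρ σ : Matrix a a ℂ} (hρ : ρ.PosSemidef) (hσ : σ.PosSemidef) :
    Tendsto (fun β => minimalQ β ρ σ) (𝓝[≠] 1) (𝓝 (rtr (suppProj σ * ρ * suppProj σ))) := by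
  have h1 := tendsto_minimalQ_sub hρ hσ
  have h2 : Tendsto (fun β : ℝ => β - 1) (𝓝[≠] 1) (𝓝 0) := by
    have : ContinuousAt (fun β : ℝ => β - 1) 1 := by fun_prop
    have h := this.tendsto
    rw [sub_self] at h
    exact h.mono_left nhdsWithin_le_nhds
  have h3 := (h1.mul h2).add ((continuous_rtr.tendsto _).comp (tendsto_sandwich (ρ := ρ) hσ))
  rw [mul_zero, zero_add] at h3
  refine h3.congr' ?_
  filter_upwards [self_mem_nhdsWithin] with β hβ
  have hne : β - 1 ≠ 0 := sub_ne_zero.2 hβ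
  simp only [Function.comp_apply]
  field_simp
  ring

lemma tendsto_rtr_sandwich_sub {ρ σ : Matrix a a ℂ} (hσ : σ.PosSemidef)
    (hd : Dominated ρ σ) :
    ∃ D : ℝ, Tendsto (fun β => (rtr (sandwich β ρ σ) - rtr ρ) / (β - 1)) (𝓝[≠] 1) (𝓝 D) := by
  obtain ⟨E, hE⟩ := hd.exists_eq_mul hσ
  obtain ⟨U, d, hU, hU', hσU, hd'⟩ := exists_unitary_rdiag hσ.1
  have hd' := hd' hσ
  set w : a → ℝ := fun i => ((Uᴴ * ρ * U) i i).re with hw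
  have hw0 : ∀ i, d i = 0 → w i = 0 := fun i hi => by
    simp only [hw]
    rw [hE, hσU, show Uᴴ * (E * (U * rdiag d * Uᴴ)) * U = Uᴴ * E * U * rdiag d * (Uᴴ * U) by
      simp only [Matrix.mul_assoc], hU, Matrix.mul_one, rdiag, mul_diagonal, hi]
    simp
  have hf : ∀ β : ℝ, β ≠ 0 → β ≠ 1 →
      rtr (sandwich β ρ σ) = ∑ i, d i ^ ((1 - β) / β) * w i := fun β h0 h1 => by
    have hc : (1 - β) / (2 * β) ≠ 0 := div_ne_zero (sub_ne_zero.2 h1.symm) (by simpa using h0)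
    have e : (1 - β) / (2 * β) + (1 - β) / (2 * β) = (1 - β) / β := by field_simp; ring
    have hc2 : (1 - β) / β ≠ 0 := div_ne_zero (sub_ne_zero.2 h1.symm) h0
    rw [sandwich, rtr_mul_comm, ← Matrix.mul_assoc, power_mul_power hσ hc hc (by rw [e]; exact hc2),
      e, hσU, power_conj_rdiag hc2 hU, rtr_conj_rdiag_mul]
  have hρ1 : rtr ρ = ∑ i, d i ^ ((1 - (1 : ℝ)) / 1) * w i := by
    have := rtr_conj_rdiag_mul U ρ fun _ => 1
    rw [show rdiag (fun _ : a => (1 : ℝ)) = 1 by simp [rdiag], Matrix.mul_one, hU',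
      Matrix.one_mul] at this
    rw [this]; simp [hw]
  have hder : ∀ i, HasDerivAt (fun β : ℝ => d i ^ ((1 - β) / β) * w i)
      (Real.log (d i) * (-1) * w i) 1 := fun i => by
    rcases (hd' i).eq_or_lt with h | h
    · simp only [hw0 i h.symm, mul_zero]
      exact hasDerivAt_const _ _
    · have h1 : HasDerivAt (fun β : ℝ => (1 - β) / β) (-1) 1 := by
        have := ((hasDerivAt_id' (1 : ℝ)).const_sub 1).fun_div (hasDerivAt_id' (1 : ℝ))
          one_ne_zero
        simpa using this
      have h2 := (h1.const_rpow h).mul_const (w i)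
      simpa using h2
  have hsum := HasDerivAt.fun_sum (u := Finset.univ) fun i _ => hder i
  refine ⟨_, (hasDerivAt_iff_tendsto_slope.1 hsum).congr' ?_⟩
  filter_upwards [eventually_near_one] with β hβ
  rw [slope_def_field, hf β hβ.2.2.ne' hβ.1, hρ1]

/-- For `ρ ≪ σ`, the divergence of order `β` is a difference quotient at `β = 1` of the function
`β ↦ log (minimalQ β ρ σ / tr ρ)`, which is differentiable there. -/
lemma exists_tendsto_log_minimalQ {ρ σ : Matrix a a ℂ} (hρ : ρ.PosSemidef) (hσ : σ.PosSemidef)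
    (hρ0 : ρ ≠ 0) (hd : Dominated ρ σ) :
    ∃ D : ℝ, Tendsto (fun β => 1 / (β - 1) * Real.log (minimalQ β ρ σ / rtr ρ)) (𝓝[≠] 1)
      (𝓝 D) := by
  obtain ⟨D₁, h1⟩ := tendsto_rtr_sandwich_sub hσ hd
  have h2 := tendsto_minimalQ_sub hρ hσ
  have htr := rtr_pos hρ hρ0
  set F : ℝ → ℝ := Function.update (fun β => minimalQ β ρ σ) 1 (rtr ρ) with hF
  have hF1 : F 1 = rtr ρ := by simp [hF]
  have hder : HasDerivAt F (trMulLog (suppProj σ * ρ * suppProj σ) + D₁) 1 := by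
    rw [hasDerivAt_iff_tendsto_slope]
    refine (h2.add h1).congr' ?_
    filter_upwards [self_mem_nhdsWithin] with β hβ
    rw [slope_def_field, hF1, hF, Function.update_of_ne hβ]
    ring
  have hlog := (hder.div_const (rtr ρ)).log (by rw [hF1, div_self htr.ne']; exact one_ne_zero)
  refine ⟨_, (hasDerivAt_iff_tendsto_slope.1 hlog).congr' ?_⟩
  filter_upwards [self_mem_nhdsWithin] with β hβ
  rw [slope_def_field, hF1, div_self htr.ne', Real.log_one, sub_zero, hF, Function.update_of_ne hβ]
  ring

lemma not_dominated_of_orthogonal {ρ σ : Matrix a a ℂ} (hσ : σ.PosSemidef)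
    (hρ0 : ρ ≠ 0) (h : Orthogonal ρ σ) : ¬ Dominated ρ σ := fun hd => by
  obtain ⟨D, hD⟩ := exists_suppProj_eq_mul hσ
  have h1 := hd.mul_suppProj hσ
  have h2 := congrArg conjTranspose hD
  rw [suppProj_isHermitian hσ, conjTranspose_mul, hσ.1] at h2
  rw [h2, ← Matrix.mul_assoc, h.1, Matrix.zero_mul] at h1
  exact hρ0 h1.symm

lemma minimalDivReal_of_dominated {ρ σ : Matrix a a ℂ} (hd : Dominated ρ σ) (β : ℝ) :
    minimalDivReal β ρ σ = ((1 / (β - 1) * Real.log (minimalQ β ρ σ / rtr ρ) : ℝ) : EReal) := by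
  rw [minimalDivReal, if_pos (Or.inr hd)]

/-- If `ρ` is not dominated by `σ`, the support of `σ` does not carry all of `ρ`. -/
lemma rtr_suppProj_conj_lt {ρ σ : Matrix a a ℂ} (hρ : ρ.PosSemidef) (hσ : σ.PosSemidef)
    (hd : ¬ Dominated ρ σ) : rtr (suppProj σ * ρ * suppProj σ) < rtr ρ := by
  set P := suppProj σ with hP
  have hPh : Pᴴ = P := suppProj_isHermitian hσ
  have hPP : P * P = P := suppProj_mul_self hσ
  have hQ : (1 - P).PosSemidef := by
    have : 1 - P = (1 - P)ᴴ * (1 - P) := by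
      rw [conjTranspose_sub, conjTranspose_one, hPh]
      simp [Matrix.mul_sub, Matrix.sub_mul, hPP]
    rw [this]; exact posSemidef_conjTranspose_mul_self _
  have e : rtr ρ - rtr (P * ρ * P) = rtr (ρ * (1 - P)) := by
    rw [rtr_mul_comm (P * ρ), ← Matrix.mul_assoc, hPP, Matrix.mul_sub, Matrix.mul_one, rtr_sub,
      rtr_mul_comm P]
  rw [← sub_pos, e]
  refine (rtr_mul_nonneg hρ hQ).lt_of_ne fun h0 => hd (dominated_of_mul_suppProj hσ ?_)
  have := mul_eq_zero_of_rtr_eq_zero hρ hQ h0.symm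
  rw [Matrix.mul_sub, Matrix.mul_one, sub_eq_zero] at this
  exact this.symm

lemma rtr_suppProj_conj_pos {ρ σ : Matrix a a ℂ} (hρ : ρ.PosSemidef) (hσ : σ.PosSemidef)
    (ho : ¬ Orthogonal ρ σ) : 0 < rtr (suppProj σ * ρ * suppProj σ) := by
  set P := suppProj σ with hP
  have hPh : Pᴴ = P := suppProj_isHermitian hσ
  have hPP : P * P = P := suppProj_mul_self hσ
  have hPp : P.PosSemidef := by
    have : P = Pᴴ * P := by rw [hPh, hPP]
    rw [this]; exact posSemidef_conjTranspose_mul_self _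
  rw [rtr_mul_comm, ← Matrix.mul_assoc, hPP, rtr_mul_comm]
  refine (rtr_mul_nonneg hρ hPp).lt_of_ne fun h0 => ho ?_
  have h1 := mul_eq_zero_of_rtr_eq_zero hρ hPp h0.symm
  have h2 : P * σ = σ := by
    have := congrArg conjTranspose (mul_suppProj hσ)
    rwa [conjTranspose_mul, ← hP, hPh, hσ.1] at this
  have h3 : ρ * σ = 0 := by rw [← h2, ← Matrix.mul_assoc, h1, Matrix.zero_mul]
  refine ⟨h3, ?_⟩
  have := congrArg conjTranspose h3
  rwa [conjTranspose_mul, hρ.1, hσ.1, conjTranspose_zero] at this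

/-- If `ρ` is not dominated by `σ`, the divergence tends to `∞` at order one. -/
lemma tendsto_minimalDivReal_one_top {ρ σ : Matrix a a ℂ} (hρ : ρ.PosSemidef) (hσ : σ.PosSemidef)
    (hd : ¬ Dominated ρ σ) :
    Tendsto (fun β => minimalDivReal β ρ σ) (𝓝[≠] 1) (𝓝 ⊤) := by
  rw [← nhdsLT_sup_nhdsGT, tendsto_sup]
  constructor
  · by_cases ho : Orthogonal ρ σ
    · refine tendsto_const_nhds.congr' (Eventually.of_forall fun β => ?_)
      refine (if_neg ?_).symm
      rintro (h | h)
      · exact h.2 ho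
      · exact hd h
    have hlt := rtr_suppProj_conj_lt hρ hσ hd
    have hpos := rtr_suppProj_conj_pos hρ hσ ho
    have h1 := ((tendsto_minimalQ_one hρ hσ).mono_left
      (nhdsWithin_mono 1 fun x (hx : x < 1) => hx.ne)).div_const (rtr ρ)
    have hq : 0 < rtr (suppProj σ * ρ * suppProj σ) / rtr ρ := div_pos hpos (hpos.trans hlt)
    have h2 := h1.log hq.ne'
    have h3 : Tendsto (fun β : ℝ => 1 / (β - 1)) (𝓝[<] 1) atBot := by
      simp only [one_div]
      refine tendsto_inv_nhdsLT_zero.comp ?_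
      refine tendsto_nhdsWithin_iff.2 ⟨?_, ?_⟩
      · have : ContinuousAt (fun β : ℝ => β - 1) 1 := by fun_prop
        have h := this.tendsto
        rw [sub_self] at h
        exact h.mono_left nhdsWithin_le_nhds
      · filter_upwards [self_mem_nhdsWithin] with β (hβ : β < 1)
        exact sub_neg.2 hβ
    have h4 := h3.atBot_mul_neg (Real.log_neg hq ((div_lt_one (hpos.trans hlt)).2 hlt)) h2
    refine (EReal.tendsto_coe_nhds_top_iff.2 h4).congr' ?_
    filter_upwards [self_mem_nhdsWithin] with β (hβ : β < 1)
    rw [minimalDivReal, if_pos (Or.inl ⟨hβ, ho⟩)]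
  · refine tendsto_const_nhds.congr' ?_
    filter_upwards [self_mem_nhdsWithin] with β (hβ : 1 < β)
    refine (if_neg ?_).symm
    rintro (h | h)
    · exact absurd h.1 (not_lt.2 hβ.le)
    · exact hd h

lemma minimalDiv_one (ρ σ : Matrix a a ℂ) :
    minimalDiv 1 ρ σ = limUnder (𝓝[≠] 1) (fun β : ℝ => minimalDivReal β ρ σ) := by
  rw [minimalDiv, if_neg ENNReal.one_ne_top, if_pos rfl]

lemma tendsto_minimalDivReal_one {ρ σ : Matrix a a ℂ} (hρ : ρ.PosSemidef) (hσ : σ.PosSemidef)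
    (hρ0 : ρ ≠ 0) :
    Tendsto (fun β => minimalDivReal β ρ σ) (𝓝[≠] 1) (𝓝 (minimalDiv 1 ρ σ)) := by
  rw [minimalDiv_one]
  refine tendsto_nhds_limUnder ?_
  by_cases hd : Dominated ρ σ
  · obtain ⟨D, hD⟩ := exists_tendsto_log_minimalQ hρ hσ hρ0 hd
    refine ⟨D, (EReal.tendsto_coe.2 hD).congr fun β => ?_⟩
    rw [minimalDivReal_of_dominated hd]
  · exact ⟨⊤, tendsto_minimalDivReal_one_top hρ hσ hd⟩

end LimitOne

/-! ### Optimal measurements -/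

section ConvexHull

lemma sum_eq_of_embedding {ι κ M : Type*} [Fintype ι] [Fintype κ] [AddCommMonoid M] (e : ι ↪ κ)
    {g : ι → M} {h : κ → M} (h1 : ∀ i, h (e i) = g i) (h2 : ∀ j, j ∉ Set.range e → h j = 0) :
    ∑ j, h j = ∑ i, g i := by
  rw [← Finset.sum_subset (Finset.subset_univ (Finset.univ.map e)), Finset.sum_map]
  · exact Finset.sum_congr rfl fun i _ => h1 i
  · intro j _ hj
    exact h2 j fun ⟨i, hi⟩ => hj (by simp [← hi])

/-- The convex hull of a compact set in a finite-dimensional space is compact, by Carathéodory. -/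
lemma isCompact_convexHull_of_finiteDimensional {E : Type*} [AddCommGroup E] [Module ℝ E]
    [FiniteDimensional ℝ E] [TopologicalSpace E] [IsTopologicalAddGroup E] [ContinuousSMul ℝ E]
    {s : Set E} (hs : IsCompact s) : IsCompact (convexHull ℝ s) := by
  rcases s.eq_empty_or_nonempty with rfl | ⟨x₀, hx₀⟩
  · simp
  set D := Module.finrank ℝ E + 1
  have himage : convexHull ℝ s = (fun wz : (Fin D → ℝ) × (Fin D → E) => ∑ i, wz.1 i • wz.2 i) ''
      (stdSimplex ℝ (Fin D) ×ˢ Set.pi Set.univ fun _ => s) := by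
    ext x
    constructor
    · intro hx
      obtain ⟨ι, _, z, w, hz, hind, hw, hw1, hx⟩ := eq_pos_convex_span_of_mem_convexHull hx
      have hcard : Fintype.card ι ≤ Fintype.card (Fin D) := by
        rw [Fintype.card_fin]
        refine hind.card_le_finrank_succ.trans (Nat.succ_le_succ ?_)
        exact Submodule.finrank_le _
      obtain ⟨e⟩ := Function.Embedding.nonempty_of_card_le hcard
      refine ⟨(Function.extend e w 0, Function.extend e z fun _ => x₀), ⟨⟨?_, ?_⟩, ?_⟩, ?_⟩
      · intro j
        by_cases hj : ∃ i, e i = j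
        · obtain ⟨i, rfl⟩ := hj
          simpa [e.injective.extend_apply] using (hw i).le
        · simp [Function.extend_apply' _ _ _ hj]
      · rw [← hw1]
        exact sum_eq_of_embedding e (fun i => by simp [e.injective.extend_apply]) fun j hj => by
          simp only [Function.extend_apply' _ _ _ hj]; rfl
      · intro j _
        by_cases hj : ∃ i, e i = j
        · obtain ⟨i, rfl⟩ := hj
          simpa [e.injective.extend_apply] using hz ⟨i, rfl⟩
        · simpa [Function.extend_apply' _ _ _ hj] using hx₀
      · rw [← hx]
        exact sum_eq_of_embedding e (fun i => by simp [e.injective.extend_apply]) fun j hj => by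
          simp only [Function.extend_apply' _ _ _ hj]; simp
    · rintro ⟨⟨w, z⟩, ⟨hw, hz⟩, rfl⟩
      exact (convex_convexHull ℝ s).sum_mem (fun i _ => hw.1 i) hw.2
        fun i _ => subset_convexHull ℝ s (hz i trivial)
  rw [himage]
  refine ((isCompact_stdSimplex ℝ (Fin D)).prod (isCompact_univ_pi fun _ => hs)).image ?_
  fun_prop

end ConvexHull

section Optimal

variable {a : Type*} [Fintype a] [DecidableEq a]

/-- The set of density matrices. -/
def densities (a : Type*) [Fintype a] : Set (Matrix a a ℂ) := {N | N.PosSemidef ∧ rtr N = 1}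

lemma rtr_conjTranspose_mul_self (B : Matrix a a ℂ) :
    rtr (Bᴴ * B) = ∑ i, ∑ j, ‖B j i‖ ^ 2 := by
  simp only [rtr, trace, diag, Matrix.mul_apply, conjTranspose_apply, Complex.re_sum]
  refine Finset.sum_congr rfl fun i _ => Finset.sum_congr rfl fun j _ => ?_
  rw [Complex.star_def, ← Complex.normSq_eq_conj_mul_self, Complex.ofReal_re,
    Complex.normSq_eq_norm_sq]

lemma isCompact_densities : IsCompact (densities a) := by
  have h : densities a = (fun B : Matrix a a ℂ => Bᴴ * B) '' {B | rtr (Bᴴ * B) = 1} := by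
    ext N
    constructor
    · rintro ⟨hN, h1⟩
      have e : (power N (1 / 2))ᴴ * power N (1 / 2) = N := by
        rw [power_isHermitian hN (by norm_num), power_mul_power hN (by norm_num) (by norm_num)
          (by norm_num), add_halves, power_one hN]
      exact ⟨power N (1 / 2), by rw [Set.mem_ofPred_eq, e, h1], e⟩
    · rintro ⟨B, hB, rfl⟩
      exact ⟨posSemidef_conjTranspose_mul_self B, hB⟩
  rw [h]
  refine IsCompact.image ?_ (by fun_prop)
  have hc : IsCompact (Set.pi Set.univ fun _ : a => Set.pi Set.univ fun _ : a =>
      Metric.closedBall (0 : ℂ) 1) :=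
    isCompact_univ_pi fun _ => isCompact_univ_pi fun _ => isCompact_closedBall _ _
  refine IsCompact.of_isClosed_subset hc ?_ ?_
  · exact isClosed_eq (continuous_rtr.comp (by fun_prop)) continuous_const
  · intro B hB i _ j _
    rw [Set.mem_ofPred_eq, rtr_conjTranspose_mul_self] at hB
    rw [mem_closedBall_zero_iff]
    have h1 : ‖B i j‖ ^ 2 ≤ 1 := by
      rw [← hB]
      refine le_trans ?_ (Finset.single_le_sum (f := fun j => ∑ i, ‖B i j‖ ^ 2)
        (fun j _ => Finset.sum_nonneg fun i _ => sq_nonneg _) (Finset.mem_univ j))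
      exact Finset.single_le_sum (f := fun i => ‖B i j‖ ^ 2) (fun i _ => sq_nonneg _)
        (Finset.mem_univ i)
    nlinarith [norm_nonneg (B i j)]

/-- A functional `∑ x, f (M x)` of measurements with `f` positively homogeneous and continuous on
the density matrices attains its maximum: it is a linear functional of the measure that `M` induces
on the density matrices, and the convex hull of the graph of `f` is compact. -/
lemma exists_optimal_povm [Nonempty a] {f : Matrix a a ℂ → ℝ}
    (hf : ∀ (c : ℝ) (N : Matrix a a ℂ), 0 ≤ c → f (c • N) = c * f N)
    (hfc : ContinuousOn f (densities a)) :
    ∃ (k : ℕ) (M : Fin k → Matrix a a ℂ), IsPOVM M ∧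
      ∀ (l : ℕ) (M' : Fin l → Matrix a a ℂ), IsPOVM M' → ∑ i, f (M' i) ≤ ∑ i, f (M i) := by
  set d : ℝ := (Fintype.card a : ℝ) with hd
  have hd0 : 0 < d := by rw [hd]; exact_mod_cast Fintype.card_pos
  have hrtr1 : rtr (1 : Matrix a a ℂ) = d := by simp [rtr, hd]
  set u : Matrix a a ℂ := d⁻¹ • (1 : Matrix a a ℂ) with hu
  have hu1 : u ∈ densities a := by
    refine ⟨PosSemidef.one.smul (by positivity), ?_⟩
    rw [hu, rtr_smul, hrtr1, inv_mul_cancel₀ hd0.ne']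
  set G : Set (Matrix a a ℂ × ℝ) := (fun N => (N, f N)) '' densities a with hG
  have hGc : IsCompact G := isCompact_densities.image_of_continuousOn (continuousOn_id.prodMk hfc)
  have hHc : IsCompact (convexHull ℝ G ∩ {x | x.1 = u}) :=
    (isCompact_convexHull_of_finiteDimensional hGc).inter_right
      (isClosed_eq continuous_fst continuous_const)
  have hne : (convexHull ℝ G ∩ {x | x.1 = u}).Nonempty :=
    ⟨(u, f u), subset_convexHull ℝ G ⟨u, hu1, rfl⟩, rfl⟩
  obtain ⟨x, ⟨hxG, hxu⟩, hxmax⟩ := hHc.exists_isMaxOn hne continuous_snd.continuousOn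
  -- a measurement yields a point of the convex hull, by normalizing its elements
  have hup : ∀ (l : ℕ) (M' : Fin l → Matrix a a ℂ), IsPOVM M' → ∑ i, f (M' i) ≤ d * x.2 := by
    intro l M' hM'
    have hN : ∀ i, ∃ N ∈ densities a, M' i = rtr (M' i) • N := fun i => by
      rcases (rtr_nonneg (hM'.posSemidef i)).eq_or_lt with h0 | h0
      · refine ⟨u, hu1, ?_⟩
        rw [← h0, zero_smul]; exact eq_zero_of_rtr_eq_zero (hM'.posSemidef i) h0.symm
      · refine ⟨(rtr (M' i))⁻¹ • M' i, ⟨(hM'.posSemidef i).smul (by positivity), ?_⟩, ?_⟩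
        · rw [rtr_smul, inv_mul_cancel₀ h0.ne']
        · rw [smul_smul, mul_inv_cancel₀ h0.ne', one_smul]
    choose N hN hMN using hN
    have hsum : ∑ i, rtr (M' i) = d := by rw [← rtr_sum, hM'.sum_eq_one, hrtr1]
    have hmem : ∑ i, (d⁻¹ * rtr (M' i)) • (N i, f (N i)) ∈ convexHull ℝ G :=
      (convex_convexHull ℝ G).sum_mem
        (fun i _ => mul_nonneg (by positivity) (rtr_nonneg (hM'.posSemidef i)))
        (by rw [← Finset.mul_sum, hsum, inv_mul_cancel₀ hd0.ne'])
        fun i _ => subset_convexHull ℝ G ⟨N i, hN i, rfl⟩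
    have h1 : (∑ i, (d⁻¹ * rtr (M' i)) • (N i, f (N i))).1 = u := by
      rw [Prod.fst_sum, hu, ← hM'.sum_eq_one, Finset.smul_sum]
      refine Finset.sum_congr rfl fun i _ => ?_
      conv_rhs => rw [hMN i]
      rw [Prod.smul_fst, smul_smul]
    have h2 : (∑ i, (d⁻¹ * rtr (M' i)) • (N i, f (N i))).2 = d⁻¹ * ∑ i, f (M' i) := by
      rw [Prod.snd_sum, Finset.mul_sum]
      refine Finset.sum_congr rfl fun i _ => ?_
      conv_rhs => rw [hMN i, hf _ _ (rtr_nonneg (hM'.posSemidef i))]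
      rw [Prod.smul_snd, smul_eq_mul, mul_assoc]
    have h3 := hxmax (show _ ∈ convexHull ℝ G ∩ {x | x.1 = u} from ⟨hmem, h1⟩)
    simp only [Set.mem_ofPred_eq] at h3
    rw [h2, inv_mul_le_iff₀ hd0] at h3
    exact h3
  -- the maximizing point is a convex combination, which is a measurement
  obtain ⟨ι, _, w, z, hw, hw1, hz, hx⟩ := mem_convexHull_iff_exists_fintype.1 hxG
  choose N hN hzN using hz
  let e := (Fintype.equivFin ι).symm
  refine ⟨Fintype.card ι, fun j => (d * w (e j)) • N (e j), ⟨fun j => ?_, ?_⟩, fun l M' hM' => ?_⟩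
  · exact (hN (e j)).1.smul (mul_nonneg hd0.le (hw _))
  · rw [e.sum_comp fun i => (d * w i) • N i]
    have h1 : ∑ i, w i • N i = u := by
      rw [← hxu, ← hx, Prod.fst_sum]
      exact Finset.sum_congr rfl fun i _ => by rw [Prod.smul_fst, ← hzN i]
    simp only [mul_smul, ← Finset.smul_sum]
    rw [h1, hu, smul_smul, mul_inv_cancel₀ hd0.ne', one_smul]
  · refine (hup l M' hM').trans (le_of_eq ?_)
    rw [e.sum_comp fun i => f ((d * w i) • N i), ← hx, Prod.snd_sum, Finset.mul_sum]
    refine Finset.sum_congr rfl fun i _ => ?_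
    rw [hf _ _ (mul_nonneg hd0.le (hw _)), Prod.smul_snd, ← hzN i, smul_eq_mul, mul_assoc]

/-- The perspective of a continuous function is continuous on a cone inside a half-plane. -/
lemma continuousOn_perspective {φ : ℝ → ℝ} (hφ : Continuous φ) (c : ℝ) :
    ContinuousOn (fun x : ℝ × ℝ => x.2 * φ (x.1 / x.2))
      {x | 0 ≤ x.1 ∧ 0 ≤ x.2 ∧ x.1 ≤ c * x.2} := by
  rintro ⟨p, q⟩ ⟨hp, hq, hpq⟩
  simp only at hp hq hpq
  rcases hq.eq_or_lt with h0 | h0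
  · obtain ⟨B, hB⟩ := (isCompact_Icc (a := 0) (b := c)).exists_bound_of_continuousOn hφ.continuousOn
    have hlim : Tendsto (fun x : ℝ × ℝ => x.2 * B)
        (𝓝[{x | 0 ≤ x.1 ∧ 0 ≤ x.2 ∧ x.1 ≤ c * x.2}] (p, q)) (𝓝 0) := by
      have : Continuous fun x : ℝ × ℝ => x.2 * B := by fun_prop
      have h := this.tendsto (p, q)
      simp only [← h0, zero_mul] at h
      rw [← h0]
      exact h.mono_left nhdsWithin_le_nhds
    rw [ContinuousWithinAt]
    simp only [← h0, zero_mul]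
    rw [← h0] at hlim
    refine squeeze_zero_norm' ?_ hlim
    filter_upwards [self_mem_nhdsWithin] with x hx
    obtain ⟨h1, h2, h3⟩ := hx
    rw [norm_mul, Real.norm_of_nonneg h2]
    rcases h2.eq_or_lt with h4 | h4
    · simp [← h4]
    · exact mul_le_mul_of_nonneg_left (hB _ ⟨div_nonneg h1 h2, (div_le_iff₀ h4).2 h3⟩) h2
  · have : ContinuousAt (fun x : ℝ × ℝ => x.2 * φ (x.1 / x.2)) (p, q) :=
      continuousAt_snd.mul
        (hφ.continuousAt.comp (continuousAt_fst.div continuousAt_snd h0.ne'))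
    exact this.continuousWithinAt

lemma le_rtr_smul_one {A : Matrix a a ℂ} (hA : A.PosSemidef) : A ≤ rtr A • (1 : Matrix a a ℂ) := by
  obtain ⟨U, d, hU, hU', rfl, hd⟩ := exists_unitary_rdiag hA.1
  have hd := hd hA
  rw [rtr_conj_isometry hU, rtr_rdiag]
  have h1 : (∑ i, d i) • (1 : Matrix a a ℂ) = U * rdiag (fun _ => ∑ i, d i) * Uᴴ := by
    rw [show rdiag (fun _ : a => ∑ i, d i) = (∑ i, d i) • (1 : Matrix a a ℂ) by
      ext i j; simp [rdiag, diagonal_apply, one_apply], Matrix.mul_smul, Matrix.smul_mul,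
      Matrix.mul_one, hU']
  rw [h1]
  refine conj_le_conj ?_ U
  rw [Matrix.le_iff, rdiag, rdiag, diagonal_sub]
  refine PosSemidef.diagonal fun i => ?_
  rw [← Complex.ofReal_sub]
  simp only [Pi.zero_apply, Complex.zero_le_real, sub_nonneg]
  exact Finset.single_le_sum (fun j _ => hd j) (Finset.mem_univ i)

lemma suppProj_eq_power_mul {σ : Matrix a a ℂ} (hσ : σ.PosSemidef) {s : ℝ} (hs : s ≠ 0) :
    power σ s * power σ (-s) = suppProj σ := by
  obtain ⟨U, d, hU, -, rfl, hd⟩ := exists_unitary_rdiag hσ.1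
  rw [suppProj, cfc_conj_rdiag (by simp) hU, power_conj_rdiag hs hU,
    power_conj_rdiag (neg_ne_zero.2 hs) hU, conj_rdiag_mul hU]
  congr 3; ext i; split_ifs with h
  · simp [h, Real.zero_rpow hs]
  · rw [Real.rpow_neg (hd hσ i), mul_inv_cancel₀
      (Real.rpow_pos_of_pos ((hd hσ i).lt_of_ne (Ne.symm h)) s).ne']

/-- For `0 ≠ ρ ≪ σ` there is a largest likelihood ratio `c`, attained by a rank one effect `N`. It
is the largest eigenvalue of `σ ^ (-1/2) * ρ * σ ^ (-1/2)`. -/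
lemma exists_max_ratio {ρ σ : Matrix a a ℂ} (hρ : ρ.PosSemidef) (hσ : σ.PosSemidef) (hρ0 : ρ ≠ 0)
    (hd : Dominated ρ σ) : ∃ (c : ℝ) (N : Matrix a a ℂ), 0 < c ∧ ρ ≤ c • σ ∧ N.PosSemidef ∧
      N ≤ 1 ∧ 0 < rtr (σ * N) ∧ rtr (ρ * N) = c * rtr (σ * N) := by
  set S := power σ (1 / 2) with hS
  set R := power σ (-(1 / 2)) with hR
  have hSh : Sᴴ = S := power_isHermitian hσ (by norm_num)
  have hRh : Rᴴ = R := power_isHermitian hσ (by norm_num)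
  have hSS : S * S = σ := by
    rw [hS, power_mul_power hσ (by norm_num) (by norm_num) (by norm_num), add_halves, power_one hσ]
  have hSR : S * R = suppProj σ := suppProj_eq_power_mul hσ (by norm_num)
  have hRS : R * S = suppProj σ := by
    have := congrArg conjTranspose hSR
    rwa [conjTranspose_mul, hSh, hRh, suppProj_isHermitian hσ] at this
  set X := R * ρ * R with hX
  have hXp : X.PosSemidef := sandwich_posSemidef hρ hσ (by norm_num)
  have hρX : ρ = S * X * S := by
    rw [hX, show S * (R * ρ * R) * S = (S * R) * ρ * (R * S) by simp only [Matrix.mul_assoc], hSR,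
      hRS, hd.suppProj_mul hρ hσ, hd.mul_suppProj hσ]
  obtain ⟨U, x, hU, hU', hXU, hx⟩ := exists_unitary_rdiag hXp.1
  have hx := hx hXp
  have hne : Nonempty a := by
    by_contra h
    rw [not_nonempty_iff] at h
    exact hρ0 (Subsingleton.elim _ _)
  obtain ⟨i, -, hi⟩ := Finset.exists_max_image Finset.univ x Finset.univ_nonempty
  have hxi : 0 < x i := by
    refine (hx i).lt_of_ne fun h0 => hρ0 ?_
    have : x = fun _ => 0 := funext fun j => le_antisymm (h0 ▸ hi j (Finset.mem_univ j)) (hx j)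
    rw [hρX, hXU, this]
    simp [rdiag]
  -- the projection onto the top eigenvector
  set E := U * rdiag (fun j => if j = i then 1 else 0) * Uᴴ with hE
  have hEp : E.PosSemidef := (rdiag_posSemidef fun j => by
    split_ifs <;> norm_num).mul_mul_conjTranspose_same U
  have hEtr : rtr E = 1 := by rw [hE, rtr_conj_isometry hU, rtr_rdiag]; simp
  have hXE : X * E = x i • E := by
    rw [hXU, hE, conj_rdiag_mul hU, ← Matrix.smul_mul, ← Matrix.mul_smul, smul_rdiag]
    congr 3; ext j; split_ifs with h <;> simp [h]
  have hPX : suppProj σ * X = X := by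
    rw [hX, ← Matrix.mul_assoc, ← Matrix.mul_assoc, ← hSR, hR]
    congr 2
    obtain ⟨V, d, hV, -, hσV, -⟩ := exists_unitary_rdiag hσ.1
    rw [← hR, hSR, hR, suppProj, hσV, cfc_conj_rdiag (by simp) hV,
      power_conj_rdiag (by norm_num) hV, conj_rdiag_mul hV]
    congr 3; ext j; split_ifs with h
    · rw [h, zero_mul, Real.zero_rpow (by norm_num)]
    · rw [one_mul]
  have hPE : suppProj σ * E = E := by
    have h1 : E = (x i)⁻¹ • (X * E) := by rw [hXE, smul_smul, inv_mul_cancel₀ hxi.ne', one_smul]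
    rw [h1, Matrix.mul_smul, ← Matrix.mul_assoc, hPX]
  set N₀ := R * E * R with hN₀
  have hN₀p : N₀.PosSemidef := by
    have := hEp.mul_mul_conjTranspose_same R
    rwa [hRh] at this
  have hσN : rtr (σ * N₀) = 1 := by
    rw [← hSS, hN₀, show S * S * (R * E * R) = S * (S * R * E * R) by simp only [Matrix.mul_assoc],
      rtr_mul_comm, hSR, hPE, Matrix.mul_assoc, hRS, rtr_mul_comm, hPE, hEtr]
  have hρN : rtr (ρ * N₀) = x i := by
    rw [hN₀, show ρ * (R * E * R) = (ρ * R * E) * R by simp only [Matrix.mul_assoc], rtr_mul_comm,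
      show R * (ρ * R * E) = X * E by rw [hX]; simp only [Matrix.mul_assoc], hXE, rtr_smul, hEtr,
      mul_one]
  have hN₀tr : 0 < rtr N₀ := rtr_pos hN₀p fun h => by
    rw [h, Matrix.mul_zero] at hσN; simp [rtr] at hσN
  refine ⟨x i, (rtr N₀)⁻¹ • N₀, hxi, ?_, hN₀p.smul (by positivity), ?_, ?_, ?_⟩
  · have h1 : X ≤ x i • (1 : Matrix a a ℂ) := by
      have e1 : x i • (1 : Matrix a a ℂ) = U * rdiag (fun _ => x i) * Uᴴ := by
        rw [show rdiag (fun _ : a => x i) = x i • (1 : Matrix a a ℂ) by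
          ext i j; simp [rdiag, diagonal_apply, one_apply], Matrix.mul_smul, Matrix.smul_mul,
          Matrix.mul_one, hU']
      rw [e1]
      conv_lhs => rw [hXU]
      refine conj_le_conj ?_ U
      rw [Matrix.le_iff, rdiag, rdiag, diagonal_sub]
      refine PosSemidef.diagonal fun j => ?_
      rw [← Complex.ofReal_sub]
      simp only [Pi.zero_apply, Complex.zero_le_real, sub_nonneg]
      exact hi j (Finset.mem_univ j)
    have h2 := conj_le_conj h1 S
    rwa [hSh, ← hρX, Matrix.mul_smul, Matrix.smul_mul, Matrix.mul_one, hSS] at h2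
  · have h1 := le_rtr_smul_one (hN₀p.smul (inv_nonneg.2 hN₀tr.le))
    rwa [rtr_smul, inv_mul_cancel₀ hN₀tr.ne', one_smul] at h1
  · rw [Matrix.mul_smul, rtr_smul, hσN]; positivity
  · rw [Matrix.mul_smul, Matrix.mul_smul, rtr_smul, rtr_smul, hσN, hρN]; ring

end Optimal

/-! ### Classical Rényi divergences -/

section ClassicalDivergence

variable {κ : Type*} [Fintype κ] {p q : κ → ℝ}

lemma classicalDiv_comp_equiv {κ' : Type*} [Fintype κ'] (e : κ' ≃ κ) (α : ℝ≥0∞) (p q : κ → ℝ) :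
    classicalDiv α (p ∘ e) (q ∘ e) = classicalDiv α p q := by
  have h1 : (∀ i, (q ∘ e) i = 0 → (p ∘ e) i = 0) ↔ ∀ i, q i = 0 → p i = 0 :=
    e.forall_congr_left.trans (by simp)
  have h2 : (∃ i, (p ∘ e) i ≠ 0 ∧ (q ∘ e) i ≠ 0) ↔ ∃ i, p i ≠ 0 ∧ q i ≠ 0 :=
    e.exists_congr_left.trans (by simp)
  have h3 : ∀ f : κ → ℝ, ∑ i, f (e i) = ∑ i, f i := fun f => e.sum_comp f
  simp only [classicalDiv, h1, h2]
  have h4 := h3 p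
  have h5 := h3 fun i => p i * (Real.log (p i) - Real.log (q i))
  have h6 := h3 fun i => p i ^ α.toReal * q i ^ (1 - α.toReal)
  simp only [Function.comp_apply, h4, h5, h6]
  congr 1
  exact e.iSup_comp (g := fun i => ⨆ _ : p i ≠ 0,
    if q i = 0 then (⊤ : EReal) else ((Real.log (p i / q i) : ℝ) : EReal))

lemma ofReal_ne_one {β : ℝ} (hβ1 : β ≠ 1) : ENNReal.ofReal β ≠ 1 := by
  rwa [Ne, ENNReal.ofReal_eq_one]

lemma classicalDiv_ofReal_of_ac {β : ℝ} (hβ : 0 < β) (hβ1 : β ≠ 1)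
    (hac : ∀ i, q i = 0 → p i = 0) : classicalDiv (ENNReal.ofReal β) p q =
      ((1 / (β - 1) * Real.log ((∑ i, p i ^ β * q i ^ (1 - β)) / ∑ i, p i) : ℝ) : EReal) := by
  rw [classicalDiv, if_neg ENNReal.ofReal_ne_top, if_neg (ofReal_ne_one hβ1), if_pos (Or.inr hac),
    ENNReal.toReal_ofReal hβ.le]

lemma classicalDiv_ofReal_of_lt_one {β : ℝ} (hβ : 0 < β) (hβ1 : β < 1)
    (h : ∃ i, p i ≠ 0 ∧ q i ≠ 0) : classicalDiv (ENNReal.ofReal β) p q =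
      ((1 / (β - 1) * Real.log ((∑ i, p i ^ β * q i ^ (1 - β)) / ∑ i, p i) : ℝ) : EReal) := by
  rw [classicalDiv, if_neg ENNReal.ofReal_ne_top, if_neg (ofReal_ne_one hβ1.ne),
    if_pos (Or.inl ⟨by rwa [ENNReal.ofReal_lt_one], h⟩), ENNReal.toReal_ofReal hβ.le]

lemma classicalDiv_eq_top {α : ℝ≥0∞} (h : ∃ i, q i = 0 ∧ p i ≠ 0)
    (h' : 1 ≤ α ∨ ∀ i, p i = 0 ∨ q i = 0) : classicalDiv α p q = ⊤ := by
  obtain ⟨i, hqi, hpi⟩ := h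
  have hac : ¬ ∀ i, q i = 0 → p i = 0 := fun h => hpi (h i hqi)
  rw [classicalDiv]
  split_ifs with h1 h2 h3
  · refine top_le_iff.1 (le_iSup_of_le i (le_iSup_of_le hpi ?_))
    rw [if_pos hqi]
  · rfl
  · exfalso
    rcases h3 with ⟨h3, j, hj, hj'⟩ | h3
    · rcases h' with h' | h'
      · exact absurd h3 (not_lt.2 h')
      · rcases h' j with h | h
        exacts [hj h, hj' h]
    · exact hac h3
  · rfl

lemma sum_rpow_mul_rpow_pos (hp : ∀ i, 0 ≤ p i) (hq : ∀ i, 0 ≤ q i) (β : ℝ)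
    (h : ∃ i, p i ≠ 0 ∧ q i ≠ 0) : 0 < ∑ i, p i ^ β * q i ^ (1 - β) := by
  obtain ⟨i, h1, h2⟩ := h
  refine Finset.sum_pos' (fun j _ => mul_nonneg (Real.rpow_nonneg (hp j) _)
    (Real.rpow_nonneg (hq j) _)) ⟨i, Finset.mem_univ i, ?_⟩
  exact mul_pos (Real.rpow_pos_of_pos ((hp i).lt_of_ne h1.symm) _)
    (Real.rpow_pos_of_pos ((hq i).lt_of_ne h2.symm) _)

lemma exists_common_of_ac (hP : 0 < ∑ i, p i) (hac : ∀ i, q i = 0 → p i = 0) :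
    ∃ i, p i ≠ 0 ∧ q i ≠ 0 := by
  obtain ⟨i, -, hi⟩ := Finset.exists_ne_zero_of_sum_ne_zero hP.ne'
  exact ⟨i, hi, fun h => hi (hac i h)⟩

lemma exists_common_of_sum_ne_zero {β : ℝ} (hβ : β ≠ 0) (hβ1 : β ≠ 1)
    (h : ∑ i, p i ^ β * q i ^ (1 - β) ≠ 0) : ∃ i, p i ≠ 0 ∧ q i ≠ 0 := by
  obtain ⟨i, -, hi⟩ := Finset.exists_ne_zero_of_sum_ne_zero h
  refine ⟨i, fun h => hi ?_, fun h => hi ?_⟩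
  · rw [h, Real.zero_rpow hβ, zero_mul]
  · rw [h, Real.zero_rpow (sub_ne_zero.2 hβ1.symm), mul_zero]

/-- The classical Rényi divergence of order `β` is compared with that of order `1`, using only
`exp t ≥ 1 + t`. -/
lemma mul_exp_le_sum_rpow (hp : ∀ i, 0 ≤ p i) (hq : ∀ i, 0 ≤ q i) (hP : 0 < ∑ i, p i)
    (hac : ∀ i, q i = 0 → p i = 0) {β : ℝ} (hβ : β ≠ 0) :
    (∑ i, p i) * Real.exp ((β - 1) *
        ((∑ i, p i * (Real.log (p i) - Real.log (q i))) / ∑ i, p i)) ≤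
      ∑ i, p i ^ β * q i ^ (1 - β) := by
  set P := ∑ i, p i with hPdef
  set k := (∑ i, p i * (Real.log (p i) - Real.log (q i))) / P with hk
  have hkP : ∑ i, p i * (Real.log (p i) - Real.log (q i)) = k * P := by
    rw [hk, div_mul_cancel₀ _ hP.ne']
  have h1 : P ≤ ∑ i, p i ^ β * q i ^ (1 - β) * Real.exp (-((β - 1) * k)) := by
    have h2 : P = ∑ i, p i * (1 + (β - 1) * (Real.log (p i) - Real.log (q i) - k)) := by
      have : ∀ i, p i * (1 + (β - 1) * (Real.log (p i) - Real.log (q i) - k)) =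
          p i + (β - 1) * (p i * (Real.log (p i) - Real.log (q i)) - k * p i) := fun i => by ring
      simp only [this]
      rw [Finset.sum_add_distrib, ← Finset.mul_sum, Finset.sum_sub_distrib, hkP, ← Finset.mul_sum,
        ← hPdef, sub_self, mul_zero, add_zero]
    rw [h2]
    refine Finset.sum_le_sum fun i _ => ?_
    rcases (hp i).eq_or_lt with h0 | h0
    · rw [← h0, Real.zero_rpow hβ]; simp
    have hqi : 0 < q i := (hq i).lt_of_ne fun h => h0.ne' (hac i h.symm)
    have h3 : p i ^ β * q i ^ (1 - β) * Real.exp (-((β - 1) * k)) =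
        p i * Real.exp ((β - 1) * (Real.log (p i) - Real.log (q i) - k)) := by
      rw [Real.rpow_def_of_pos h0, Real.rpow_def_of_pos hqi]
      conv_rhs => enter [1]; rw [← Real.exp_log h0]
      rw [← Real.exp_add, ← Real.exp_add, ← Real.exp_add]
      congr 1; ring
    rw [h3]
    refine mul_le_mul_of_nonneg_left ?_ h0.le
    linarith [Real.add_one_le_exp ((β - 1) * (Real.log (p i) - Real.log (q i) - k))]
  rw [← Finset.sum_mul, Real.exp_neg, ← div_eq_mul_inv, le_div_iff₀ (Real.exp_pos _)] at h1
  exact h1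

lemma classicalDiv_one_of_ac (hac : ∀ i, q i = 0 → p i = 0) : classicalDiv 1 p q =
    (((∑ i, p i * (Real.log (p i) - Real.log (q i))) / ∑ i, p i : ℝ) : EReal) := by
  rw [classicalDiv, if_neg ENNReal.one_ne_top, if_pos rfl, if_pos hac]

/-- The logarithmic form of `mul_exp_le_sum_rpow`; dividing by `β - 1` gives opposite comparisons
for `β < 1` and for `β > 1`. -/
lemma mul_div_le_log (hp : ∀ i, 0 ≤ p i) (hq : ∀ i, 0 ≤ q i) (hP : 0 < ∑ i, p i)
    (hac : ∀ i, q i = 0 → p i = 0) {β : ℝ} (hβ : β ≠ 0) :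
    (β - 1) * ((∑ i, p i * (Real.log (p i) - Real.log (q i))) / ∑ i, p i) ≤
      Real.log ((∑ i, p i ^ β * q i ^ (1 - β)) / ∑ i, p i) := by
  have h := mul_exp_le_sum_rpow hp hq hP hac hβ
  rw [Real.le_log_iff_exp_le
    (div_pos (sum_rpow_mul_rpow_pos hp hq β (exists_common_of_ac hP hac)) hP), le_div_iff₀ hP]
  linarith

lemma classicalDiv_ofReal_le_one (hp : ∀ i, 0 ≤ p i) (hq : ∀ i, 0 ≤ q i) (hP : 0 < ∑ i, p i)
    {β : ℝ} (hβ : 0 < β) (hβ1 : β < 1) :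
    classicalDiv (ENNReal.ofReal β) p q ≤ classicalDiv 1 p q := by
  by_cases hac : ∀ i, q i = 0 → p i = 0
  · rw [classicalDiv_ofReal_of_ac hβ hβ1.ne hac, classicalDiv_one_of_ac hac, EReal.coe_le_coe_iff,
      one_div, ← div_eq_inv_mul, div_le_iff_of_neg (by linarith), mul_comm]
    exact mul_div_le_log hp hq hP hac hβ.ne'
  · push Not at hac
    rw [classicalDiv_eq_top hac (Or.inl le_rfl)]
    exact le_top

lemma classicalDiv_one_le_ofReal (hp : ∀ i, 0 ≤ p i) (hq : ∀ i, 0 ≤ q i) (hP : 0 < ∑ i, p i)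
    {β : ℝ} (hβ1 : 1 < β) : classicalDiv 1 p q ≤ classicalDiv (ENNReal.ofReal β) p q := by
  by_cases hac : ∀ i, q i = 0 → p i = 0
  · rw [classicalDiv_ofReal_of_ac (by linarith) hβ1.ne' hac, classicalDiv_one_of_ac hac,
      EReal.coe_le_coe_iff, one_div, ← div_eq_inv_mul, le_div_iff₀ (by linarith), mul_comm]
    exact mul_div_le_log hp hq hP hac (by linarith)
  · push Not at hac
    rw [classicalDiv_eq_top hac (Or.inl (ENNReal.one_le_ofReal.2 hβ1.le))]
    exact le_top

end ClassicalDivergence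

/-! ### Measured divergences -/

section Measured

variable {a κ : Type*} [Fintype a] [DecidableEq a] [Fintype κ] {ρ σ : Matrix a a ℂ}

/-- Measurements may be indexed by any finite type. -/
lemma classicalDiv_mem_measuredDivs {M : κ → Matrix a a ℂ} (hM : IsPOVM M) (α : ℝ≥0∞)
    (ρ σ : Matrix a a ℂ) : classicalDiv α (measure M ρ) (measure M σ) ∈ measuredDivs α ρ σ := by
  let e := (Fintype.equivFin κ).symm
  refine ⟨Fintype.card κ, fun i => M (e i), ⟨fun i => hM.posSemidef _, ?_⟩, ?_⟩
  · rw [e.sum_comp M, hM.sum_eq_one]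
  · exact (classicalDiv_comp_equiv e α _ _).symm

lemma IsPOVM.ac_of_dominated {M : κ → Matrix a a ℂ} (hM : IsPOVM M) (hσ : σ.PosSemidef)
    (hd : Dominated ρ σ) (i : κ) (h : measure M σ i = 0) : measure M ρ i = 0 :=
  hd.rtr_mul_eq_zero hσ (hM.posSemidef i) h

lemma minimalDivReal_of_not_orthogonal {β : ℝ} (hβ : β < 1) (ho : ¬ Orthogonal ρ σ) :
    minimalDivReal β ρ σ = ((1 / (β - 1) * Real.log (minimalQ β ρ σ / rtr ρ) : ℝ) : EReal) := by
  rw [minimalDivReal, if_pos (Or.inl ⟨hβ, ho⟩)]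

lemma minimalDivReal_eq_top {β : ℝ} (hd : ¬ Dominated ρ σ) (h : 1 ≤ β ∨ Orthogonal ρ σ) :
    minimalDivReal β ρ σ = ⊤ := by
  rw [minimalDivReal, if_neg]
  rintro (h' | h')
  · rcases h with h | h
    exacts [absurd h'.1 (not_lt.2 h), h'.2 h]
  · exact hd h'

lemma minimalQ_pos (hρ : ρ.PosSemidef) (hσ : σ.PosSemidef) {β : ℝ} (hβ : 0 < β) (hβ1 : β ≠ 1)
    (ho : ¬ Orthogonal ρ σ) : 0 < minimalQ β ρ σ :=
  (minimalQ_nonneg hρ hσ hβ hβ1).lt_of_ne fun h =>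
    ho (orthogonal_of_minimalQ_eq_zero hρ hσ hβ hβ1 h.symm)

lemma minimalQ_eq_zero_of_orthogonal (hσ : σ.PosSemidef) {β : ℝ} (hβ : 1 / 2 ≤ β) (hβ1 : β ≠ 1)
    (ho : Orthogonal ρ σ) : minimalQ β ρ σ = 0 := by
  have hc := exponent_ne_zero (by linarith : 0 < β) hβ1
  have hc1 : (1 - β) / (2 * β) - 1 ≠ 0 := by
    rw [sub_ne_zero, Ne, div_eq_one_iff_eq (by linarith)]
    intro h; linarith
  have h1 : power σ ((1 - β) / (2 * β)) * ρ = 0 := by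
    have h2 := power_mul_power hσ hc1 one_ne_zero (by rwa [sub_add_cancel])
    rw [sub_add_cancel, power_one hσ] at h2
    rw [← h2, Matrix.mul_assoc, ho.2, Matrix.mul_zero]
  rw [minimalQ, h1, Matrix.zero_mul, power_zero_matrix (by linarith)]
  simp [rtr]

/-- Either the divergence of order `β` is finite, given by a positive `minimalQ`, or the pair is in
the position where it is infinite. -/
lemma minimalDivReal_cases (hρ : ρ.PosSemidef) (hσ : σ.PosSemidef) (hρ0 : ρ ≠ 0) {β : ℝ}
    (hβ : 0 < β) (hβ1 : β ≠ 1) :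
    (0 < minimalQ β ρ σ ∧ (1 < β → Dominated ρ σ) ∧ ¬ Orthogonal ρ σ ∧ minimalDivReal β ρ σ =
      ((1 / (β - 1) * Real.log (minimalQ β ρ σ / rtr ρ) : ℝ) : EReal)) ∨
    (¬ Dominated ρ σ ∧ (1 ≤ β ∨ Orthogonal ρ σ) ∧ minimalDivReal β ρ σ = ⊤) := by
  by_cases hd : Dominated ρ σ
  · have ho : ¬ Orthogonal ρ σ := fun ho => not_dominated_of_orthogonal hσ hρ0 ho hd
    exact Or.inl ⟨minimalQ_pos hρ hσ hβ hβ1 ho, fun _ => hd, ho, minimalDivReal_of_dominated hd β⟩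
  · by_cases h : 1 ≤ β ∨ Orthogonal ρ σ
    · exact Or.inr ⟨hd, h, minimalDivReal_eq_top hd h⟩
    · push Not at h
      exact Or.inl ⟨minimalQ_pos hρ hσ hβ hβ1 h.2, fun h' => absurd h' (not_lt.2 h.1.le), h.2,
        minimalDivReal_of_not_orthogonal h.1 h.2⟩

/-- Measurements do not increase the minimal divergence. -/
lemma classicalDiv_measure_le [DecidableEq κ] {M : κ → Matrix a a ℂ} (hM : IsPOVM M)
    (hρ : ρ.PosSemidef) (hσ : σ.PosSemidef) (hρ0 : ρ ≠ 0) {β : ℝ} (hβ : 1 / 2 ≤ β) (hβ1 : β ≠ 1) :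
    classicalDiv (ENNReal.ofReal β) (measure M ρ) (measure M σ) ≤ minimalDivReal β ρ σ := by
  have hβ0 : 0 < β := by linarith
  have hP := rtr_pos hρ hρ0
  have hp := hM.measure_nonneg hρ
  have hq := hM.measure_nonneg hσ
  rcases minimalDivReal_cases hρ hσ hρ0 hβ0 hβ1 with ⟨hQ, hd, -, h⟩ | ⟨-, -, h⟩
  swap
  · rw [h]; exact le_top
  rw [h]
  rcases lt_or_gt_of_ne hβ1 with hlt | hgt
  · have h1 := minimalQ_le_sum_measure hM hρ hσ hβ hlt
    rw [classicalDiv_ofReal_of_lt_one hβ0 hlt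
      (exists_common_of_sum_ne_zero hβ0.ne' hβ1 (hQ.trans_le h1).ne'), hM.sum_measure,
      EReal.coe_le_coe_iff]
    refine mul_le_mul_of_nonpos_left (Real.log_le_log (div_pos hQ hP) ?_)
      (one_div_nonpos.2 (by linarith))
    exact div_le_div_of_nonneg_right h1 hP.le
  · have hac := fun i => hM.ac_of_dominated hσ (hd hgt) i
    have h1 := sum_measure_le_minimalQ hM hρ hσ (hd hgt) hgt
    have hP' : 0 < ∑ i, measure M ρ i := by rwa [hM.sum_measure]
    rw [classicalDiv_ofReal_of_ac hβ0 hβ1 hac, hM.sum_measure, EReal.coe_le_coe_iff]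
    refine mul_le_mul_of_nonneg_left (Real.log_le_log (div_pos ?_ hP) ?_)
      (one_div_nonneg.2 (by linarith))
    · exact sum_rpow_mul_rpow_pos hp hq β (exists_common_of_ac hP' hac)
    · exact div_le_div_of_nonneg_right h1 hP.le

lemma tensorPow_ne_zero (hρ : ρ.PosSemidef) (hρ0 : ρ ≠ 0) (n : ℕ) : tensorPow ρ n ≠ 0 := fun h => by
  have h1 := pow_pos (rtr_pos hρ hρ0) n
  rw [← rtr_tensorPow hρ, h] at h1
  simp [rtr] at h1

/-- The divergence of `n` copies, in the finite case. -/
lemma minimalDivReal_tensorPow (hρ : ρ.PosSemidef) (hσ : σ.PosSemidef) (hρ0 : ρ ≠ 0) {β D : ℝ}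
    (hβ : 1 / 2 ≤ β) (hβ1 : β ≠ 1) (hD : minimalDivReal β ρ σ = D) (n : ℕ) :
    minimalDivReal β (tensorPow ρ n) (tensorPow σ n) = ((n * D : ℝ) : EReal) := by
  have hβ0 : 0 < β := by linarith
  have hP := rtr_pos hρ hρ0
  rcases minimalDivReal_cases hρ hσ hρ0 hβ0 hβ1 with ⟨hQ, hd, -, h⟩ | ⟨-, -, h⟩
  swap
  · rw [h] at hD; exact absurd hD (EReal.top_ne_coe D)
  rw [h, EReal.coe_eq_coe_iff] at hD
  have hQn := minimalQ_tensorPow hρ hσ hβ0 hβ1 n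
  have hval : 1 / (β - 1) * Real.log (minimalQ β (tensorPow ρ n) (tensorPow σ n) /
      rtr (tensorPow ρ n)) = n * D := by
    rw [hQn, rtr_tensorPow hρ, ← div_pow, Real.log_pow, ← hD]; ring
  rw [← hval]
  rcases lt_or_gt_of_ne hβ1 with hlt | hgt
  · refine minimalDivReal_of_not_orthogonal hlt fun ho => ?_
    rw [minimalQ_eq_zero_of_orthogonal (tensorPow_posSemidef hσ n) hβ hβ1 ho] at hQn
    exact (pow_pos hQ n).ne hQn
  · exact minimalDivReal_of_dominated ((hd hgt).tensorPow hσ n) β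

/-- On `n` copies, the basis of `IsPinchingBasis` achieves the divergence up to a logarithmic
error. -/
lemma exists_le_classicalDiv (hρ : ρ.PosSemidef) (hσ : σ.PosSemidef) (hρ0 : ρ ≠ 0) {β D : ℝ}
    (hβ : 0 < β) (hβ1 : β ≠ 1) (hD : minimalDivReal β ρ σ = D) : ∃ C : ℝ, ∀ n : ℕ,
      ∃ W : Matrix (Fin n → a) (Fin n → a) ℂ, IsPOVM (basisPOVM W) ∧
      ((n * D - C * Real.log ((n : ℝ) + 1) : ℝ) : EReal) ≤ classicalDiv (ENNReal.ofReal β)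
        (measure (basisPOVM W) (tensorPow ρ n)) (measure (basisPOVM W) (tensorPow σ n)) := by
  have hP := rtr_pos hρ hρ0
  rcases minimalDivReal_cases hρ hσ hρ0 hβ hβ1 with ⟨hQ, hd, -, h⟩ | ⟨-, -, h⟩
  swap
  · rw [h] at hD; exact absurd hD (EReal.top_ne_coe D)
  rw [h, EReal.coe_eq_coe_iff] at hD
  refine ⟨(if β < 1 then 1 else β / (β - 1)) * Fintype.card a, fun n => ?_⟩
  obtain ⟨W, r, m, hW⟩ := exists_isPinchingBasis hρ hσ n
  refine ⟨W, isPOVM_basisPOVM hW.mul_conjTranspose_self, ?_⟩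
  rw [hW.measure_left, hW.measure_right]
  have hPn : ∑ i, r i = rtr ρ ^ n := by rw [hW.sum_left, rtr_tensorPow hρ]
  have hv : (0 : ℝ) < ((n : ℝ) + 1) ^ Fintype.card a := by positivity
  have hlogv : Real.log (((n : ℝ) + 1) ^ Fintype.card a) =
      Fintype.card a * Real.log ((n : ℝ) + 1) := Real.log_pow _ _
  have hnD : (n : ℝ) * D =
      1 / (β - 1) * (n * Real.log (minimalQ β ρ σ) - n * Real.log (rtr ρ)) := by
    rw [← hD, Real.log_div hQ.ne' hP.ne']; ring
  have hle := hW.pow_le hρ hσ hβ hβ1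
  have hS : 0 < ∑ i, r i ^ β * m i ^ (1 - β) := by
    by_contra hS
    exact absurd (hle.trans (mul_nonpos_of_nonneg_of_nonpos (by positivity) (not_lt.1 hS)))
      (not_le.2 (pow_pos hQ n))
  have hcommon := exists_common_of_sum_ne_zero hβ.ne' hβ1 hS.ne'
  have hlog : Real.log ((∑ i, r i ^ β * m i ^ (1 - β)) / ∑ i, r i) =
      Real.log (∑ i, r i ^ β * m i ^ (1 - β)) - n * Real.log (rtr ρ) := by
    rw [hPn, Real.log_div hS.ne' (pow_pos hP n).ne', Real.log_pow]
  rcases lt_or_gt_of_ne hβ1 with hlt | hgt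
  · rw [classicalDiv_ofReal_of_lt_one hβ hlt hcommon, EReal.coe_le_coe_iff, hlog, hnD, if_pos hlt]
    have h1 := Real.log_le_log hS (hW.sum_le_of_lt_one β hβ hlt)
    rw [Real.log_mul (by positivity) (by positivity), Real.log_rpow hv, hlogv, Real.log_pow] at h1
    have h2 : 1 / (β - 1) < 0 := one_div_neg.2 (by linarith)
    have h3 := mul_le_mul_of_nonpos_left h1 h2.le
    have h4 : 1 / (β - 1) * ((1 - β) * (Fintype.card a * Real.log ((n : ℝ) + 1))) =
        -(Fintype.card a * Real.log ((n : ℝ) + 1)) := by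
      field_simp [sub_ne_zero.2 hβ1]; ring
    rw [mul_add, h4] at h3
    linarith
  · by_cases hac : ∀ i, m i = 0 → r i = 0
    swap
    · push Not at hac
      rw [classicalDiv_eq_top hac (Or.inl (ENNReal.one_le_ofReal.2 hgt.le))]
      exact le_top
    rw [classicalDiv_ofReal_of_ac hβ hβ1 hac, EReal.coe_le_coe_iff, hlog, hnD,
      if_neg (not_lt.2 hgt.le)]
    have h1 := Real.log_le_log (pow_pos hQ n) hle
    rw [Real.log_mul (by positivity) hS.ne', Real.log_rpow hv, Real.log_pow, hlogv] at h1
    have h2 : 0 < 1 / (β - 1) := one_div_pos.2 (by linarith)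
    have h3 := mul_le_mul_of_nonneg_left h1 h2.le
    have h4 : 1 / (β - 1) * (β * (Fintype.card a * Real.log ((n : ℝ) + 1))) =
        β / (β - 1) * Fintype.card a * Real.log ((n : ℝ) + 1) := by ring
    rw [mul_add, h4] at h3
    linarith

end Measured

/-! ### Binary measurements and infinite divergences -/

section Binary

variable {a : Type*} [Fintype a] [DecidableEq a] {ρ σ : Matrix a a ℂ}

/-- The measurement of an effect `N` against its complement. -/
def binaryPOVM (N : Matrix a a ℂ) (x : Bool) : Matrix a a ℂ := if x then N else 1 - N

lemma isPOVM_binaryPOVM {N : Matrix a a ℂ} (hN : N.PosSemidef) (hN1 : N ≤ 1) :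
    IsPOVM (binaryPOVM N) where
  posSemidef x := by
    cases x
    · simpa [binaryPOVM] using Matrix.le_iff.1 hN1
    · simpa [binaryPOVM] using hN
  sum_eq_one := by simp [binaryPOVM]

lemma isPOVM_suppProj (hσ : σ.PosSemidef) : IsPOVM (binaryPOVM (suppProj σ)) := by
  have hPh := suppProj_isHermitian hσ
  have hPP := suppProj_mul_self hσ
  refine isPOVM_binaryPOVM ?_ ?_
  · have := posSemidef_conjTranspose_mul_self (suppProj σ)
    rwa [hPh, hPP] at this
  · rw [Matrix.le_iff]
    have := posSemidef_conjTranspose_mul_self (1 - suppProj σ)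
    rw [conjTranspose_sub, conjTranspose_one, hPh] at this
    rwa [show (1 - suppProj σ) * (1 - suppProj σ) = 1 - suppProj σ by
      rw [Matrix.mul_sub, Matrix.sub_mul, Matrix.sub_mul, hPP]; simp] at this

lemma measure_suppProj_right (hσ : σ.PosSemidef) :
    measure (binaryPOVM (suppProj σ)) σ false = 0 := by
  simp [measure, binaryPOVM, Matrix.mul_sub, mul_suppProj hσ, rtr]

lemma measure_suppProj_left (hρ : ρ.PosSemidef) (hσ : σ.PosSemidef) (hd : ¬ Dominated ρ σ) :
    0 < measure (binaryPOVM (suppProj σ)) ρ false := by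
  have h := rtr_suppProj_conj_lt hρ hσ hd
  rw [Matrix.mul_assoc, rtr_mul_comm, Matrix.mul_assoc, suppProj_mul_self hσ] at h
  simp only [measure, binaryPOVM, Bool.false_eq_true, if_false, Matrix.mul_sub, Matrix.mul_one,
    rtr_sub]
  linarith

/-- If the divergence is infinite, this is seen by measuring the support of the second argument. -/
lemma top_mem_measuredDivs (hρ : ρ.PosSemidef) (hσ : σ.PosSemidef) (hd : ¬ Dominated ρ σ)
    {α : ℝ≥0∞} (h : 1 ≤ α ∨ Orthogonal ρ σ) : ⊤ ∈ measuredDivs α ρ σ := by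
  rw [← classicalDiv_eq_top (α := α) ⟨false, measure_suppProj_right hσ,
    (measure_suppProj_left hρ hσ hd).ne'⟩ (h.imp_right fun ho i => ?_)]
  · exact classicalDiv_mem_measuredDivs (isPOVM_suppProj hσ) α ρ σ
  · cases i
    · exact Or.inr (measure_suppProj_right hσ)
    · left
      obtain ⟨D, hD⟩ := exists_suppProj_eq_mul hσ
      have h2 := congrArg conjTranspose hD
      rw [suppProj_isHermitian hσ, conjTranspose_mul, hσ.1] at h2
      simp only [measure, binaryPOVM, if_true]
      rw [h2, ← Matrix.mul_assoc, ho.1, Matrix.zero_mul]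
      simp [rtr]

lemma not_dominated_tensorPow (hρ : ρ.PosSemidef) (hσ : σ.PosSemidef) (hd : ¬ Dominated ρ σ)
    {n : ℕ} (hn : n ≠ 0) : ¬ Dominated (tensorPow ρ n) (tensorPow σ n) := fun h => by
  have hM := isPOVM_suppProj hσ
  have h1 := (hM.povmPow n).ac_of_dominated (tensorPow_posSemidef hσ n) h fun _ => false
  rw [hM.measure_povmPow hσ, hM.measure_povmPow hρ] at h1
  simp only [Finset.prod_const, measure_suppProj_right hσ, Finset.card_univ, Fintype.card_fin] at h1
  exact (pow_pos (measure_suppProj_left hρ hσ hd) n).ne' (h1 (zero_pow hn))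

lemma Orthogonal.tensorPow (h : Orthogonal ρ σ) {n : ℕ} (hn : n ≠ 0) :
    Orthogonal (tensorPow ρ n) (tensorPow σ n) := by
  have h0 : QuantumRenyi.tensorPow (0 : Matrix a a ℂ) n = 0 := by
    ext i j
    simp [QuantumRenyi.tensorPow, hn]
  exact ⟨by rw [← tensorPow_mul, h.1, h0], by rw [← tensorPow_mul, h.2, h0]⟩

end Binary

/-! ### The order `∞` -/

section OrderTop

variable {a κ : Type*} [Fintype a] [DecidableEq a] [Fintype κ] {ρ σ : Matrix a a ℂ}

lemma tensorPow_le_tensorPow {A B : Matrix a a ℂ} (hA : A.PosSemidef) (h : A ≤ B) (n : ℕ) :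
    tensorPow A n ≤ tensorPow B n := by
  have hB : B = ∑ x : Bool, if x then A else B - A := by simp
  rw [Matrix.le_iff]
  conv => enter [1, 1]; rw [tensorPow_eq_tprod, hB, tprod_sum,
    ← Finset.add_sum_erase _ _ (Finset.mem_univ fun _ => true)]
  simp only [if_true, tensorPow_eq_tprod, add_sub_cancel_left]
  refine posSemidef_sum _ fun y _ => tprod_posSemidef fun k => ?_
  split_ifs
  exacts [hA, Matrix.le_iff.1 h]

lemma tensorPow_smul (c : ℝ) (A : Matrix a a ℂ) (n : ℕ) :
    tensorPow (c • A) n = c ^ n • tensorPow A n := by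
  ext i j
  simp [tensorPow, Finset.prod_mul_distrib]

lemma IsPOVM.measure_le {M : κ → Matrix a a ℂ} (hM : IsPOVM M) {c : ℝ} (h : ρ ≤ c • σ) (i : κ) :
    measure M ρ i ≤ c * measure M σ i := by
  have h1 := rtr_mul_nonneg (Matrix.le_iff.1 h) (hM.posSemidef i)
  rw [Matrix.sub_mul, rtr_sub, Matrix.smul_mul, rtr_smul] at h1
  exact sub_nonneg.1 h1

lemma classicalDiv_top_le {M : κ → Matrix a a ℂ} (hM : IsPOVM M) (hρ : ρ.PosSemidef) {c : ℝ}
    (hc : 0 < c) (hle : ρ ≤ c • σ) :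
    classicalDiv ⊤ (measure M ρ) (measure M σ) ≤ ((Real.log c : ℝ) : EReal) := by
  classical
  rw [classicalDiv, if_pos rfl]
  refine iSup_le fun j => iSup_le fun hj => ?_
  have hp := (hM.measure_nonneg hρ j).lt_of_ne hj.symm
  have h1 := hM.measure_le hle j
  have hq : 0 < measure M σ j := pos_of_mul_pos_right (hp.trans_le h1) hc.le
  rw [if_neg hq.ne', EReal.coe_le_coe_iff]
  exact Real.log_le_log (div_pos hp hq) ((div_le_iff₀ hq).2 h1)

/-- If a measurement attains the largest likelihood ratio `c`, then `log c` is the maximum of the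
measured divergences of order `∞`. -/
lemma isGreatest_measuredDivs_top (hρ : ρ.PosSemidef) {c : ℝ} (hc : 0 < c)
    (hle : ρ ≤ c • σ) {M : κ → Matrix a a ℂ} (hM : IsPOVM M) {i : κ} (hi : 0 < measure M σ i)
    (hci : measure M ρ i = c * measure M σ i) :
    IsGreatest (measuredDivs ⊤ ρ σ) ((Real.log c : ℝ) : EReal) := by
  have hattain : ((Real.log c : ℝ) : EReal) ≤ classicalDiv ⊤ (measure M ρ) (measure M σ) := by
    rw [classicalDiv, if_pos rfl]
    refine le_iSup_of_le i (le_iSup_of_le (by rw [hci]; positivity) ?_)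
    rw [if_neg hi.ne', hci, mul_div_cancel_right₀ _ hi.ne']
  refine ⟨?_, ?_⟩
  · have h1 := classicalDiv_mem_measuredDivs hM ⊤ ρ σ
    rwa [le_antisymm (classicalDiv_top_le hM hρ hc hle) hattain] at h1
  · rintro _ ⟨k, M', hM', rfl⟩
    exact classicalDiv_top_le hM' hρ hc hle

/-- On `n` copies, the largest likelihood ratio is the `n`-th power of that of a single copy. -/
lemma isGreatest_measuredDivs_tensorPow_top (hρ : ρ.PosSemidef) (hσ : σ.PosSemidef)
    {c : ℝ} (hc : 0 < c)
    (hle : ρ ≤ c • σ) {N : Matrix a a ℂ} (hN : N.PosSemidef) (hN1 : N ≤ 1) (hσN : 0 < rtr (σ * N))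
    (hρN : rtr (ρ * N) = c * rtr (σ * N)) (n : ℕ) :
    IsGreatest (measuredDivs ⊤ (tensorPow ρ n) (tensorPow σ n))
      ((n * Real.log c : ℝ) : EReal) := by
  have hM := isPOVM_binaryPOVM hN hN1
  rw [← Real.log_pow]
  have h1 : ∀ τ : Matrix a a ℂ, τ.PosSemidef → measure (povmPow (binaryPOVM N) n) (tensorPow τ n)
      (fun _ => true) = rtr (τ * N) ^ n := fun τ hτ => by
    rw [hM.measure_povmPow hτ]
    simp [measure, binaryPOVM]
  refine isGreatest_measuredDivs_top (tensorPow_posSemidef hρ n) (pow_pos hc n) ?_ (hM.povmPow n)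
    (i := fun _ => true) ?_ ?_
  · rw [← tensorPow_smul]
    exact tensorPow_le_tensorPow hρ hle n
  · rw [h1 σ hσ]; exact pow_pos hσN n
  · rw [h1 σ hσ, h1 ρ hρ, hρN, mul_pow]

lemma sum_rpow_mul_rpow_le_of_ratio_le {p q : κ → ℝ} (hp : ∀ i, 0 ≤ p i) (hq : ∀ i, 0 ≤ q i) {c : ℝ}
    (hpq : ∀ i, p i ≤ c * q i) {β : ℝ} (hβ : 1 < β) :
    ∑ i, p i ^ β * q i ^ (1 - β) ≤ (∑ i, p i) * c ^ (β - 1) := by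
  rw [Finset.sum_mul]
  refine Finset.sum_le_sum fun i _ => ?_
  rcases (hp i).eq_or_lt with h0 | h0
  · rw [← h0, Real.zero_rpow (by linarith)]; simp
  have hqi : 0 < q i := (hq i).lt_of_ne fun h => by
    have := hpq i
    rw [← h, mul_zero] at this
    exact absurd h0 (not_lt.2 this)
  have h1 : p i ^ β * q i ^ (1 - β) = p i * (p i / q i) ^ (β - 1) := by
    rw [Real.div_rpow h0.le hqi.le, show 1 - β = -(β - 1) by ring, Real.rpow_neg hqi.le,
      div_eq_mul_inv, ← mul_assoc]
    congr 1
    conv_rhs => enter [1]; rw [← Real.rpow_one (p i)]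
    rw [← Real.rpow_add h0]
    congr 1; ring
  rw [h1]
  refine mul_le_mul_of_nonneg_left ?_ h0.le
  exact Real.rpow_le_rpow (by positivity) ((div_le_iff₀ hqi).2 (hpq i)) (by linarith)

/-- An operator inequality `ρ ≤ c σ` bounds all likelihood ratios on `n` copies by `c ^ n`. -/
lemma minimalQ_le_of_le_smul (hρ : ρ.PosSemidef) (hσ : σ.PosSemidef) {c : ℝ} (hc : 0 < c)
    (hle : ρ ≤ c • σ) {β : ℝ} (hβ : 1 < β) : minimalQ β ρ σ ≤ rtr ρ * c ^ (β - 1) := by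
  have hβ0 : 0 < β := by linarith
  refine le_of_pow_le_mul_pow (κ := Fintype.card a * β)
    (mul_nonneg (rtr_nonneg hρ) (by positivity)) fun n => ?_
  obtain ⟨W, r, m, hW⟩ := exists_isPinchingBasis hρ hσ n
  refine (hW.pow_le hρ hσ hβ0 hβ.ne').trans ?_
  have h1 : ∀ i, r i ≤ c ^ n * m i := fun i => by
    rw [← hW.measure_left, ← hW.measure_right]
    refine (isPOVM_basisPOVM hW.mul_conjTranspose_self).measure_le ?_ i
    rw [← tensorPow_smul]
    exact tensorPow_le_tensorPow hρ hle n
  have h2 := sum_rpow_mul_rpow_le_of_ratio_le hW.left_nonneg hW.right_nonneg h1 hβ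
  rw [hW.sum_left, rtr_tensorPow hρ, ← Real.rpow_pow_comm hc.le, ← mul_pow] at h2
  rw [Real.rpow_mul (by positivity), Real.rpow_natCast]
  exact mul_le_mul_of_nonneg_left h2 (by positivity)

/-- The limit of order `∞` is the logarithm of the largest likelihood ratio. -/
lemma tendsto_minimalDivReal_atTop (hρ : ρ.PosSemidef) (hσ : σ.PosSemidef) (hρ0 : ρ ≠ 0)
    {c : ℝ} (hc : 0 < c) (hle : ρ ≤ c • σ) {N : Matrix a a ℂ} (hN : N.PosSemidef) (hN1 : N ≤ 1)
    (hσN : 0 < rtr (σ * N)) (hρN : rtr (ρ * N) = c * rtr (σ * N)) (hd : Dominated ρ σ) :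
    Tendsto (fun β => minimalDivReal β ρ σ) atTop (𝓝 ((Real.log c : ℝ) : EReal)) := by
  have hP := rtr_pos hρ hρ0
  have hM := isPOVM_binaryPOVM hN hN1
  have hpos : 0 < rtr (ρ * N) := by rw [hρN]; positivity
  simp only [minimalDivReal_of_dominated hd]
  rw [EReal.tendsto_coe]
  have hlim : Tendsto (fun β : ℝ => Real.log c + 1 / (β - 1) * Real.log (rtr (ρ * N) / rtr ρ))
      atTop (𝓝 (Real.log c)) := by
    have h1 : Tendsto (fun β : ℝ => 1 / (β - 1)) atTop (𝓝 0) := by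
      simp only [one_div]
      exact tendsto_inv_atTop_zero.comp (tendsto_atTop_add_const_right _ (-1) tendsto_id)
    have h2 := (h1.mul_const (Real.log (rtr (ρ * N) / rtr ρ))).const_add (Real.log c)
    rwa [zero_mul, add_zero] at h2
  refine tendsto_of_tendsto_of_tendsto_of_le_of_le' hlim tendsto_const_nhds ?_ ?_
  · filter_upwards [eventually_gt_atTop 1] with β hβ
    have h1 := sum_measure_le_minimalQ hM hρ hσ hd hβ
    have hb : 0 < β - 1 := by linarith
    have h2 : rtr (ρ * N) * c ^ (β - 1) ≤ minimalQ β ρ σ := by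
      refine le_trans ?_ h1
      refine le_trans (le_of_eq ?_) (Finset.single_le_sum (fun x _ => mul_nonneg
        (Real.rpow_nonneg (hM.measure_nonneg hρ x) _) (Real.rpow_nonneg (hM.measure_nonneg hσ x) _))
        (Finset.mem_univ true))
      simp only [measure, binaryPOVM, if_true]
      rw [hρN, Real.mul_rpow hc.le hσN.le, mul_assoc (c ^ β), ← Real.rpow_add hσN,
        add_sub_cancel, Real.rpow_one]
      conv_rhs => enter [1]; rw [← sub_add_cancel β 1, Real.rpow_add_one hc.ne']
      ring
    have h3 := Real.log_le_log (by positivity) (div_le_div_of_nonneg_right h2 hP.le)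
    rw [mul_div_right_comm, Real.log_mul (by positivity) (by positivity), Real.log_rpow hc] at h3
    have h4 := mul_le_mul_of_nonneg_left h3 (one_div_nonneg.2 hb.le)
    refine le_trans (le_of_eq ?_) h4
    field_simp; ring
  · filter_upwards [eventually_gt_atTop 1] with β hβ
    have hb : 0 < β - 1 := by linarith
    have hQ := minimalQ_pos hρ hσ (by linarith : 0 < β) hβ.ne' fun ho =>
      not_dominated_of_orthogonal hσ hρ0 ho hd
    have h2 : minimalQ β ρ σ / rtr ρ ≤ c ^ (β - 1) :=
      (div_le_iff₀' hP).2 (minimalQ_le_of_le_smul hρ hσ hc hle hβ)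
    have h3 := Real.log_le_log (div_pos hQ hP) h2
    rw [Real.log_rpow hc] at h3
    rw [one_div, inv_mul_le_iff₀ hb]
    exact h3

lemma minimalDiv_top (ρ σ : Matrix a a ℂ) :
    minimalDiv ⊤ ρ σ = limUnder atTop (fun β : ℝ => minimalDivReal β ρ σ) := by
  rw [minimalDiv, if_pos rfl]

lemma tendsto_minimalDivReal_top (hρ : ρ.PosSemidef) (hσ : σ.PosSemidef) (hρ0 : ρ ≠ 0) :
    Tendsto (fun β => minimalDivReal β ρ σ) atTop (𝓝 (minimalDiv ⊤ ρ σ)) := by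
  rw [minimalDiv_top]
  refine tendsto_nhds_limUnder ?_
  by_cases hd : Dominated ρ σ
  · obtain ⟨c, N, hc, hle, hN, hN1, hσN, hρN⟩ := exists_max_ratio hρ hσ hρ0 hd
    exact ⟨_, tendsto_minimalDivReal_atTop hρ hσ hρ0 hc hle hN hN1 hσN hρN hd⟩
  · refine ⟨⊤, tendsto_const_nhds.congr' ?_⟩
    filter_upwards [eventually_ge_atTop 1] with β hβ
    exact (minimalDivReal_eq_top hd (Or.inl hβ)).symm

end OrderTop

/-! ### Attainment of the measured divergences -/

section Attainment

variable {a : Type*} [Fintype a] [DecidableEq a] {ρ σ : Matrix a a ℂ}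

lemma rtr_mul_smul (ρ N : Matrix a a ℂ) (c : ℝ) : rtr (ρ * c • N) = c * rtr (ρ * N) := by
  rw [Matrix.mul_smul, rtr_smul]

lemma continuous_rtr_mul (ρ : Matrix a a ℂ) : Continuous fun N : Matrix a a ℂ => rtr (ρ * N) :=
  continuous_rtr.comp (by fun_prop)

lemma nonempty_of_ne_zero (hρ0 : ρ ≠ 0) : Nonempty a := by
  by_contra h
  rw [not_nonempty_iff] at h
  exact hρ0 (Subsingleton.elim _ _)

/-- For `ρ ≪ σ`, a measured `f`-divergence `∑ x, q x * φ (p x / q x)` attains its maximum. -/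
lemma exists_optimal_perspective (hρ : ρ.PosSemidef) (hσ : σ.PosSemidef) (hρ0 : ρ ≠ 0)
    (hd : Dominated ρ σ) {φ : ℝ → ℝ} (hφ : Continuous φ) :
    ∃ (k : ℕ) (M : Fin k → Matrix a a ℂ), IsPOVM M ∧
      ∀ (l : ℕ) (M' : Fin l → Matrix a a ℂ), IsPOVM M' →
        ∑ i, measure M' σ i * φ (measure M' ρ i / measure M' σ i) ≤
          ∑ i, measure M σ i * φ (measure M ρ i / measure M σ i) := by
  have := nonempty_of_ne_zero hρ0
  obtain ⟨c, N, hc, hle, -⟩ := exists_max_ratio hρ hσ hρ0 hd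
  refine exists_optimal_povm (f := fun N => rtr (σ * N) * φ (rtr (ρ * N) / rtr (σ * N))) ?_ ?_
  · intro t N ht
    simp only [rtr_mul_smul]
    rcases ht.eq_or_lt with h0 | h0
    · rw [← h0]; simp
    · rw [mul_div_mul_left _ _ h0.ne', mul_assoc]
  · refine (continuousOn_perspective hφ c).comp
      ((continuous_rtr_mul ρ).prodMk (continuous_rtr_mul σ)).continuousOn fun N hN => ?_
    refine ⟨rtr_mul_nonneg hρ hN.1, rtr_mul_nonneg hσ hN.1, ?_⟩
    have h1 := rtr_mul_nonneg (Matrix.le_iff.1 hle) hN.1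
    rw [Matrix.sub_mul, rtr_sub, Matrix.smul_mul, rtr_smul] at h1
    exact sub_nonneg.1 h1

lemma exists_eq_ofReal {α : ℝ≥0∞} (hα : 1 / 2 ≤ α) (htop : α ≠ ⊤) :
    ∃ β : ℝ, 1 / 2 ≤ β ∧ α = ENNReal.ofReal β := by
  refine ⟨α.toReal, ?_, (ENNReal.ofReal_toReal htop).symm⟩
  have h := ENNReal.toReal_mono htop hα
  simpa using h

/-- The measured divergence attains its maximum over all measurements. -/
lemma exists_isGreatest_measuredDivs (hρ : ρ.PosSemidef) (hσ : σ.PosSemidef) (hρ0 : ρ ≠ 0)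
    {α : ℝ≥0∞} (hα : 1 / 2 ≤ α) : ∃ d, IsGreatest (measuredDivs α ρ σ) d := by
  have hP := rtr_pos hρ hρ0
  by_cases hbad : ¬ Dominated ρ σ ∧ (1 ≤ α ∨ Orthogonal ρ σ)
  · exact ⟨⊤, top_mem_measuredDivs hρ hσ hbad.1 hbad.2, fun _ _ => le_top⟩
  have hgood : Dominated ρ σ ∨ α < 1 ∧ ¬ Orthogonal ρ σ := by
    by_contra h
    push Not at h
    exact hbad ⟨h.1, (le_or_gt 1 α).imp_right h.2⟩
  have ho : ¬ Orthogonal ρ σ := by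
    rcases hgood with h | h
    exacts [fun ho => not_dominated_of_orthogonal hσ hρ0 ho h, h.2]
  rcases lt_trichotomy α 1 with hlt | rfl | hgt
  · -- order `α < 1`: minimize the concave functional `∑ x, p x ^ β * q x ^ (1 - β)`
    obtain ⟨β, hβ, rfl⟩ := exists_eq_ofReal hα (hlt.trans ENNReal.one_lt_top).ne
    have hβ1 : β < 1 := ENNReal.ofReal_lt_one.1 hlt
    have hβ0 : 0 < β := by linarith
    have := nonempty_of_ne_zero hρ0
    obtain ⟨k, M, hM, hmax⟩ := exists_optimal_povm
      (f := fun N => -(|rtr (ρ * N)| ^ β * |rtr (σ * N)| ^ (1 - β)))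
      (fun t N ht => by
        simp only [rtr_mul_smul, abs_mul, abs_of_nonneg ht]
        rw [Real.mul_rpow ht (abs_nonneg _), Real.mul_rpow ht (abs_nonneg _)]
        have h1 : t ^ β * t ^ (1 - β) = t := by
          rw [← Real.rpow_add_of_nonneg ht hβ0.le (by linarith), add_sub_cancel, Real.rpow_one]
        linear_combination (-(|rtr (ρ * N)| ^ β * |rtr (σ * N)| ^ (1 - β))) * h1)
      (by
        have h1 := (Real.continuous_rpow_const hβ0.le).comp (continuous_rtr_mul ρ).abs
        have h2 := (Real.continuous_rpow_const (by linarith : 0 ≤ 1 - β)).comp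
          (continuous_rtr_mul σ).abs
        exact (h1.mul h2).neg.continuousOn)
    refine ⟨_, ⟨k, M, hM, rfl⟩, ?_⟩
    rintro _ ⟨l, M', hM', rfl⟩
    have hS : ∀ {l : ℕ} {M : Fin l → Matrix a a ℂ}, IsPOVM M →
        0 < ∑ i, measure M ρ i ^ β * measure M σ i ^ (1 - β) := fun hM =>
      (minimalQ_pos hρ hσ hβ0 hβ1.ne ho).trans_le (minimalQ_le_sum_measure hM hρ hσ hβ hβ1)
    have habs : ∀ {l : ℕ} {M : Fin l → Matrix a a ℂ}, IsPOVM M →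
        ∑ i, -(|rtr (ρ * M i)| ^ β * |rtr (σ * M i)| ^ (1 - β)) =
          -∑ i, measure M ρ i ^ β * measure M σ i ^ (1 - β) := fun {l M} hM => by
      rw [Finset.sum_neg_distrib]
      refine congrArg _ (Finset.sum_congr rfl fun i _ => ?_)
      rw [abs_of_nonneg (rtr_mul_nonneg hρ (hM.posSemidef i)),
        abs_of_nonneg (rtr_mul_nonneg hσ (hM.posSemidef i))]
      rfl
    have h1 := hmax l M' hM'
    rw [habs hM, habs hM', neg_le_neg_iff] at h1
    rw [classicalDiv_ofReal_of_lt_one hβ0 hβ1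
        (exists_common_of_sum_ne_zero hβ0.ne' hβ1.ne (hS hM).ne'),
      classicalDiv_ofReal_of_lt_one hβ0 hβ1
        (exists_common_of_sum_ne_zero hβ0.ne' hβ1.ne (hS hM').ne'), hM.sum_measure,
      hM'.sum_measure, EReal.coe_le_coe_iff]
    refine mul_le_mul_of_nonpos_left (Real.log_le_log (div_pos (hS hM) hP) ?_)
      (one_div_nonpos.2 (by linarith))
    exact div_le_div_of_nonneg_right h1 hP.le
  · have hd := hgood.resolve_right fun h => lt_irrefl _ h.1
    obtain ⟨k, M, hM, hmax⟩ := exists_optimal_perspective hρ hσ hρ0 hd Real.continuous_mul_log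
    refine ⟨_, ⟨k, M, hM, rfl⟩, ?_⟩
    rintro _ ⟨l, M', hM', rfl⟩
    have hsum : ∀ {l : ℕ} {M : Fin l → Matrix a a ℂ}, IsPOVM M →
        ∑ i, measure M ρ i * (Real.log (measure M ρ i) - Real.log (measure M σ i)) =
          ∑ i, measure M σ i * (measure M ρ i / measure M σ i *
            Real.log (measure M ρ i / measure M σ i)) := fun {l M} hM => by
      refine Finset.sum_congr rfl fun i _ => ?_
      by_cases hp : measure M ρ i = 0
      · simp [hp]
      have hq : measure M σ i ≠ 0 := fun h => hp (hM.ac_of_dominated hσ hd i h)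
      rw [Real.log_div hp hq, ← mul_assoc, mul_div_cancel₀ _ hq]
    rw [classicalDiv_one_of_ac fun i => hM.ac_of_dominated hσ hd i,
      classicalDiv_one_of_ac fun i => hM'.ac_of_dominated hσ hd i, hM.sum_measure, hM'.sum_measure,
      EReal.coe_le_coe_iff, hsum hM, hsum hM']
    exact div_le_div_of_nonneg_right (hmax l M' hM') hP.le
  · have hd := hgood.resolve_right fun h => lt_asymm hgt h.1
    by_cases htop : α = ⊤
    · subst htop
      obtain ⟨c, N, hc, hle, hN, hN1, hσN, hρN⟩ := exists_max_ratio hρ hσ hρ0 hd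
      exact ⟨_, isGreatest_measuredDivs_top hρ hc hle (isPOVM_binaryPOVM hN hN1) (i := true)
        (by simpa [measure, binaryPOVM] using hσN) (by simpa [measure, binaryPOVM] using hρN)⟩
    obtain ⟨β, -, rfl⟩ := exists_eq_ofReal hα htop
    have hβ1 : 1 < β := ENNReal.one_lt_ofReal.1 hgt
    have hβ0 : 0 < β := by linarith
    obtain ⟨k, M, hM, hmax⟩ := exists_optimal_perspective hρ hσ hρ0 hd
      (Real.continuous_rpow_const hβ0.le)
    refine ⟨_, ⟨k, M, hM, rfl⟩, ?_⟩
    rintro _ ⟨l, M', hM', rfl⟩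
    have hsum : ∀ {l : ℕ} {M : Fin l → Matrix a a ℂ}, IsPOVM M →
        ∑ i, measure M ρ i ^ β * measure M σ i ^ (1 - β) =
          ∑ i, measure M σ i * (measure M ρ i / measure M σ i) ^ β := fun {l M} hM => by
      refine Finset.sum_congr rfl fun i _ => ?_
      rcases (hM.measure_nonneg hσ i).eq_or_lt with hq | hq
      · rw [hM.ac_of_dominated hσ hd i hq.symm, Real.zero_rpow hβ0.ne', ← hq]; simp
      rw [Real.div_rpow (hM.measure_nonneg hρ i) hq.le, Real.rpow_sub hq, Real.rpow_one]
      ring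
    have hS : ∀ {l : ℕ} {M : Fin l → Matrix a a ℂ}, IsPOVM M →
        0 < ∑ i, measure M ρ i ^ β * measure M σ i ^ (1 - β) := fun hM =>
      sum_rpow_mul_rpow_pos (hM.measure_nonneg hρ) (hM.measure_nonneg hσ) β
        (exists_common_of_ac (by rwa [hM.sum_measure]) fun i => hM.ac_of_dominated hσ hd i)
    rw [classicalDiv_ofReal_of_ac hβ0 hβ1.ne' fun i => hM.ac_of_dominated hσ hd i,
      classicalDiv_ofReal_of_ac hβ0 hβ1.ne' fun i => hM'.ac_of_dominated hσ hd i, hM.sum_measure,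
      hM'.sum_measure, EReal.coe_le_coe_iff]
    refine mul_le_mul_of_nonneg_left (Real.log_le_log (div_pos (hS hM') hP) ?_)
      (one_div_nonneg.2 (by linarith))
    rw [hsum hM, hsum hM']
    exact div_le_div_of_nonneg_right (hmax l M' hM') hP.le

end Attainment

/-! ### Properties of the minimal divergence -/

section Divergence

variable {a b : Type*} [Fintype a] [DecidableEq a] [Fintype b] [DecidableEq b]
  {ρ σ : Matrix a a ℂ}

lemma minimalDiv_ofReal {β : ℝ} (hβ : 0 ≤ β) (hβ1 : β ≠ 1) (ρ σ : Matrix a a ℂ) :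
    minimalDiv (ENNReal.ofReal β) ρ σ = minimalDivReal β ρ σ := by
  rw [minimalDiv, if_neg ENNReal.ofReal_ne_top, if_neg (ofReal_ne_one hβ1),
    ENNReal.toReal_ofReal hβ]

lemma minimalDiv_eq_top (hρ : ρ.PosSemidef) (hσ : σ.PosSemidef) (hρ0 : ρ ≠ 0) {α : ℝ≥0∞}
    (hα : 1 / 2 ≤ α) (hd : ¬ Dominated ρ σ) (h : 1 ≤ α ∨ Orthogonal ρ σ) :
    minimalDiv α ρ σ = ⊤ := by
  by_cases htop : α = ⊤
  · subst htop
    refine tendsto_nhds_unique (tendsto_minimalDivReal_top hρ hσ hρ0)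
      (tendsto_const_nhds.congr' ?_)
    filter_upwards [eventually_ge_atTop 1] with β hβ
    exact (minimalDivReal_eq_top hd (Or.inl hβ)).symm
  by_cases h1 : α = 1
  · subst h1
    exact tendsto_nhds_unique (tendsto_minimalDivReal_one hρ hσ hρ0)
      (tendsto_minimalDivReal_one_top hρ hσ hd)
  obtain ⟨β, hβ, rfl⟩ := exists_eq_ofReal hα htop
  rw [minimalDiv_ofReal (by linarith) fun h => h1 (by rw [h, ENNReal.ofReal_one])]
  exact minimalDivReal_eq_top hd (h.imp_left ENNReal.one_le_ofReal.1)

/-- Data processing at real orders. -/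
lemma minimalDivReal_channel_le {E : Matrix a a ℂ →ₗ[ℂ] Matrix b b ℂ} (hE : IsCPTP E)
    (hρ : ρ.PosSemidef) (hσ : σ.PosSemidef) (hρ0 : ρ ≠ 0) {β : ℝ} (hβ : 1 / 2 ≤ β) (hβ1 : β ≠ 1) :
    minimalDivReal β (E ρ) (E σ) ≤ minimalDivReal β ρ σ := by
  have hβ0 : 0 < β := by linarith
  obtain ⟨K, hK, hEK⟩ := hE.exists_kraus
  rw [hEK, hEK]
  have hρ' := kraus_posSemidef K hρ
  have hσ' := kraus_posSemidef K hσ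
  have hP := rtr_pos hρ hρ0
  rcases minimalDivReal_cases hρ hσ hρ0 hβ0 hβ1 with ⟨hQ, hd, -, h⟩ | ⟨-, -, h⟩
  swap
  · rw [h]; exact le_top
  rw [h]
  rcases lt_or_gt_of_ne hβ1 with hlt | hgt
  · have h1 := le_minimalQ_kraus hK hρ hσ hβ hlt
    rw [minimalDivReal_of_not_orthogonal hlt fun ho => (hQ.trans_le h1).ne'
      (minimalQ_eq_zero_of_orthogonal hσ' hβ hβ1 ho), rtr_kraus hK, EReal.coe_le_coe_iff]
    exact mul_le_mul_of_nonpos_left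
      (Real.log_le_log (div_pos hQ hP) (div_le_div_of_nonneg_right h1 hP.le))
      (one_div_nonpos.2 (by linarith))
  · have h1 := minimalQ_kraus_le hK hρ hσ (hd hgt) hgt
    have hd' := (hd hgt).kraus (K := K) hσ
    have hρ0' : kraus K ρ ≠ 0 := fun h0 => by
      have h2 := rtr_kraus hK ρ
      rw [h0] at h2
      rw [← h2] at hP
      simp [rtr] at hP
    have hQ' := minimalQ_pos hρ' hσ' hβ0 hβ1 fun ho =>
      not_dominated_of_orthogonal hσ' hρ0' ho hd'
    rw [minimalDivReal_of_dominated hd', rtr_kraus hK, EReal.coe_le_coe_iff]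
    exact mul_le_mul_of_nonneg_left
      (Real.log_le_log (div_pos hQ' hP) (div_le_div_of_nonneg_right h1 hP.le))
      (one_div_nonneg.2 (by linarith))

lemma eventually_half_le : ∀ᶠ β : ℝ in 𝓝[≠] 1, 1 / 2 ≤ β ∧ β ≠ 1 :=
  (eventually_nhdsWithin_of_eventually_nhds (eventually_ge_nhds (by norm_num))).and
    self_mem_nhdsWithin

/-- The data-processing inequality. The orders `1` and `∞` follow by passing to the limit. -/
lemma minimalDiv_channel_le {E : Matrix a a ℂ →ₗ[ℂ] Matrix b b ℂ} (hE : IsCPTP E)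
    (hρ : ρ.PosSemidef) (hσ : σ.PosSemidef) (hρ0 : ρ ≠ 0) {α : ℝ≥0∞} (hα : 1 / 2 ≤ α) :
    minimalDiv α (E ρ) (E σ) ≤ minimalDiv α ρ σ := by
  obtain ⟨K, hK, hEK⟩ := hE.exists_kraus
  have hρ' : (E ρ).PosSemidef := by rw [hEK]; exact kraus_posSemidef K hρ
  have hσ' : (E σ).PosSemidef := by rw [hEK]; exact kraus_posSemidef K hσ
  have hρ0' : E ρ ≠ 0 := fun h0 => by
    have h1 := rtr_kraus hK ρ
    rw [← hEK, h0] at h1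
    have h2 := rtr_pos hρ hρ0
    rw [← h1] at h2
    simp [rtr] at h2
  by_cases htop : α = ⊤
  · subst htop
    refine le_of_tendsto_of_tendsto (tendsto_minimalDivReal_top hρ' hσ' hρ0')
      (tendsto_minimalDivReal_top hρ hσ hρ0) ?_
    filter_upwards [eventually_gt_atTop 1] with β hβ
    exact minimalDivReal_channel_le hE hρ hσ hρ0 (by linarith) hβ.ne'
  by_cases h1 : α = 1
  · subst h1
    refine le_of_tendsto_of_tendsto (tendsto_minimalDivReal_one hρ' hσ' hρ0')
      (tendsto_minimalDivReal_one hρ hσ hρ0) ?_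
    filter_upwards [eventually_half_le] with β hβ
    exact minimalDivReal_channel_le hE hρ hσ hρ0 hβ.1 hβ.2
  obtain ⟨β, hβ, rfl⟩ := exists_eq_ofReal hα htop
  have hβ1 : β ≠ 1 := fun h => h1 (by rw [h, ENNReal.ofReal_one])
  rw [minimalDiv_ofReal (by linarith) hβ1, minimalDiv_ofReal (by linarith) hβ1]
  exact minimalDivReal_channel_le hE hρ hσ hρ0 hβ hβ1

end Divergence

/-! ### Joint convexity of the divergence -/

section Convexity

variable {a : Type*} [Fintype a] [DecidableEq a] {ρ₀ ρ₁ σ₀ σ₁ : Matrix a a ℂ}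

/-- Joint convexity at orders below `1`: `minimalQ` is jointly concave, and
`x ↦ log x / (β - 1)` is convex and decreasing. -/
lemma minimalDivReal_add_le (hρ₀ : ρ₀.PosSemidef) (hρ₁ : ρ₁.PosSemidef) (hσ₀ : σ₀.PosSemidef)
    (hσ₁ : σ₁.PosSemidef) (h0 : ρ₀ ≠ 0) (htr : rtr ρ₀ = rtr ρ₁) {β : ℝ} (hβ : 1 / 2 ≤ β)
    (hβ1 : β < 1) {s t : ℝ} (hs : 0 < s) (ht : 0 < t) (hst : s + t = 1) :
    minimalDivReal β (s • ρ₀ + t • ρ₁) (s • σ₀ + t • σ₁) ≤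
      (s : EReal) * minimalDivReal β ρ₀ σ₀ + (t : EReal) * minimalDivReal β ρ₁ σ₁ := by
  have hβ0 : 0 < β := by linarith
  have hP := rtr_pos hρ₀ h0
  have h1 : ρ₁ ≠ 0 := fun h => by
    rw [htr, h] at hP
    simp [rtr] at hP
  have hs' : (0 : EReal) < s := EReal.coe_pos.2 hs
  have ht' : (0 : EReal) < t := EReal.coe_pos.2 ht
  rcases minimalDivReal_cases hρ₀ hσ₀ h0 hβ0 hβ1.ne with ⟨hQ₀, -, -, e₀⟩ | ⟨-, -, e₀⟩ <;>
    rcases minimalDivReal_cases hρ₁ hσ₁ h1 hβ0 hβ1.ne with ⟨hQ₁, -, -, e₁⟩ | ⟨-, -, e₁⟩ <;>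
    rw [e₀, e₁]
  · have hle := le_minimalQ_add hρ₀ hρ₁ hσ₀ hσ₁ hβ hβ1 hs.le ht.le
    have hpos : 0 < s * minimalQ β ρ₀ σ₀ + t * minimalQ β ρ₁ σ₁ := by positivity
    have htr' : rtr (s • ρ₀ + t • ρ₁) = rtr ρ₀ := by
      rw [rtr_add, rtr_smul, rtr_smul, ← htr, ← add_mul, hst, one_mul]
    rw [minimalDivReal_of_not_orthogonal hβ1 fun ho => (hpos.trans_le hle).ne'
      (minimalQ_eq_zero_of_orthogonal ((hσ₀.smul hs.le).add (hσ₁.smul ht.le)) hβ hβ1.ne ho), htr',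
      ← htr, ← EReal.coe_mul, ← EReal.coe_mul, ← EReal.coe_add, EReal.coe_le_coe_iff]
    have hlog := strictConcaveOn_log_Ioi.concaveOn.2 (Set.mem_Ioi.2 (div_pos hQ₀ hP))
      (Set.mem_Ioi.2 (div_pos hQ₁ hP)) hs.le ht.le hst
    simp only [smul_eq_mul] at hlog
    have h2 : Real.log (s * (minimalQ β ρ₀ σ₀ / rtr ρ₀) + t * (minimalQ β ρ₁ σ₁ / rtr ρ₀)) ≤
        Real.log (minimalQ β (s • ρ₀ + t • ρ₁) (s • σ₀ + t • σ₁) / rtr ρ₀) := by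
      refine Real.log_le_log (by positivity) ?_
      rw [← mul_div_assoc, ← mul_div_assoc, ← add_div]
      exact div_le_div_of_nonneg_right hle hP.le
    have h3 := mul_le_mul_of_nonpos_left (hlog.trans h2)
      (one_div_nonpos.2 (by linarith : β - 1 ≤ 0))
    linarith
  · rw [EReal.mul_top_of_pos ht', ← EReal.coe_mul, EReal.coe_add_top]
    exact le_top
  · rw [EReal.mul_top_of_pos hs', ← EReal.coe_mul, EReal.top_add_coe]
    exact le_top
  · rw [EReal.mul_top_of_pos hs', EReal.mul_top_of_pos ht', EReal.top_add_top]
    exact le_top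

lemma minimalDiv_one_ne_bot {ρ σ : Matrix a a ℂ} (hρ : ρ.PosSemidef) (hσ : σ.PosSemidef)
    (hρ0 : ρ ≠ 0) : minimalDiv 1 ρ σ ≠ ⊥ := by
  by_cases hd : Dominated ρ σ
  · obtain ⟨D, hD⟩ := exists_tendsto_log_minimalQ hρ hσ hρ0 hd
    have h1 := tendsto_minimalDivReal_one hρ hσ hρ0
    simp only [minimalDivReal_of_dominated hd] at h1
    rw [tendsto_nhds_unique h1 (EReal.tendsto_coe.2 hD)]
    exact EReal.coe_ne_bot D
  · rw [tendsto_nhds_unique (tendsto_minimalDivReal_one hρ hσ hρ0)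
      (tendsto_minimalDivReal_one_top hρ hσ hd)]
    exact top_ne_bot

/-- Joint convexity of the divergence. The order `1` is a limit of orders below `1`. -/
lemma minimalDiv_add_le (hρ₀ : ρ₀.PosSemidef) (hρ₁ : ρ₁.PosSemidef) (hσ₀ : σ₀.PosSemidef)
    (hσ₁ : σ₁.PosSemidef) (h0 : ρ₀ ≠ 0) (htr : rtr ρ₀ = rtr ρ₁) {α : ℝ≥0∞} (hα : 1 / 2 ≤ α)
    (hα1 : α ≤ 1) {s t : ℝ} (hs : 0 ≤ s) (ht : 0 ≤ t) (hst : s + t = 1) :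
    minimalDiv α (s • ρ₀ + t • ρ₁) (s • σ₀ + t • σ₁) ≤
      (s : EReal) * minimalDiv α ρ₀ σ₀ + (t : EReal) * minimalDiv α ρ₁ σ₁ := by
  rcases hs.eq_or_lt with rfl | hs
  · rw [zero_add] at hst
    simp [hst]
  rcases ht.eq_or_lt with rfl | ht
  · rw [add_zero] at hst
    simp [hst]
  rcases hα1.eq_or_lt with rfl | hα1
  · have h1 : ρ₁ ≠ 0 := fun h => by
      have := rtr_pos hρ₀ h0
      rw [htr, h] at this
      simp [rtr] at this
    have hρ := (hρ₀.smul hs.le).add (hρ₁.smul ht.le)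
    have hσ := (hσ₀.smul hs.le).add (hσ₁.smul ht.le)
    have hρ0 : s • ρ₀ + t • ρ₁ ≠ 0 := fun h => by
      have h2 : rtr (s • ρ₀ + t • ρ₁) = rtr ρ₀ := by
        rw [rtr_add, rtr_smul, rtr_smul, ← htr, ← add_mul, hst, one_mul]
      have h3 := rtr_pos hρ₀ h0
      rw [← h2, h] at h3
      simp [rtr] at h3
    have hmono : 𝓝[<] (1 : ℝ) ≤ 𝓝[≠] 1 := nhdsWithin_mono 1 fun x (hx : x < 1) => hx.ne
    have hmul : ∀ {r : ℝ}, 0 < r → ∀ {ρ σ : Matrix a a ℂ}, ρ.PosSemidef → σ.PosSemidef → ρ ≠ 0 →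
        Tendsto (fun β => (r : EReal) * minimalDivReal β ρ σ) (𝓝[<] 1)
          (𝓝 ((r : EReal) * minimalDiv 1 ρ σ)) := fun {r} hr {ρ σ} hρ hσ hρ0 =>
      EReal.Tendsto.const_mul ((tendsto_minimalDivReal_one hρ hσ hρ0).mono_left hmono)
        (Or.inl (EReal.coe_ne_bot r)) (Or.inl (EReal.coe_ne_top r))
    have hbot : ∀ {r : ℝ}, 0 < r → ∀ {x : EReal}, x ≠ ⊥ → (r : EReal) * x ≠ ⊥ := by
      intro r hr x hx
      induction x with
      | bot => exact absurd rfl hx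
      | coe x => rw [← EReal.coe_mul]; exact EReal.coe_ne_bot _
      | top => rw [EReal.coe_mul_top_of_pos hr]; exact top_ne_bot
    have hadd := (EReal.continuousAt_add
      (p := ((s : EReal) * minimalDiv 1 ρ₀ σ₀, (t : EReal) * minimalDiv 1 ρ₁ σ₁))
      (Or.inr (hbot ht (minimalDiv_one_ne_bot hρ₁ hσ₁ h1)))
      (Or.inl (hbot hs (minimalDiv_one_ne_bot hρ₀ hσ₀ h0)))).tendsto.comp
      ((hmul hs hρ₀ hσ₀ h0).prodMk_nhds (hmul ht hρ₁ hσ₁ h1))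
    refine le_of_tendsto_of_tendsto ((tendsto_minimalDivReal_one hρ hσ hρ0).mono_left hmono) hadd ?_
    filter_upwards [eventually_half_le.filter_mono hmono, self_mem_nhdsWithin] with β hβ hβ1
    exact minimalDivReal_add_le hρ₀ hρ₁ hσ₀ hσ₁ h0 htr hβ.1 hβ1 hs ht hst
  · obtain ⟨β, hβ, rfl⟩ := exists_eq_ofReal hα (hα1.trans ENNReal.one_lt_top).ne
    have hβ1 : β < 1 := ENNReal.ofReal_lt_one.1 hα1
    simp only [minimalDiv_ofReal (by linarith : 0 ≤ β) hβ1.ne]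
    exact minimalDivReal_add_le hρ₀ hρ₁ hσ₀ hσ₁ h0 htr hβ hβ1 hs ht hst

end Convexity

/-! ### Asymptotic achievability -/

section Asymptotics

variable {a κ : Type*} [Fintype a] [DecidableEq a] {ρ σ : Matrix a a ℂ}

lemma inv_mul_le_of_le {n : ℕ} (hn : n ≠ 0) {D : ℝ} {x : EReal} (h : x ≤ ((n * D : ℝ) : EReal)) :
    (((n : ℝ)⁻¹ : ℝ) : EReal) * x ≤ D := by
  have hn' : (n : ℝ) ≠ 0 := Nat.cast_ne_zero.2 hn
  refine (mul_le_mul_of_nonneg_left h (EReal.coe_nonneg.2 (by positivity))).trans (le_of_eq ?_)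
  rw [← EReal.coe_mul, inv_mul_cancel_left₀ hn']

lemma tendsto_log_div : Tendsto (fun n : ℕ => (n : ℝ)⁻¹ * Real.log ((n : ℝ) + 1)) atTop (𝓝 0) := by
  have h1 : Tendsto (fun n : ℕ => Real.log ((n : ℝ) + 1) / ((n : ℝ) + 1)) atTop (𝓝 0) := by
    have h := Real.isLittleO_log_id_atTop.tendsto_div_nhds_zero.comp
      (tendsto_atTop_add_const_right atTop (1 : ℝ) tendsto_natCast_atTop_atTop)
    exact h
  have h2 : Tendsto (fun n : ℕ => 1 + (n : ℝ)⁻¹) atTop (𝓝 (1 + 0)) :=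
    tendsto_const_nhds.add tendsto_inv_atTop_nhds_zero_nat
  have h3 := h2.mul h1
  rw [mul_zero] at h3
  refine h3.congr' ?_
  filter_upwards [eventually_gt_atTop 0] with n hn
  have hn' : (n : ℝ) ≠ 0 := Nat.cast_ne_zero.2 hn.ne'
  field_simp

lemma eventually_lt_inv_mul {C D : ℝ} {m : ℕ → EReal}
    (h : ∀ n : ℕ, ((n * D - C * Real.log ((n : ℝ) + 1) : ℝ) : EReal) ≤ m n) {z : EReal}
    (hz : z < D) : ∀ᶠ n : ℕ in atTop, z < (((n : ℝ)⁻¹ : ℝ) : EReal) * m n := by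
  have h1 : Tendsto (fun n : ℕ => D - C * ((n : ℝ)⁻¹ * Real.log ((n : ℝ) + 1))) atTop (𝓝 D) := by
    have := (tendsto_log_div.const_mul C).const_sub D
    rwa [mul_zero, sub_zero] at this
  filter_upwards [(EReal.tendsto_coe.2 h1).eventually (lt_mem_nhds hz), eventually_gt_atTop 0]
    with n hn hn0
  have hn' : (n : ℝ) ≠ 0 := Nat.cast_ne_zero.2 hn0.ne'
  refine hn.trans_le (le_trans (le_of_eq ?_)
    (mul_le_mul_of_nonneg_left (h n) (EReal.coe_nonneg.2 (by positivity))))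
  rw [← EReal.coe_mul, EReal.coe_eq_coe_iff]
  field_simp

lemma minimalDivReal_ne_bot (β : ℝ) (ρ σ : Matrix a a ℂ) : minimalDivReal β ρ σ ≠ ⊥ := by
  rw [minimalDivReal]
  split_ifs
  exacts [EReal.coe_ne_bot _, top_ne_bot]

/-- Measurements on `n` copies give at most `n` times the divergence. -/
lemma inv_mul_classicalDiv_le (hρ : ρ.PosSemidef) (hσ : σ.PosSemidef) (hρ0 : ρ ≠ 0) {β : ℝ}
    (hβ : 1 / 2 ≤ β) (hβ1 : β ≠ 1) {n : ℕ} (hn : n ≠ 0) [Fintype κ] [DecidableEq κ]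
    {M : κ → Matrix (Fin n → a) (Fin n → a) ℂ} (hM : IsPOVM M) :
    (((n : ℝ)⁻¹ : ℝ) : EReal) * classicalDiv (ENNReal.ofReal β) (measure M (tensorPow ρ n))
      (measure M (tensorPow σ n)) ≤ minimalDivReal β ρ σ := by
  rcases hD : minimalDivReal β ρ σ with _ | _ | D
  · exact absurd hD (minimalDivReal_ne_bot β ρ σ)
  · exact le_top
  · refine inv_mul_le_of_le hn ?_
    rw [← minimalDivReal_tensorPow hρ hσ hρ0 hβ hβ1 hD n]
    exact classicalDiv_measure_le hM (tensorPow_posSemidef hρ n) (tensorPow_posSemidef hσ n)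
      (tensorPow_ne_zero hρ hρ0 n) hβ hβ1

/-- The measured divergences of `n` copies, divided by `n`, converge to the minimal divergence. -/
lemma tendsto_inv_mul_measured (hρ : ρ.PosSemidef) (hσ : σ.PosSemidef) (hρ0 : ρ ≠ 0) {α : ℝ≥0∞}
    (hα : 1 / 2 ≤ α) {m : ℕ → EReal}
    (hm : ∀ n, IsGreatest (measuredDivs α (tensorPow ρ n) (tensorPow σ n)) (m n)) :
    Tendsto (fun n : ℕ => (((n : ℝ)⁻¹ : ℝ) : EReal) * m n) atTop (𝓝 (minimalDiv α ρ σ)) := by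
  by_cases hbad : ¬ Dominated ρ σ ∧ (1 ≤ α ∨ Orthogonal ρ σ)
  · rw [minimalDiv_eq_top hρ hσ hρ0 hα hbad.1 hbad.2]
    refine tendsto_const_nhds.congr' ?_
    filter_upwards [eventually_gt_atTop 0] with n hn
    have h1 := top_mem_measuredDivs (α := α) (tensorPow_posSemidef hρ n) (tensorPow_posSemidef hσ n)
      (not_dominated_tensorPow hρ hσ hbad.1 hn.ne')
      (hbad.2.imp_right fun ho => ho.tensorPow hn.ne')
    rw [top_le_iff.1 ((hm n).2 h1), EReal.coe_mul_top_of_pos]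
    positivity
  have hdom : 1 ≤ α → Dominated ρ σ := fun h => by
    by_contra hd
    exact hbad ⟨hd, Or.inl h⟩
  by_cases htop : α = ⊤
  · subst htop
    have hd := hdom le_top
    obtain ⟨c, N, hc, hle, hN, hN1, hσN, hρN⟩ := exists_max_ratio hρ hσ hρ0 hd
    rw [tendsto_nhds_unique (tendsto_minimalDivReal_top hρ hσ hρ0)
      (tendsto_minimalDivReal_atTop hρ hσ hρ0 hc hle hN hN1 hσN hρN hd)]
    refine tendsto_const_nhds.congr' ?_
    filter_upwards [eventually_gt_atTop 0] with n hn
    have hn' : (n : ℝ) ≠ 0 := Nat.cast_ne_zero.2 hn.ne'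
    rw [(hm n).unique (isGreatest_measuredDivs_tensorPow_top hρ hσ hc hle hN hN1 hσN hρN n),
      ← EReal.coe_mul, inv_mul_cancel_left₀ hn']
  by_cases h1 : α = 1
  · subst h1
    have hd := hdom le_rfl
    have hlim := tendsto_minimalDivReal_one hρ hσ hρ0
    refine tendsto_order.2 ⟨fun z hz => ?_, fun z hz => ?_⟩
    · -- an order `β < 1` whose divergence still exceeds `z`
      have hmono : 𝓝[<] (1 : ℝ) ≤ 𝓝[≠] 1 := nhdsWithin_mono 1 fun x (hx : x < 1) => hx.ne
      obtain ⟨β, hβz, ⟨hβ, -⟩, hβ1 : β < 1⟩ := (((hlim.mono_left hmono).eventually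
        (lt_mem_nhds hz)).and ((eventually_half_le.filter_mono hmono).and
          self_mem_nhdsWithin)).exists
      have hD := minimalDivReal_of_dominated hd β
      obtain ⟨C, hC⟩ := exists_le_classicalDiv hρ hσ hρ0 (by linarith) hβ1.ne hD
      rw [hD] at hβz
      refine eventually_lt_inv_mul (C := C) (fun n => ?_) hβz
      obtain ⟨W, hW, hWle⟩ := hC n
      refine (hWle.trans ?_).trans ((hm n).2 (classicalDiv_mem_measuredDivs hW 1 _ _))
      refine classicalDiv_ofReal_le_one (hW.measure_nonneg (tensorPow_posSemidef hρ n))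
        (hW.measure_nonneg (tensorPow_posSemidef hσ n)) ?_ (by linarith) hβ1
      rw [hW.sum_measure]
      exact rtr_pos (tensorPow_posSemidef hρ n) (tensorPow_ne_zero hρ hρ0 n)
    · -- for orders `β > 1`, the divergence bounds the measured divergence of order `1`
      filter_upwards [eventually_gt_atTop 0] with n hn
      refine lt_of_le_of_lt ?_ hz
      obtain ⟨k, M, hM, hMm⟩ := (hm n).1
      have hmono : 𝓝[>] (1 : ℝ) ≤ 𝓝[≠] 1 := nhdsWithin_mono 1 fun x (hx : 1 < x) => hx.ne'
      refine ge_of_tendsto (hlim.mono_left hmono) ?_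
      filter_upwards [self_mem_nhdsWithin] with β (hβ : 1 < β)
      refine le_trans (mul_le_mul_of_nonneg_left ?_ (EReal.coe_nonneg.2 (by positivity)))
        (inv_mul_classicalDiv_le hρ hσ hρ0 (by linarith) hβ.ne' hn.ne' hM)
      rw [hMm]
      refine classicalDiv_one_le_ofReal (hM.measure_nonneg (tensorPow_posSemidef hρ n))
        (hM.measure_nonneg (tensorPow_posSemidef hσ n)) ?_ hβ
      rw [hM.sum_measure]
      exact rtr_pos (tensorPow_posSemidef hρ n) (tensorPow_ne_zero hρ hρ0 n)
  · obtain ⟨β, hβ, rfl⟩ := exists_eq_ofReal hα htop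
    have hβ1 : β ≠ 1 := fun h => h1 (by rw [h, ENNReal.ofReal_one])
    have hβ0 : 0 < β := by linarith
    rw [minimalDiv_ofReal hβ0.le hβ1]
    have hD : ∃ D : ℝ, minimalDivReal β ρ σ = D := by
      rcases minimalDivReal_cases hρ hσ hρ0 hβ0 hβ1 with ⟨-, -, -, h⟩ | ⟨hd, h, -⟩
      · exact ⟨_, h⟩
      · exact absurd ⟨hd, h.imp_left ENNReal.one_le_ofReal.2⟩ hbad
    obtain ⟨D, hD⟩ := hD
    refine tendsto_order.2 ⟨fun z hz => ?_, fun z hz => ?_⟩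
    · obtain ⟨C, hC⟩ := exists_le_classicalDiv hρ hσ hρ0 hβ0 hβ1 hD
      rw [hD] at hz
      refine eventually_lt_inv_mul (C := C) (fun n => ?_) hz
      obtain ⟨W, hW, hWle⟩ := hC n
      exact hWle.trans ((hm n).2 (classicalDiv_mem_measuredDivs hW _ _ _))
    · filter_upwards [eventually_gt_atTop 0] with n hn
      refine lt_of_le_of_lt ?_ hz
      obtain ⟨k, M, hM, hMm⟩ := (hm n).1
      rw [hMm]
      exact inv_mul_classicalDiv_le hρ hσ hρ0 hβ hβ1 hn.ne' hM

end Asymptotics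

end QuantumRenyi

end

theorem mainTheorem1 {a b : Type*} [Fintype a] [DecidableEq a] [Fintype b] [DecidableEq b]
    (α : ℝ≥0∞) (hα : 1 / 2 ≤ α) :
    -- the limits that define the orders `1` and `∞` exist
    (∀ ρ σ : Matrix a a ℂ, ρ.PosSemidef → σ.PosSemidef → ρ ≠ 0 →
      Tendsto (fun β : ℝ => minimalDivReal β ρ σ) (𝓝[≠] 1) (𝓝 (minimalDiv 1 ρ σ)) ∧
      Tendsto (fun β : ℝ => minimalDivReal β ρ σ) atTop (𝓝 (minimalDiv ⊤ ρ σ))) ∧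
    -- joint concavity of `Q_α` for `α < 1`, joint convexity for `1 < α < ∞`
    (α < 1 → ConcaveOn ℝ
      {p : Matrix a a ℂ × Matrix a a ℂ | p.1.PosSemidef ∧ p.2.PosSemidef}
      (fun p => minimalQ α.toReal p.1 p.2)) ∧
    (1 < α → α ≠ ⊤ → ConvexOn ℝ
      {p : Matrix a a ℂ × Matrix a a ℂ | p.1.PosSemidef ∧ p.2.PosSemidef ∧ Dominated p.1 p.2}
      (fun p => minimalQ α.toReal p.1 p.2)) ∧
    -- joint convexity of the divergence, for first arguments of equal trace
    (1 / 2 < α → α ≤ 1 → ∀ ρ₀ ρ₁ σ₀ σ₁ : Matrix a a ℂ,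
      ρ₀.PosSemidef → ρ₁.PosSemidef → σ₀.PosSemidef → σ₁.PosSemidef →
      ρ₀ ≠ 0 → ρ₀.trace = ρ₁.trace → ∀ s t : ℝ, 0 ≤ s → 0 ≤ t → s + t = 1 →
      minimalDiv α (s • ρ₀ + t • ρ₁) (s • σ₀ + t • σ₁) ≤
        (s : EReal) * minimalDiv α ρ₀ σ₀ + (t : EReal) * minimalDiv α ρ₁ σ₁) ∧
    -- data-processing inequality
    (∀ E : Matrix a a ℂ →ₗ[ℂ] Matrix b b ℂ, IsCPTP E →
      ∀ ρ σ : Matrix a a ℂ, ρ.PosSemidef → σ.PosSemidef → ρ ≠ 0 →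
      minimalDiv α (E ρ) (E σ) ≤ minimalDiv α ρ σ) ∧
    -- asymptotic achievability by a measurement
    (∀ ρ σ : Matrix a a ℂ, ρ.PosSemidef → σ.PosSemidef → ρ ≠ 0 →
      ∃ m : ℕ → EReal,
        (∀ n, IsGreatest (measuredDivs α (tensorPow ρ n) (tensorPow σ n)) (m n)) ∧
        Tendsto (fun n : ℕ => (((n : ℝ)⁻¹ : ℝ) : EReal) * m n) atTop (𝓝 (minimalDiv α ρ σ))) := by
  refine ⟨fun ρ σ hρ hσ hρ0 =>
    ⟨tendsto_minimalDivReal_one hρ hσ hρ0, tendsto_minimalDivReal_top hρ hσ hρ0⟩,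
    fun hα1 => ?_, fun hα1 htop => ?_, fun _ hα1 ρ₀ ρ₁ σ₀ σ₁ hρ₀ hρ₁ hσ₀ hσ₁ h0 htr s t hs ht hst =>
      minimalDiv_add_le hρ₀ hρ₁ hσ₀ hσ₁ h0 (by rw [rtr, htr, rtr]) hα hα1 hs ht hst,
    fun E hE ρ σ hρ hσ hρ0 => minimalDiv_channel_le hE hρ hσ hρ0 hα, fun ρ σ hρ hσ hρ0 => ?_⟩
  · obtain ⟨β, hβ, rfl⟩ := exists_eq_ofReal hα (hα1.trans ENNReal.one_lt_top).ne
    rw [ENNReal.toReal_ofReal (by linarith)]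
    refine ⟨fun p hp q hq s t hs ht _ =>
      ⟨(hp.1.smul hs).add (hq.1.smul ht), (hp.2.smul hs).add (hq.2.smul ht)⟩,
      fun p hp q hq s t hs ht _ => ?_⟩
    exact le_minimalQ_add hp.1 hq.1 hp.2 hq.2 hβ (ENNReal.ofReal_lt_one.1 hα1) hs ht
  · obtain ⟨β, hβ, rfl⟩ := exists_eq_ofReal hα htop
    rw [ENNReal.toReal_ofReal (by linarith)]
    refine ⟨fun p hp q hq s t hs ht _ =>
      ⟨(hp.1.smul hs).add (hq.1.smul ht), (hp.2.1.smul hs).add (hq.2.1.smul ht),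
        (hp.2.2.smul s).add (hp.2.1.smul hs) (hq.2.1.smul ht) (hq.2.2.smul t)⟩,
      fun p hp q hq s t hs ht _ => ?_⟩
    exact minimalQ_add_le hp.1 hq.1 hp.2.1 hq.2.1 hp.2.2 hq.2.2 (ENNReal.one_lt_ofReal.1 hα1) hs ht
  · choose m hm using fun n => exists_isGreatest_measuredDivs (tensorPow_posSemidef hρ n)
      (tensorPow_posSemidef hσ n) (tensorPow_ne_zero hρ hρ0 n) hα
    exact ⟨m, hm, tendsto_inv_mul_measured hρ hσ hρ0 hα hm⟩
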